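/- Let $\mathbb K$ be a field of characteristic $0$ and let $\mathfrak g, V$ be $\mathbb K$-vector spaces. For $\mu\in\mathrm{Hom}(\wedge^2\mathfrak g,\mathfrak g)$, a linear map $\rho:\mathfrak g\to\mathfrak{gl}(V)$ and a linear map $T:V\to\mathfrak g$, the triple $((\mathfrak g,\mu),\rho,T)$ is a relative Rota-Baxter Lie algebra if $\mu$ is a Lie bracket, $\rho$ is a representation of $(\mathfrak g,\mu)$ on $V$, and $\mu(Tu,Tv)=T(\rho(Tu)v-\rho(Tv)u)$ for all $u,v\in V$. Let $L=\bigoplus_{n\ge 0}C^n$, $C^n=\mathrm{Hom}(\wedge^{n+1}(\mathfrak g\oplus V),\mathfrak g\oplus V)$, with the Nijenhuis-Richardson bracket $[P,Q]=P\bar\circ Q-(-1)^{pq}Q\bar\circ P$ for $P\in C^p$, $Q\in C^q$, where $$(P\bar\circ Q)(x_1,\dots,x_{p+q+1})=\sum_{\sigma}(-1)^\sigma P(Q(x_{\sigma(1)},\dots,x_{\sigma(q+1)}),x_{\sigma(q+2)},\dots,x_{\sigma(p+q+1)}),$$ the sum being over the $(q+1,p)$-shuffles. Let $C^{k|l}\subset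 C^{k+l}$ be the subspace of maps sending $\wedge^{k+1}\mathfrak g\otimes\wedge^l V$ to $\mathfrak g$, $\wedge^k\mathfrak g\otimes\wedge^{l+1}V$ to $V$, and vanishing on all other $\wedge^a\mathfrak g\otimes\wedge^bV$. Put $L'=\bigoplus_{n\ge0}C^{n|0}$ and $\mathfrak h=\bigoplus_{n\ge0}C^{-1|n+1}=\bigoplus_{n\ge0}\mathrm{Hom}(\wedge^{n+1}V,\mathfrak g)$, and let $P:L\to L$ be the projection onto $\mathfrak h$ along the other bidegrees. On the $\mathbb Z$-graded space $s^{-1}L'\oplus\mathfrak h$, where $(s^{-1}L')^m=(L')^{m+1}$, consider the degree $1$ graded symmetric multilinear brackets $l_k$, $k\ge1$, determined by $$l_2(s^{-1}Q,s^{-1}Q')=(-1)^{Q}s^{-1}[Q,Q'],\qquad l_k(s^{-1}Q,\theta_1,\dots,\theta_{k-1})=P[\cdots[[Q,\theta_1],\theta_2],\cdots,\theta_{k-1}]\quad(k\ge2)$$ for homogeneous $Q,Q'\in L'$ and $\theta_i\in\mathfrak h$, and by vanishing on all other combinations. A weakly filtered $L_\infty$-algebra is an $L_\infty$-algebra $E$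 with a descending filtration $E=F_1\supset F_2\supset\cdots$ by graded subspaces such that $l_k(E,\dots,E)\subset F_k$ for all sufficiently large $k$ and, in each degree, the natural map $E\to\varprojlim E/F_n$ is an isomorphism. Its Maurer-Cartan elements are the $\alpha\in E^0$ with $\sum_{k\ge1}\frac1{k!}l_k(\alpha,\dots,\alpha)=0$, and twisting by such an $\alpha$ gives the brackets $l_k^\alpha(x_1,\dots,x_k)=\sum_{n\ge0}\frac1{n!}l_{k+n}(\alpha,\dots,\alpha,x_1,\dots,x_k)$; the series converge with respect to the filtration. **Theorem.** Let $((\mathfrak g,\mu),\rho,T)$ be a relative Rota-Baxter Lie algebra, and let $\pi=\mu+\rho\in C^{1|0}$ be the map $((x,u),(y,v))\mapsto(\mu(x,y),\rho(x)v-\rho(y)u)$. Then $(s^{-1}L'\oplus\mathfrak h,\{l_k\})$ is an $L_\infty$-algebra, weakly filtered by $F_1=s^{-1}L'\oplus\mathfrak h$ and $F_n=\bigoplus_{j\ge n-1}\mathrm{Hom}(\wedge^jV,\mathfrak g)$ for $n\ge2$. Moreover, for every filtration by which $(s^{-1}L'\oplus\mathfrak h,\{l_k\})$ is weakly filtered: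 1. $(s^{-1}\pi,T)$ is a Maurer-Cartan element, the series defining the twisted brackets converge, and $(s^{-1}L'\oplus\mathfrak h,\{l_k^{(s^{-1}\pi,T)}\}_{k\ge1})$ is again a weakly filtered $L_\infty$-algebra with the same filtration. 2. For all $\mu'\in\mathrm{Hom}(\wedge^2\mathfrak g,\mathfrak g)$ and all linear maps $\rho':\mathfrak g\to\mathfrak{gl}(V)$, $T':V\to\mathfrak g$, the triple $((\mathfrak g,\mu+\mu'),\rho+\rho',T+T')$ is a relative Rota-Baxter Lie algebra if and only if $(s^{-1}(\mu'+\rho'),T')$ is a Maurer-Cartan element of the twisted $L_\infty$-algebra $(s^{-1}L'\oplus\mathfrak h,\{l_k^{(s^{-1}\pi,T)}\}_{k\ge1})$. -/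

import Mathlib

namespace RelRB

open Equiv

/-- The `(i, n - i)`-shuffles: the permutations that are increasing on the first `i` and on the
last `n - i` positions. -/
def shuffles (i n : ℕ) : Finset (Perm (Fin n)) :=
  open Classical in
  Finset.univ.filter fun σ =>
    (∀ j k : Fin n, j < k → (k : ℕ) < i → σ j < σ k) ∧
    (∀ j k : Fin n, j < k → i ≤ (j : ℕ) → σ j < σ k)

/-- The permutation of `a + b` letters that permutes the first `a` and the last `b` letters
separately. -/
def blockPerm {a b : ℕ} (τ : Perm (Fin a) × Perm (Fin b)) : Perm (Fin (a + b)) :=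
  finSumFinEquiv.permCongr (Equiv.sumCongr τ.1 τ.2)

theorem blockPerm_castAdd {a b : ℕ} (τ : Perm (Fin a) × Perm (Fin b)) (j : Fin a) :
    blockPerm τ (Fin.castAdd b j) = Fin.castAdd b (τ.1 j) := by
  simp [blockPerm, Equiv.permCongr_apply]

theorem blockPerm_natAdd {a b : ℕ} (τ : Perm (Fin a) × Perm (Fin b)) (j : Fin b) :
    blockPerm τ (Fin.natAdd a j) = Fin.natAdd a (τ.2 j) := by
  simp [blockPerm, Equiv.permCongr_apply]

theorem mem_shuffles_add {a b : ℕ} (σ : Perm (Fin (a + b))) :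
    σ ∈ shuffles a (a + b) ↔
      StrictMono (fun j : Fin a => σ (Fin.castAdd b j)) ∧
      StrictMono (fun j : Fin b => σ (Fin.natAdd a j)) := by
  simp only [shuffles, Finset.mem_filter, Finset.mem_univ, true_and]
  constructor
  · rintro ⟨h1, h2⟩
    exact ⟨fun j k h => h1 _ _ ((Fin.strictMono_castAdd b) h) (by simp),
      fun j k h => h2 _ _ (by simpa using h) (by simp)⟩
  · rintro ⟨h1, h2⟩
    refine ⟨fun j k hjk hk => ?_, fun j k hjk hj => ?_⟩
    · have := @h1 ⟨j, by omega⟩ ⟨k, hk⟩ (by simpa using hjk)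
      simpa using this
    · have := @h2 ⟨j - a, by omega⟩ ⟨k - a, by omega⟩ (by
        simp only [Fin.mk_lt_mk]; have : (j : ℕ) < k := hjk; omega)
      have e1 : Fin.natAdd a (⟨j - a, by omega⟩ : Fin b) = j := by ext; simp; omega
      have e2 : Fin.natAdd a (⟨k - a, by omega⟩ : Fin b) = k := by
        ext; simp; have : (j : ℕ) < k := hjk; omega
      simpa [e1, e2] using this

theorem shuffle_blockPerm_bijective (a b : ℕ) :
    Function.Bijective (fun x : shuffles a (a + b) × (Perm (Fin a) × Perm (Fin b)) =>
      (x.1 : Perm (Fin (a + b))) * blockPerm x.2) := by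
  constructor
  · rintro ⟨⟨s, hs⟩, τ⟩ ⟨⟨s', hs'⟩, τ'⟩ h
    rw [mem_shuffles_add] at hs hs'
    simp only at h
    have h1 : ∀ j, s (Fin.castAdd b (τ.1 j)) = s' (Fin.castAdd b (τ'.1 j)) := fun j => by
      have := congrArg (fun e : Perm (Fin (a + b)) => e (Fin.castAdd b j)) h
      simpa [blockPerm_castAdd] using this
    have h2 : ∀ j, s (Fin.natAdd a (τ.2 j)) = s' (Fin.natAdd a (τ'.2 j)) := fun j => by
      have := congrArg (fun e : Perm (Fin (a + b)) => e (Fin.natAdd a j)) h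
      simpa [blockPerm_natAdd] using this
    have r1 : (fun j : Fin a => s (Fin.castAdd b j)) = fun j : Fin a => s' (Fin.castAdd b j) := by
      refine (StrictMono.range_inj hs.1 hs'.1).1 ?_
      rw [← τ.1.surjective.range_comp, ← τ'.1.surjective.range_comp (fun j => s' (Fin.castAdd b j))]
      exact congrArg Set.range (funext h1)
    have r2 : (fun j : Fin b => s (Fin.natAdd a j)) = fun j : Fin b => s' (Fin.natAdd a j) := by
      refine (StrictMono.range_inj hs.2 hs'.2).1 ?_
      rw [← τ.2.surjective.range_comp, ← τ'.2.surjective.range_comp (fun j => s' (Fin.natAdd a j))]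
      exact congrArg Set.range (funext h2)
    have hss : s = s' := by
      ext j
      refine congrArg _ (Fin.addCases (fun j => congrFun r1 j) (fun j => congrFun r2 j) j)
    subst hss
    have e1 : τ.1 = τ'.1 := Equiv.ext fun j => by simpa using h1 j
    have e2 : τ.2 = τ'.2 := Equiv.ext fun j => by simpa using h2 j
    simp [Prod.ext_iff, e1, e2]
  · intro σ
    let t1 := Tuple.sort (fun j : Fin a => σ (Fin.castAdd b j))
    let t2 := Tuple.sort (fun j : Fin b => σ (Fin.natAdd a j))
    have m1 := Tuple.monotone_sort (fun j : Fin a => σ (Fin.castAdd b j))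
    have m2 := Tuple.monotone_sort (fun j : Fin b => σ (Fin.natAdd a j))
    refine ⟨⟨⟨σ * blockPerm (t1, t2), ?_⟩, (t1⁻¹, t2⁻¹)⟩, ?_⟩
    · rw [mem_shuffles_add]
      constructor
      · simp only [Perm.mul_apply, blockPerm_castAdd]
        exact m1.strictMono_of_injective (σ.injective.comp
          ((Fin.castAdd_injective a b).comp t1.injective))
      · simp only [Perm.mul_apply, blockPerm_natAdd]
        exact m2.strictMono_of_injective (σ.injective.comp
          ((Fin.natAdd_injective b a).comp t2.injective))
    · ext j
      refine congrArg _ (Fin.addCases (fun j => ?_) (fun j => ?_) j)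
      · simp [blockPerm_castAdd]
      · simp [blockPerm_natAdd]

theorem sum_shuffles {M : Type*} [AddCommMonoid M] {a b : ℕ} (G : Perm (Fin (a + b)) → M)
    (hG : ∀ σ τ, G (σ * blockPerm τ) = G σ) :
    ∑ σ, G σ = (a.factorial * b.factorial) • ∑ σ ∈ shuffles a (a + b), G σ := by
  rw [← (shuffle_blockPerm_bijective a b).sum_comp G, Fintype.sum_prod_type]
  simp only [hG, Finset.sum_const, ← Finset.smul_sum]
  rw [Finset.sum_coe_sort (shuffles a (a+b)) G]
  simp [Fintype.card_perm]

/-! ### Cochains and the Nijenhuis–Richardson bracket -/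

/-- `C^n(W, W) = Hom(⋀^{n+1} W, W)`. -/
abbrev Cochain (K W : Type*) [Field K] [AddCommGroup W] [Module K W] (n : ℕ) :=
  W [⋀^Fin (n + 1)]→ₗ[K] W

section NijenhuisRichardson

variable {K W : Type*} [Field K] [AddCommGroup W] [Module K W]

/-- The argument list `(Q(y₁, …, y_{q+1}), y_{q+2}, …, y_{p+q+1})` of `P`. -/
def insertArgs {p q : ℕ} (Q : Cochain K W q) (y : Fin (p + q + 1) → W) : Fin (p + 1) → W :=
  Fin.cons (α := fun _ => W) (Q fun j : Fin (q + 1) => y ⟨j, by omega⟩)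
    (fun j : Fin p => y ⟨q + 1 + j, by omega⟩)

theorem insertArgs_update_lt {p q : ℕ} (Q : Cochain K W q) (y : Fin (p + q + 1) → W)
    (i : Fin (p + q + 1)) (hi : (i : ℕ) < q + 1) (a : W) :
    insertArgs Q (Function.update y i a) = Function.update (insertArgs Q y) 0
      (Q (Function.update (fun j : Fin (q + 1) => y ⟨j, by omega⟩) ⟨i, hi⟩ a)) := by
  rw [insertArgs, insertArgs, Fin.update_cons_zero]
  congr 1
  · congr 1
    funext j
    simp [Function.update_apply, Fin.ext_iff]
  · funext j
    rw [Function.update_of_ne]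
    simp only [ne_eq, Fin.ext_iff]
    omega

theorem insertArgs_update_ge {p q : ℕ} (Q : Cochain K W q) (y : Fin (p + q + 1) → W)
    (i : Fin (p + q + 1)) (hi : ¬ (i : ℕ) < q + 1) (a : W) :
    insertArgs Q (Function.update y i a) =
      Function.update (insertArgs Q y) (Fin.succ ⟨i - (q + 1), by omega⟩) a := by
  rw [insertArgs, insertArgs, ← Fin.cons_update]
  congr 1
  · congr 1
    funext j
    rw [Function.update_of_ne]
    simp only [ne_eq, Fin.ext_iff]
    omega
  · funext j
    simp only [Function.update_apply, Fin.ext_iff]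
    congr 1
    simp only [eq_iff_iff]
    omega

/-- `y ↦ P(Q(y₁, …, y_{q+1}), y_{q+2}, …, y_{p+q+1})`. -/
def insertFirst {p q : ℕ} (P : Cochain K W p) (Q : Cochain K W q) :
    MultilinearMap K (fun _ : Fin (p + q + 1) => W) W :=
  MultilinearMap.mk' (fun y => P (insertArgs Q y))
    (fun y i a b => by
      by_cases hi : (i : ℕ) < q + 1
      · simp only [insertArgs_update_lt _ _ _ hi, AlternatingMap.map_update_add]
      · simp only [insertArgs_update_ge _ _ _ hi, AlternatingMap.map_update_add])
    (fun y i c a => by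
      by_cases hi : (i : ℕ) < q + 1
      · simp only [insertArgs_update_lt _ _ _ hi, AlternatingMap.map_update_smul]
      · simp only [insertArgs_update_ge _ _ _ hi, AlternatingMap.map_update_smul])

theorem insertFirst_apply {p q : ℕ} (P : Cochain K W p) (Q : Cochain K W q)
    (y : Fin (p + q + 1) → W) : insertFirst P Q y = P (insertArgs Q y) := rfl

theorem insertFirst_blockPerm {p q n : ℕ} (P : Cochain K W p) (Q : Cochain K W q)
    (h : p + q + 1 = n) (h' : (q + 1) + p = n)
    (τ : Perm (Fin (q + 1)) × Perm (Fin p)) (y : Fin n → W) :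
    insertFirst P Q (fun j => y ((finCongr h').permCongr (blockPerm τ) (Fin.cast h j))) =
      Perm.sign (blockPerm τ) • insertFirst P Q (fun j => y (Fin.cast h j)) := by
  subst h'
  have hs : Perm.sign (blockPerm τ) = Perm.sign τ.1 * Perm.sign τ.2 := by
    rw [blockPerm, Perm.sign_permCongr, Perm.sign_sumCongr]
  have e1 : ∀ j : Fin (q + 1), blockPerm τ (Fin.cast h ⟨j, by omega⟩) =
      Fin.castAdd p (τ.1 j) := fun j => by rw [← blockPerm_castAdd]; rfl
  have e2 : ∀ j : Fin p, blockPerm τ (Fin.cast h ⟨q + 1 + j, by omega⟩) =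
      Fin.natAdd (q + 1) (τ.2 j) := fun j => by rw [← blockPerm_natAdd]; rfl
  rw [insertFirst_apply, insertFirst_apply, hs]
  have e3 : insertArgs (p := p) Q
      (fun j => y ((finCongr rfl).permCongr (blockPerm τ) (Fin.cast h j))) =
      Fin.cons (α := fun _ => W) (Perm.sign τ.1 • Q fun j => y (Fin.castAdd p j))
        (fun j => y (Fin.natAdd (q + 1) (τ.2 j))) := by
    rw [insertArgs, ← Q.map_perm]
    congr 1
    · congr 1
      funext j
      exact congrArg y (e1 j)
    · funext j
      exact congrArg y (e2 j)
  let τ' : Perm (Fin (p + 1)) := Perm.decomposeFin.symm (0, τ.2)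
  have e4 : (Fin.cons (α := fun _ => W) (Perm.sign τ.1 • Q fun j => y (Fin.castAdd p j))
        (fun j => y (Fin.natAdd (q + 1) (τ.2 j))) : Fin (p + 1) → W) =
      (Fin.cons (α := fun _ => W) (Perm.sign τ.1 • Q fun j => y (Fin.castAdd p j))
        (fun j => y (Fin.natAdd (q + 1) j)) : Fin (p + 1) → W) ∘ τ' := by
    funext j
    refine Fin.cases ?_ (fun j => ?_) j
    · simp [τ']
    · simp [τ']
  have hsτ : Perm.sign τ' = Perm.sign τ.2 := by
    simp [τ', Perm.decomposeFin.symm_sign]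
  rw [e3, e4, P.map_perm, hsτ]
  have e5 : insertArgs (p := p) Q (fun j => y (Fin.cast h j)) =
      Fin.cons (α := fun _ => W) (Q fun j => y (Fin.castAdd p j))
        (fun j => y (Fin.natAdd (q + 1) j)) := rfl
  rw [e5, mul_comm, mul_smul]
  congr 1
  rw [Units.smul_def, Units.smul_def]
  generalize (Perm.sign τ.1 : ℤ) = c
  have := P.toMultilinearMap.cons_smul (fun j => y (Fin.natAdd (q + 1) j)) (c : K)
    (Q fun j => y (Fin.castAdd p j))
  rw [Int.cast_smul_eq_zsmul, Int.cast_smul_eq_zsmul] at this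
  exact this

theorem sum_shuffles_insertFirst {p q n : ℕ} (P : Cochain K W p) (Q : Cochain K W q)
    (h : p + q + 1 = n) (h' : (q + 1) + p = n) (x : Fin n → W) :
    ∑ σ : Perm (Fin n), Perm.sign σ • insertFirst P Q (fun j => x (σ (Fin.cast h j))) =
      ((q + 1).factorial * p.factorial) • ∑ σ ∈ shuffles (q + 1) n,
        Perm.sign σ • insertFirst P Q (fun j => x (σ (Fin.cast h j))) := by
  subst h'
  refine sum_shuffles _ fun σ τ => ?_
  have := insertFirst_blockPerm P Q h rfl τ (fun j => x (σ j))
  simp only [Perm.mul_apply]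
  rw [show (fun j => x (σ (blockPerm τ (Fin.cast h j)))) =
    fun j => x (σ ((finCongr rfl).permCongr (blockPerm τ) (Fin.cast h j))) from rfl, this,
    smul_smul, map_mul, mul_assoc, Int.units_mul_self, mul_one]

/-- `P ∘̄ Q`, the sum over `(q+1, p)`-shuffles `σ` of
`(-1)^σ P(Q(x_{σ(1)}, …, x_{σ(q+1)}), x_{σ(q+2)}, …, x_{σ(p+q+1)})`. -/
def circ [CharZero K] {p q : ℕ} (P : Cochain K W p) (Q : Cochain K W q) :
    Cochain K W (p + q) where
  toMultilinearMap := ∑ σ ∈ shuffles (q + 1) (p + q + 1),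
    Perm.sign σ • (insertFirst P Q).domDomCongr σ
  map_eq_zero_of_eq' x i j hx hij := by
    have h1 := sum_shuffles_insertFirst P Q rfl (by omega) x
    have h2 := (MultilinearMap.alternatization (insertFirst P Q)).map_eq_zero_of_eq x hx hij
    rw [MultilinearMap.alternatization_apply] at h2
    have h3 : ((q + 1).factorial * p.factorial) • ∑ σ ∈ shuffles (q + 1) (p + q + 1),
        Perm.sign σ • insertFirst P Q (fun j => x (σ j)) = 0 := h1.symm.trans h2
    rw [← Nat.cast_smul_eq_nsmul K, smul_eq_zero] at h3
    have h4 := h3.resolve_left (by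
      exact_mod_cast (Nat.mul_pos (Nat.factorial_pos _) (Nat.factorial_pos _)).ne')
    simpa [sum_apply] using h4

theorem circ_apply [CharZero K] {p q : ℕ} (P : Cochain K W p) (Q : Cochain K W q)
    (x : Fin (p + q + 1) → W) :
    circ P Q x = ∑ σ ∈ shuffles (q + 1) (p + q + 1),
      (Perm.sign σ : ℤ) • P (Fin.cons (α := fun _ => W)
        (Q fun j : Fin (q + 1) => x (σ ⟨j, by omega⟩))
        (fun j : Fin p => x (σ ⟨q + 1 + j, by omega⟩))) := by
  change (∑ σ ∈ shuffles (q + 1) (p + q + 1),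
    Perm.sign σ • (insertFirst P Q).domDomCongr σ) x = _
  rw [sum_apply]
  rfl

end NijenhuisRichardson

section NijenhuisRichardsonAlgebra

variable (K W : Type*) [Field K] [CharZero K] [AddCommGroup W] [Module K W]

/-- `∘̄` as a bilinear map. -/
def circHom (p q : ℕ) :
    Cochain K W p →ₗ[K] Cochain K W q →ₗ[K] Cochain K W (p + q) :=
  LinearMap.mk₂ K (fun P Q => circ P Q)
    (fun P P' Q => by
      ext x
      simp only [circ_apply, AlternatingMap.add_apply, smul_add, Finset.sum_add_distrib])
    (fun c P Q => by
      ext x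
      simp only [circ_apply, AlternatingMap.smul_apply, Finset.smul_sum]
      exact Finset.sum_congr rfl fun σ _ => smul_comm _ _ _)
    (fun P Q Q' => by
      ext x
      simp only [circ_apply, AlternatingMap.add_apply, ← Finset.sum_add_distrib, ← smul_add]
      exact Finset.sum_congr rfl fun σ _ => congrArg _ (P.toMultilinearMap.cons_add _ _ _))
    (fun c P Q => by
      ext x
      simp only [circ_apply, AlternatingMap.smul_apply, Finset.smul_sum]
      refine Finset.sum_congr rfl fun σ _ => ?_
      rw [smul_comm c]
      exact congrArg _ (P.toMultilinearMap.cons_smul _ _ _))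

/-- `L = C^*(W, W) = ⨁_{n ≥ 0} C^n(W, W)`. -/
abbrev CochainAlg := DirectSum ℕ fun n => Cochain K W n

/-- `[P, Q] = P ∘̄ Q - (-1)^{pq} Q ∘̄ P` for `P` of degree `p` and `Q` of degree `q`. -/
def nrHom (p q : ℕ) : Cochain K W p →ₗ[K] Cochain K W q →ₗ[K] CochainAlg K W :=
  LinearMap.mk₂ K
    (fun P Q => DirectSum.lof K ℕ (fun n => Cochain K W n) (p + q) (circHom K W p q P Q) -
      (-1 : K) ^ (p * q) •
        DirectSum.lof K ℕ (fun n => Cochain K W n) (q + p) (circHom K W q p Q P))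
    (fun P P' Q => by simp only [map_add, LinearMap.add_apply, smul_add]; abel)
    (fun c P Q => by simp only [map_smul, LinearMap.smul_apply, smul_sub, smul_comm c])
    (fun P Q Q' => by simp only [map_add, LinearMap.add_apply, smul_add]; abel)
    (fun c P Q => by simp only [map_smul, LinearMap.smul_apply, smul_sub, smul_comm c])

/-- The Nijenhuis–Richardson bracket on `L`. -/
def nrBracket : CochainAlg K W →ₗ[K] CochainAlg K W →ₗ[K] CochainAlg K W :=
  DirectSum.toModule K ℕ _ fun p =>
    (DirectSum.toModule K ℕ _ fun q => (nrHom K W p q).flip).flip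

/-- `nestedBracket [θ₁, …, θ_k] Q = [⋯[[Q, θ₁], θ₂], ⋯, θ_k]`. -/
def nestedBracket : List (CochainAlg K W) → (CochainAlg K W →ₗ[K] CochainAlg K W)
  | [] => LinearMap.id
  | θ :: θs => nestedBracket θs ∘ₗ (nrBracket K W).flip θ

variable {K W}

theorem nrBracket_lof (p q : ℕ) (P : Cochain K W p) (Q : Cochain K W q) :
    nrBracket K W (DirectSum.lof K ℕ (fun n => Cochain K W n) p P)
        (DirectSum.lof K ℕ (fun n => Cochain K W n) q Q) =
      DirectSum.lof K ℕ (fun n => Cochain K W n) (p + q) (circ P Q) -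
        (-1 : K) ^ (p * q) •
          DirectSum.lof K ℕ (fun n => Cochain K W n) (q + p) (circ Q P) := by
  simp [nrBracket, nrHom, circHom, DirectSum.toModule_lof]

end NijenhuisRichardsonAlgebra

/-- The operator on `L` that multiplies an element of degree `m` by `(-1)^{r m}`. -/
def signTwist (K W : Type*) [Field K] [AddCommGroup W] [Module K W] (r : ℕ) : CochainAlg K W →ₗ[K] CochainAlg K W :=
  DirectSum.toModule K ℕ _ fun m =>
    (-1 : K) ^ (r * m) • DirectSum.lof K ℕ (fun n => Cochain K W n) m

theorem signTwist_apply {K W : Type*} [Field K] [AddCommGroup W]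
    [Module K W] (r m : ℕ) (Q : CochainAlg K W) :
    signTwist K W r Q m = (-1 : K) ^ (r * m) • Q m := by
  classical
  induction Q using DirectSum.induction_on with
  | zero => simp
  | of i x =>
    rw [← DirectSum.lof_eq_of K, signTwist, DirectSum.toModule_lof, LinearMap.smul_apply,
      DirectSum.smul_apply]
    by_cases h : i = m
    · subst h; rfl
    · rw [DirectSum.lof_eq_of, DirectSum.of_eq_of_ne _ _ _ (Ne.symm h), smul_zero, smul_zero]
  | add x y hx hy => rw [map_add, DirectSum.add_apply, DirectSum.add_apply, hx, hy, smul_add]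

/-! ### Bidegrees -/

section Bidegree

variable (K 𝔤 V : Type*) [Field K] [AddCommGroup 𝔤] [Module K 𝔤] [AddCommGroup V] [Module K V]

/-- `x i ∈ 𝔤` for `i ∈ S` and `x i ∈ V` for `i ∉ S`. -/
def IsPure {𝔤 V : Type*} [AddCommGroup 𝔤] [AddCommGroup V] {m : ℕ} (S : Finset (Fin m))
    (x : Fin m → 𝔤 × V) : Prop :=
  ∀ i, (i ∈ S → (x i).2 = 0) ∧ (i ∉ S → (x i).1 = 0)

/-- `C^{k|l}(𝔤 ⊕ V, 𝔤 ⊕ V)`, as a subspace of `C^n(𝔤 ⊕ V, 𝔤 ⊕ V)`; here `n = k + l`. It is tested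
on families of `a` vectors of `𝔤` and `b` vectors of `V`, where `a + b = n + 1`: the value lies
in `𝔤` if `(a, b) = (k + 1, l)`, in `V` if `(a, b) = (k, l + 1)`, and is `0` otherwise. -/
def bidegree (n : ℕ) (k l : ℤ) : Submodule K (Cochain K (𝔤 × V) n) where
  carrier := {f | ∀ (S : Finset (Fin (n + 1))) (x : Fin (n + 1) → 𝔤 × V), IsPure S x →
    (((S.card : ℤ) = k + 1 ∧ (Sᶜ.card : ℤ) = l) → (f x).2 = 0) ∧
    (((S.card : ℤ) = k ∧ (Sᶜ.card : ℤ) = l + 1) → (f x).1 = 0) ∧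
    (¬ ((S.card : ℤ) = k + 1 ∧ (Sᶜ.card : ℤ) = l) →
      ¬ ((S.card : ℤ) = k ∧ (Sᶜ.card : ℤ) = l + 1) → f x = 0)}
  zero_mem' S x _ := by simp
  add_mem' {f f'} hf hf' S x hx := by
    obtain ⟨a, b, c⟩ := hf S x hx
    obtain ⟨a', b', c'⟩ := hf' S x hx
    exact ⟨fun h => by simp [a h, a' h], fun h => by simp [b h, b' h],
      fun h h' => by simp [c h h', c' h h']⟩
  smul_mem' r f hf S x hx := by
    obtain ⟨a, b, c⟩ := hf S x hx
    exact ⟨fun h => by simp [a h], fun h => by simp [b h], fun h h' => by simp [c h h']⟩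

variable {K 𝔤 V}

theorem card_compl_add_card {n : ℕ} (S : Finset (Fin n)) : S.card + Sᶜ.card = n := by
  simp

theorem mem_bidegree_zero_iff {n : ℕ} (f : Cochain K (𝔤 × V) n) :
    f ∈ bidegree K 𝔤 V n n 0 ↔
      ∀ (S : Finset (Fin (n + 1))) (x : Fin (n + 1) → 𝔤 × V), IsPure S x →
        (Sᶜ.card = 0 → (f x).2 = 0) ∧ (Sᶜ.card = 1 → (f x).1 = 0) ∧
        (2 ≤ Sᶜ.card → f x = 0) := by
  refine forall_congr' fun S => forall_congr' fun x => forall_congr' fun _ => ?_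
  have := card_compl_add_card S
  refine and_congr (imp_congr (by omega) Iff.rfl) (and_congr (imp_congr (by omega) Iff.rfl) ?_)
  rw [← and_imp]
  exact imp_congr (by omega) Iff.rfl

theorem card_compl_eq_sum {n : ℕ} (S : Finset (Fin n)) :
    Sᶜ.card = ∑ i, if i ∈ S then 0 else 1 := by
  rw [Finset.sum_ite, Finset.sum_const_zero, zero_add, Finset.card_eq_sum_ones]
  congr 1
  ext; simp

theorem circ_mem_bidegree_zero [CharZero K] {p q : ℕ} {P : Cochain K (𝔤 × V) p}
    {Q : Cochain K (𝔤 × V) q} (hP : P ∈ bidegree K 𝔤 V p p 0)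
    (hQ : Q ∈ bidegree K 𝔤 V q q 0) :
    circ P Q ∈ bidegree K 𝔤 V (p + q) (p + q : ℕ) 0 := by
  classical
  rw [mem_bidegree_zero_iff] at hP hQ ⊢
  intro S x hx
  have key : ∀ σ : Perm (Fin (p + q + 1)),
      (Sᶜ.card = 0 → (P (Fin.cons (α := fun _ => 𝔤 × V)
        (Q fun j : Fin (q + 1) => x (σ ⟨j, by omega⟩))
        (fun j : Fin p => x (σ ⟨q + 1 + j, by omega⟩)))).2 = 0) ∧
      (Sᶜ.card = 1 → (P (Fin.cons (α := fun _ => 𝔤 × V)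
        (Q fun j : Fin (q + 1) => x (σ ⟨j, by omega⟩))
        (fun j : Fin p => x (σ ⟨q + 1 + j, by omega⟩)))).1 = 0) ∧
      (2 ≤ Sᶜ.card → P (Fin.cons (α := fun _ => 𝔤 × V)
        (Q fun j : Fin (q + 1) => x (σ ⟨j, by omega⟩))
        (fun j : Fin p => x (σ ⟨q + 1 + j, by omega⟩))) = 0) := by
    intro σ
    set y : Fin (q + 1) → 𝔤 × V := fun j => x (σ ⟨j, by omega⟩) with hy
    set z : Fin p → 𝔤 × V := fun j => x (σ ⟨q + 1 + j, by omega⟩) with hz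
    let S₁ : Finset (Fin (q + 1)) := Finset.univ.filter fun j => σ ⟨j, by omega⟩ ∈ S
    have hy' : IsPure S₁ y := fun i => by simpa [S₁, hy] using hx (σ ⟨i, by omega⟩)
    let c : ℕ := ∑ j : Fin p, if σ ⟨q + 1 + j, by omega⟩ ∈ S then 0 else 1
    have hc : Sᶜ.card = S₁ᶜ.card + c := by
      rw [card_compl_eq_sum S, card_compl_eq_sum S₁, ← Equiv.sum_comp σ,
        ← Equiv.sum_comp (finCongr (show (q + 1) + p = p + q + 1 by omega)), Fin.sum_univ_add]
      congr 1
      exact Finset.sum_congr rfl fun j _ => by simp [S₁]; rfl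
    let S₂ (b : Prop) : Finset (Fin (p + 1)) :=
      Finset.univ.filter fun i => Fin.cons (α := fun _ => Prop) b
        (fun j : Fin p => σ ⟨q + 1 + j, by omega⟩ ∈ S) i
    have hS₂ : ∀ b : Prop, (S₂ b)ᶜ.card = (if b then 0 else 1) + c := fun b => by
      rw [card_compl_eq_sum, Fin.sum_univ_succ]
      simp [S₂, c]
    have hpure : ∀ (b : Prop) (w : 𝔤 × V), (b → w.2 = 0) → (¬ b → w.1 = 0) →
        IsPure (S₂ b) (Fin.cons (α := fun _ => 𝔤 × V) w z) := by
      intro b w h1 h2 i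
      refine Fin.cases ?_ (fun j => ?_) i
      · simp only [S₂, Finset.mem_filter, Finset.mem_univ, true_and, Fin.cons_zero]
        exact ⟨h1, h2⟩
      · simpa [S₂, hz] using hx (σ ⟨q + 1 + j, by omega⟩)
    obtain ⟨q0, q1, q2⟩ := hQ S₁ y hy'
    rcases Nat.lt_or_ge S₁ᶜ.card 2 with h | h
    · rcases Nat.lt_or_ge S₁ᶜ.card 1 with h0 | h0
      · have h0 : S₁ᶜ.card = 0 := by omega
        have := hP _ _ (hpure True (Q y) (fun _ => q0 h0) (by simp))
        simp only [hS₂, if_true] at this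
        simpa [hc, h0] using this
      · have h0 : S₁ᶜ.card = 1 := by omega
        obtain ⟨r0, r1, r2⟩ := hP _ _ (hpure False (Q y) (by simp) (fun _ => q1 h0))
        simp only [hS₂, if_false] at r0 r1 r2
        refine ⟨fun h => by omega, fun h => r1 (by omega), fun h => r2 (by omega)⟩
    · have hz0 : P (Fin.cons (α := fun _ => 𝔤 × V) (Q y) z) = 0 :=
        P.map_coord_zero 0 (by simp [q2 h])
      simp [hz0]
  rw [circ_apply]
  refine ⟨fun h => ?_, fun h => ?_, fun h => ?_⟩
  · rw [Prod.snd_sum]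
    exact Finset.sum_eq_zero fun σ _ => by simp [(key σ).1 h]
  · rw [Prod.fst_sum]
    exact Finset.sum_eq_zero fun σ _ => by simp [(key σ).2.1 h]
  · exact Finset.sum_eq_zero fun σ _ => by simp [(key σ).2.2 h]

/-! ### The graded space `s⁻¹L' ⊕ 𝔥` and its brackets -/

variable (K 𝔤 V)

/-- `L' = ⨁_{n ≥ 0} C^{n|0}(𝔤 ⊕ V, 𝔤 ⊕ V)`. -/
def LPrime : Submodule K (CochainAlg K (𝔤 × V)) where
  carrier := {Q | ∀ n : ℕ, Q n ∈ bidegree K 𝔤 V n n 0}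
  zero_mem' n := by simp
  add_mem' h h' n := by
    rw [DirectSum.add_apply]
    exact add_mem (h n) (h' n)
  smul_mem' c Q h n := by
    rw [DirectSum.smul_apply]
    exact Submodule.smul_mem _ c (h n)

/-- `𝔥 = ⨁_{n ≥ 0} C^{-1|n+1}(𝔤 ⊕ V, 𝔤 ⊕ V)`. -/
def HPart : Submodule K (CochainAlg K (𝔤 × V)) where
  carrier := {θ | ∀ n : ℕ, θ n ∈ bidegree K 𝔤 V n (-1) (n + 1)}
  zero_mem' n := by simp
  add_mem' h h' n := by
    rw [DirectSum.add_apply]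
    exact add_mem (h n) (h' n)
  smul_mem' c Q h n := by
    rw [DirectSum.smul_apply]
    exact Submodule.smul_mem _ c (h n)

/-- The component of `f` in `C^{-1|n+1} = Hom(⋀^{n+1} V, 𝔤)`: the map
`((x₁, v₁), …, (x_{n+1}, v_{n+1})) ↦ (pr_𝔤 f(v₁, …, v_{n+1}), 0)`. -/
def projHom (n : ℕ) : Cochain K (𝔤 × V) n →ₗ[K] Cochain K (𝔤 × V) n where
  toFun f := (LinearMap.inl K 𝔤 V ∘ₗ LinearMap.fst K 𝔤 V).compAlternatingMap
    (f.compLinearMap (LinearMap.inr K 𝔤 V ∘ₗ LinearMap.snd K 𝔤 V))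
  map_add' f f' := by ext x <;> simp
  map_smul' c f := by ext x <;> simp

/-- The projection `P : L → L` onto `𝔥` (along all other bidegrees). -/
def proj : CochainAlg K (𝔤 × V) →ₗ[K] CochainAlg K (𝔤 × V) :=
  DirectSum.lmap fun n => projHom K 𝔤 V n

variable {K 𝔤 V}

theorem proj_apply (Q : CochainAlg K (𝔤 × V)) (n : ℕ) :
    proj K 𝔤 V Q n = projHom K 𝔤 V n (Q n) := by
  rw [proj, DirectSum.lmap_apply]

theorem proj_mem (Q : CochainAlg K (𝔤 × V)) : proj K 𝔤 V Q ∈ HPart K 𝔤 V := by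
  intro n
  rw [proj_apply]
  intro S x hx
  have hcard := card_compl_add_card S
  refine ⟨fun h => ?_, fun h => by omega, fun h h' => ?_⟩
  · simp [projHom]
  · have hS : S.card ≠ 0 := fun h0 => h (by omega)
    obtain ⟨i, hi⟩ := Finset.card_ne_zero.1 hS
    have h0 : (Q n) (fun j => ((0 : 𝔤), (x j).2)) = 0 :=
      (Q n).map_coord_zero i (by simp [(hx i).1 hi])
    have : projHom K 𝔤 V n (Q n) x = (((Q n) (fun j => ((0 : 𝔤), (x j).2))).1, 0) := rfl
    rw [this, h0]
    rfl

theorem signTwist_mem_LPrime (r : ℕ) {Q : CochainAlg K (𝔤 × V)} (hQ : Q ∈ LPrime K 𝔤 V) :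
    signTwist K (𝔤 × V) r Q ∈ LPrime K 𝔤 V := fun n => by
  rw [signTwist_apply]
  exact Submodule.smul_mem _ _ (hQ n)

theorem lof_mem_LPrime {n : ℕ} {f : Cochain K (𝔤 × V) n} (hf : f ∈ bidegree K 𝔤 V n n 0) :
    DirectSum.lof K ℕ (fun n => Cochain K (𝔤 × V) n) n f ∈ LPrime K 𝔤 V := fun m => by
  by_cases h : n = m
  · subst h
    rwa [DirectSum.lof_apply]
  · rw [DirectSum.lof_eq_of, DirectSum.of_eq_of_ne _ _ _ (Ne.symm h)]
    exact zero_mem _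

theorem lof_mem_HPart {n : ℕ} {f : Cochain K (𝔤 × V) n}
    (hf : f ∈ bidegree K 𝔤 V n (-1) (n + 1)) :
    DirectSum.lof K ℕ (fun n => Cochain K (𝔤 × V) n) n f ∈ HPart K 𝔤 V := fun m => by
  by_cases h : n = m
  · subst h
    rwa [DirectSum.lof_apply]
  · rw [DirectSum.lof_eq_of, DirectSum.of_eq_of_ne _ _ _ (Ne.symm h)]
    exact zero_mem _

theorem LPrime_induction {p : CochainAlg K (𝔤 × V) → Prop} (h0 : p 0)
    (hadd : ∀ a b, p a → p b → p (a + b))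
    (hlof : ∀ (n : ℕ) (f : Cochain K (𝔤 × V) n), f ∈ bidegree K 𝔤 V n n 0 →
      p (DirectSum.lof K ℕ (fun n => Cochain K (𝔤 × V) n) n f))
    {Q : CochainAlg K (𝔤 × V)} (hQ : Q ∈ LPrime K 𝔤 V) : p Q := by
  classical
  rw [← DirectSum.sum_support_of Q]
  exact Finset.sum_induction _ p hadd h0 fun n _ => hlof n _ (hQ n)

theorem nrBracket_mem_LPrime [CharZero K] {Q Q' : CochainAlg K (𝔤 × V)}
    (hQ : Q ∈ LPrime K 𝔤 V) (hQ' : Q' ∈ LPrime K 𝔤 V) :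
    nrBracket K (𝔤 × V) Q Q' ∈ LPrime K 𝔤 V := by
  refine LPrime_induction (p := fun Q => nrBracket K (𝔤 × V) Q Q' ∈ LPrime K 𝔤 V) (by simp)
    (fun a b ha hb => by
      rw [map_add, LinearMap.add_apply]
      exact add_mem ha hb) (fun p f hf => ?_) hQ
  refine LPrime_induction (p := fun Q' => nrBracket K (𝔤 × V)
      (DirectSum.lof K ℕ (fun n => Cochain K (𝔤 × V) n) p f) Q' ∈ LPrime K 𝔤 V) (by simp)
    (fun a b ha hb => by
      rw [map_add]
      exact add_mem ha hb) (fun q f' hf' => ?_) hQ'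
  rw [nrBracket_lof]
  exact sub_mem (lof_mem_LPrime (circ_mem_bidegree_zero hf hf'))
    (Submodule.smul_mem _ _ (lof_mem_LPrime (circ_mem_bidegree_zero hf' hf)))

variable (K 𝔤 V)

/-- The space `s⁻¹L' ⊕ 𝔥`; the pair `(Q, θ)` stands for `(s⁻¹Q, θ)`. -/
abbrev TotalSpace := LPrime K 𝔤 V × HPart K 𝔤 V

/-- The degree `m` part of `s⁻¹L' ⊕ 𝔥`: pairs `(s⁻¹Q, θ)` with `Q ∈ L` of degree `m + 1` and
`θ ∈ L` of degree `m`. -/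
def grading (m : ℤ) : Submodule K (TotalSpace K 𝔤 V) where
  carrier := {x | (∀ n : ℕ, (n : ℤ) ≠ m + 1 → (x.1 : CochainAlg K (𝔤 × V)) n = 0) ∧
    (∀ n : ℕ, (n : ℤ) ≠ m → (x.2 : CochainAlg K (𝔤 × V)) n = 0)}
  zero_mem' := ⟨fun n _ => rfl, fun n _ => rfl⟩
  add_mem' {x y} hx hy := by
    refine ⟨fun n hn => ?_, fun n hn => ?_⟩
    · simp [DirectSum.add_apply, hx.1 n hn, hy.1 n hn]
    · simp [DirectSum.add_apply, hx.2 n hn, hy.2 n hn]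
  smul_mem' c x hx := by
    refine ⟨fun n hn => ?_, fun n hn => ?_⟩
    · simp [DirectSum.smul_apply, hx.1 n hn]
    · simp [DirectSum.smul_apply, hx.2 n hn]

/-- `F_1` is the whole space; for `n ≥ 2`, `F_n = ⨁_{j ≥ n - 1} Hom(⋀^j V, 𝔤) ⊆ 𝔥`. -/
def arityFiltration (n : ℕ) : Submodule K (TotalSpace K 𝔤 V) where
  carrier := {x | (2 ≤ n → x.1 = 0) ∧
    (∀ j : ℕ, j + 2 < n → (x.2 : CochainAlg K (𝔤 × V)) j = 0)}
  zero_mem' := ⟨fun _ => rfl, fun n _ => rfl⟩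
  add_mem' {x y} hx hy := by
    refine ⟨fun hn => ?_, fun j hj => ?_⟩
    · simp [hx.1 hn, hy.1 hn]
    · simp [DirectSum.add_apply, hx.2 j hj, hy.2 j hj]
  smul_mem' c x hx := by
    refine ⟨fun hn => ?_, fun j hj => ?_⟩
    · simp [hx.1 hn]
    · simp [DirectSum.smul_apply, hx.2 j hj]

variable {K 𝔤 V}
variable [CharZero K]

/-- The `s⁻¹L'`-component of `l_k`: for homogeneous `Q`, `l₂(s⁻¹Q, s⁻¹Q') = (-1)^Q s⁻¹[Q, Q']`, and
zero for `k ≠ 2`. -/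
def bracketL : (k : ℕ) → (Fin k → TotalSpace K 𝔤 V) → LPrime K 𝔤 V
  | 2, x => ⟨nrBracket K (𝔤 × V) (signTwist K (𝔤 × V) 1 (x 0).1) (x 1).1,
      nrBracket_mem_LPrime (signTwist_mem_LPrime 1 (x 0).1.2) (x 1).1.2⟩
  | _, _ => 0

/-- The contribution to `l_k((s⁻¹Q₁, θ₁), …, (s⁻¹Q_k, θ_k))` of `s⁻¹Q_i` and the `θ_j`, `j ≠ i`.
For homogeneous entries it is the product of the Koszul sign
`(-1)^{(deg Q_i - 1)(deg θ₁ + ⋯ + deg θ_{i-1})}` of moving `s⁻¹Q_i` to the front and of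
`P[⋯[[⋯[Q_i, θ₁], ⋯, θ_{i-1}], θ_{i+1}], ⋯, θ_k]`. -/
def bracketHTerm {k : ℕ} (x : Fin k → TotalSpace K 𝔤 V) (i : Fin k) :
    CochainAlg K (𝔤 × V) :=
  proj K 𝔤 V (DirectSum.toModule K ℕ (CochainAlg K (𝔤 × V))
    (fun q => nestedBracket K (𝔤 × V)
        (((List.finRange k).filter fun j => j ≠ i).map fun j =>
          if j < i then signTwist K (𝔤 × V) (q + 1) (x j).2 else (x j).2) ∘ₗ
      DirectSum.lof K ℕ (fun n => Cochain K (𝔤 × V) n) q)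
    (x i).1)

/-- The brackets `l_k` of `s⁻¹L' ⊕ 𝔥`, determined by
`l₂(s⁻¹Q, s⁻¹Q') = (-1)^Q s⁻¹[Q, Q']`, `l_k(s⁻¹Q, θ₁, …, θ_{k-1}) = P[⋯[Q, θ₁], ⋯, θ_{k-1}]`,
graded symmetry, and vanishing on all other combinations. (For `k = 1` the formula gives
`l₁(s⁻¹Q) = P Q`, which is zero for `Q ∈ L'`.) -/
def bracket (k : ℕ) (x : Fin k → TotalSpace K 𝔤 V) : TotalSpace K 𝔤 V :=
  (bracketL k x, ∑ i : Fin k, ⟨bracketHTerm x i, proj_mem _⟩)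

end Bidegree

/-! ### `L_∞`-algebras -/

/-- The Koszul sign of `σ` for homogeneous elements of degrees `d`:
`v₁ ⊙ ⋯ ⊙ vₙ = ε(σ) v_{σ(1)} ⊙ ⋯ ⊙ v_{σ(n)}`. -/
def koszulSign {n : ℕ} (σ : Perm (Fin n)) (d : Fin n → ℤ) : ℤˣ :=
  ∏ i : Fin n, ∏ j : Fin n,
    if i < j ∧ σ j < σ i then Int.negOnePow (d (σ i) * d (σ j)) else 1

section LInfinity

variable {K E : Type*} [Field K] [AddCommGroup E] [Module K E]

/-- `(E, {l_k}_{k ≥ 1})` is an `L_∞`-algebra, where `E = ⨁_m 𝒜 m` (`l 0` plays no role). -/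
structure IsLInfinity (𝒜 : ℤ → Submodule K E) (l : (k : ℕ) → (Fin k → E) → E) : Prop where
  graded : DirectSum.IsInternal 𝒜
  multilinear : ∀ k, 1 ≤ k → ∃ f : MultilinearMap K (fun _ : Fin k => E) E, ∀ x, l k x = f x
  degree_one : ∀ k, 1 ≤ k → ∀ (d : Fin k → ℤ) (x : Fin k → E), (∀ i, x i ∈ 𝒜 (d i)) →
    l k x ∈ 𝒜 (∑ i, d i + 1)
  symm : ∀ n, 1 ≤ n → ∀ (d : Fin n → ℤ) (x : Fin n → E), (∀ i, x i ∈ 𝒜 (d i)) →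
    ∀ σ : Perm (Fin n), l n (fun i => x (σ i)) = (koszulSign σ d : ℤ) • l n x
  jacobi : ∀ n, 1 ≤ n → ∀ (d : Fin n → ℤ) (x : Fin n → E), (∀ i, x i ∈ 𝒜 (d i)) →
    ∑ i : Fin n, ∑ σ ∈ shuffles (i + 1) n, (koszulSign σ d : ℤ) •
      l (n - (i + 1) + 1) (Fin.cons (α := fun _ => E)
        (l (i + 1) fun j : Fin (i + 1) => x (σ ⟨j, by omega⟩))
        (fun j : Fin (n - (i + 1)) => x (σ ⟨i + 1 + j, by omega⟩))) = 0

/-- `(E, {l_k})` is an `L_∞`-algebra, weakly filtered by the descending filtration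
`E = F 1 ⊇ F 2 ⊇ ⋯` of graded subspaces. Completeness says that in each degree `m` the natural map
`𝒜 m → lim_n 𝒜 m / (F n ∩ 𝒜 m)` is a bijection. -/
structure IsWeaklyFiltered (𝒜 : ℤ → Submodule K E) (l : (k : ℕ) → (Fin k → E) → E)
    (F : ℕ → Submodule K E) : Prop where
  isLInfinity : IsLInfinity 𝒜 l
  one : F 1 = ⊤
  antitone : Antitone F
  graded : ∀ n, F n = ⨆ m, F n ⊓ 𝒜 m
  bracket_mem : ∃ n, 1 ≤ n ∧ ∀ k, n ≤ k → ∀ x : Fin k → E, l k x ∈ F k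
  complete : ∀ (m : ℤ) (x : ℕ → E), (∀ n, x n ∈ 𝒜 m) → (∀ n, x (n + 1) - x n ∈ F n) →
    ∃! y, y ∈ 𝒜 m ∧ ∀ n, y - x n ∈ F n

/-- The series `∑_{k ≥ 0} a k` converges to `s` with respect to the filtration `F`. -/
def SeriesConverges (F : ℕ → Submodule K E) (a : ℕ → E) (s : E) : Prop :=
  ∀ n, ∃ N, ∀ M, N ≤ M → s - ∑ k ∈ Finset.range M, a k ∈ F n

/-- `α` is a Maurer–Cartan element: `α` has degree `0` and `∑_{k ≥ 1} (1/k!) l_k(α, …, α) = 0`. -/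
def IsMaurerCartan (𝒜 : ℤ → Submodule K E) (l : (k : ℕ) → (Fin k → E) → E)
    (F : ℕ → Submodule K E) (α : E) : Prop :=
  α ∈ 𝒜 0 ∧
    SeriesConverges F (fun k => ((k + 1).factorial : K)⁻¹ • l (k + 1) fun _ => α) 0

/-- The `n`-th term `(1/n!) l_{k+n}(α, …, α, x₁, …, x_k)` of the series for the twisted bracket. -/
def twistTerm (l : (k : ℕ) → (Fin k → E) → E) (α : E) (k : ℕ) (x : Fin k → E) (n : ℕ) : E :=
  (n.factorial : K)⁻¹ • l (n + k) (Fin.append (fun _ : Fin n => α) x)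

/-- The twisted bracket `l_k^α(x₁, …, x_k) = ∑_{n ≥ 0} (1/n!) l_{k+n}(α, …, α, x₁, …, x_k)`, the sum
of the series with respect to the filtration `F` (and `0` if the series does not converge). -/
noncomputable def twist (l : (k : ℕ) → (Fin k → E) → E) (F : ℕ → Submodule K E) (α : E) (k : ℕ)
    (x : Fin k → E) : E :=
  open Classical in
  if h : ∃ s, SeriesConverges F (twistTerm (K := K) l α k x) s then h.choose else 0

end LInfinity

/-! ### Relative Rota–Baxter Lie algebras -/

section RelativeRotaBaxter

variable {K 𝔤 V : Type*} [Field K] [AddCommGroup 𝔤] [Module K 𝔤] [AddCommGroup V] [Module K V]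

/-- `((𝔤, μ), ρ, T)` is a relative Rota–Baxter Lie algebra: `μ` is a Lie bracket on `𝔤`, `ρ` is a
representation of `(𝔤, μ)` on `V`, and `T` is a relative Rota–Baxter operator. -/
structure IsRelRotaBaxter (μ : 𝔤 [⋀^Fin 2]→ₗ[K] 𝔤) (ρ : 𝔤 →ₗ[K] Module.End K V)
    (T : V →ₗ[K] 𝔤) : Prop where
  jacobi : ∀ x y z, μ ![μ ![x, y], z] + μ ![μ ![y, z], x] + μ ![μ ![z, x], y] = 0
  rep : ∀ x y v, ρ (μ ![x, y]) v = ρ x (ρ y v) - ρ y (ρ x v)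
  rotaBaxter : ∀ u v, μ ![T u, T v] = T (ρ (T u) v - ρ (T v) u)

/-- `μ + ρ ∈ C^{1|0}`: the map `((x₁, v₁), (x₂, v₂)) ↦ (μ(x₁, x₂), ρ(x₁)v₂ - ρ(x₂)v₁)`. -/
def liftPair (μ : 𝔤 [⋀^Fin 2]→ₗ[K] 𝔤) (ρ : 𝔤 →ₗ[K] Module.End K V) :
    Cochain K (𝔤 × V) 1 :=
  (LinearMap.inl K 𝔤 V).compAlternatingMap (μ.compLinearMap (LinearMap.fst K 𝔤 V)) +
  { MultilinearMap.mk' (fun x : Fin 2 → 𝔤 × V =>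
        ((0 : 𝔤), ρ (x 0).1 (x 1).2 - ρ (x 1).1 (x 0).2))
      (fun x i a b => by
        fin_cases i <;> simp <;> abel)
      (fun x i c a => by
        fin_cases i <;> simp [smul_sub]) with
    map_eq_zero_of_eq' := fun x i j h hij => by
      have h01 : x 0 = x 1 := by
        fin_cases i <;> fin_cases j <;> simp_all
      simp [h01] }

theorem liftPair_apply (μ : 𝔤 [⋀^Fin 2]→ₗ[K] 𝔤) (ρ : 𝔤 →ₗ[K] Module.End K V)
    (x : Fin 2 → 𝔤 × V) :
    liftPair μ ρ x = (μ (fun i => (x i).1), ρ (x 0).1 (x 1).2 - ρ (x 1).1 (x 0).2) := by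
  ext
  · change μ (fun i => (x i).1) + 0 = _
    simp
  · change 0 + (ρ (x 0).1 (x 1).2 - ρ (x 1).1 (x 0).2) = _
    simp

/-- `T ∈ C^{-1|1}`: the map `(x, v) ↦ (T v, 0)`. -/
def liftOperator (T : V →ₗ[K] 𝔤) : Cochain K (𝔤 × V) 0 :=
  AlternatingMap.ofSubsingleton K (𝔤 × V) (𝔤 × V) (0 : Fin 1)
    (LinearMap.inl K 𝔤 V ∘ₗ T ∘ₗ LinearMap.snd K 𝔤 V)

theorem liftPair_mem (μ : 𝔤 [⋀^Fin 2]→ₗ[K] 𝔤) (ρ : 𝔤 →ₗ[K] Module.End K V) :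
    liftPair μ ρ ∈ bidegree K 𝔤 V 1 (1 : ℕ) 0 := by
  rw [mem_bidegree_zero_iff]
  intro S x hx
  rw [card_compl_eq_sum, liftPair_apply, Fin.sum_univ_two]
  have h0 := hx 0
  have h1 := hx 1
  have hμ : ∀ i, (x i).1 = 0 → μ (fun i => (x i).1) = 0 := fun i h => μ.map_coord_zero i h
  by_cases s0 : (0 : Fin 2) ∈ S <;> by_cases s1 : (1 : Fin 2) ∈ S
  · simp [s0, s1, h0.1 s0, h1.1 s1]
  · simp [s0, s1, hμ 1 (h1.2 s1)]
  · simp [s0, s1, hμ 0 (h0.2 s0)]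
  · simp [s0, s1, h0.2 s0, h1.2 s1, hμ 0 (h0.2 s0)]

theorem liftOperator_mem (T : V →ₗ[K] 𝔤) :
    liftOperator T ∈ bidegree K 𝔤 V 0 (-1) ((0 : ℕ) + 1) := by
  intro S x hx
  have hT : liftOperator T x = (T (x 0).2, 0) := rfl
  have hc := card_compl_add_card S
  refine ⟨fun _ => by rw [hT], fun h => by omega, fun h _ => ?_⟩
  have : S.card ≠ 0 := fun h0 => h (by omega)
  obtain ⟨i, hi⟩ := Finset.card_ne_zero.1 this
  obtain rfl : i = 0 := Fin.fin_one_eq_zero i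
  simp [hT, (hx 0).1 hi]

/-- The element `(s⁻¹(μ + ρ), T)` of `s⁻¹L' ⊕ 𝔥`. -/
def toElement (μ : 𝔤 [⋀^Fin 2]→ₗ[K] 𝔤) (ρ : 𝔤 →ₗ[K] Module.End K V) (T : V →ₗ[K] 𝔤) :
    TotalSpace K 𝔤 V :=
  (⟨DirectSum.lof K ℕ (fun n => Cochain K (𝔤 × V) n) 1 (liftPair μ ρ),
      lof_mem_LPrime (liftPair_mem μ ρ)⟩,
    ⟨DirectSum.lof K ℕ (fun n => Cochain K (𝔤 × V) n) 0 (liftOperator T),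
      lof_mem_HPart (liftOperator_mem T)⟩)

end RelativeRotaBaxter

end RelRB

open RelRB

namespace RelRB

open Equiv

/-! ### Signs -/

/-! The `l_k` are Voronov's higher derived brackets. `L` is a graded Lie algebra because `∘̄` is a
graded pre-Lie product; `𝔥` is abelian, since its elements ignore `𝔤`-components and take values in
`𝔤`; and `ker P` is a subalgebra, since it consists of the maps sending families of `V`-vectors into
`V`. The last two facts give `P[A, B] = P[PA, B] + P[A, PB]` (`proj_nrBracket`). For a list of pairs
`(s⁻¹q, θ)`, let `N` be the signed sum over its entries of the nested brackets of that entry's `q`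
with all the other `θ`s. The `L'`-part of the generalized Jacobi identity is the Jacobi identity of
`L`. In the `𝔥`-part, the Leibniz rule turns the terms containing some `[q, q']` into `-½ Σ ± P[N,
N']`; the formula for `P[A, B]` and antisymmetry turn this into `-Σ ± P[N, PN']`, which cancels the
remaining terms (`VoronovData.nestSum_jacobi`).

One device carries the signs: `split` sums over the ways of splitting a list in two, with Koszul
signs. It is coassociative and graded cocommutative, and with all degrees equal to one it also
computes `∘̄`. Sums over shuffles are translated into it by `sum_shuffles_eq_split`.

Filtration and convergence rest on weights. Maps in `C^{j|l}` have weight `j`, weights add under the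
bracket, `𝔥` has weight `-1`, and `P` kills every other weight. So `P[⋯[Q, θ₁], ⋯, θ_{k-1}]` depends
only on the component of `Q` in degree `k - 2`. Bracketing with `θ`s does not lower the degree,
which gives `l_k ⊆ F_k` for `k ≥ 3`; and as `Q` has finitely many components, long brackets of
finitely many given elements vanish (`locallyNilpotent_listBracket`). Every series in question is
thus a finite sum. A weak filtration is separated (`IsWeaklyFiltered.eq_zero`), so the limit is that
finite sum whatever the filtration.

For such finite series twisting is formal: binomial coefficients against factorials show that the
twist by a Maurer–Cartan element `α` is an `L_∞`-algebra, whose Maurer–Cartan elements are the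
degree `0` elements `β` with `α + β` Maurer–Cartan. It remains to compute the Maurer–Cartan series
of `(s⁻¹π, T)`: only `l₂` and `l₃` contribute, with values `-½[π, π]` and `½P[[π, T], T]`. The first
vanishes iff `μ` is a Lie bracket and `ρ` a representation, the second iff `T` is a relative
Rota–Baxter operator (`twistList_toElement`). This applies both to `(μ, ρ, T)` and to the sum of the
two triples. -/

/-- The sign `(-1)^n` as an integer. -/
def sgn (n : ℤ) : ℤ := (Int.negOnePow n : ℤ)

theorem sgn_add (m n : ℤ) : sgn (m + n) = sgn m * sgn n := by
  simp [sgn, Int.negOnePow_add]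

theorem sgn_congr {m n : ℤ} (h : Even (m - n)) : sgn m = sgn n := by
  rw [sgn, sgn, (Int.negOnePow_eq_iff m n).2 h]

@[simp] theorem sgn_zero : sgn 0 = 1 := rfl

@[simp] theorem sgn_one : sgn 1 = -1 := rfl

theorem sgn_mul_self (n : ℤ) : sgn n * sgn n = 1 := by
  rw [← sgn_add, sgn_congr (n := 0) (by simp), sgn_zero]

theorem sgn_natCast (K : Type*) [Ring K] (n : ℕ) : ((sgn n : ℤ) : K) = (-1) ^ n := by
  simp [sgn]

theorem neg_sgn (n : ℤ) : -sgn n = sgn (n + 1) := by simp [sgn_add]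

/-! ### Splittings of lists -/

section Split

variable {X M N : Type*} [AddCommGroup M] [AddCommGroup N]

/-- The total degree of a list. -/
def degSum (dg : X → ℤ) (l : List X) : ℤ := (l.map dg).sum

@[simp] theorem degSum_nil (dg : X → ℤ) : degSum dg [] = 0 := rfl

@[simp] theorem degSum_cons (dg : X → ℤ) (x : X) (l : List X) :
    degSum dg (x :: l) = dg x + degSum dg l := by simp [degSum]

@[simp] theorem degSum_append (dg : X → ℤ) (l l' : List X) :
    degSum dg (l ++ l') = degSum dg l + degSum dg l' := by simp [degSum]

theorem degSum_perm (dg : X → ℤ) {l l' : List X} (h : l.Perm l') : degSum dg l = degSum dg l' :=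
  (h.map dg).sum_eq

/-- The sum of `± f a b` over all ways of splitting `l` into two complementary sublists `a`, `b`,
where `±` is the Koszul sign of the rearrangement `l ↦ a ++ b`. -/
def split (dg : X → ℤ) : List X → (List X → List X → M) → M
  | [], f => f [] []
  | x :: l, f => split dg l (fun a b => f (x :: a) b) +
      split dg l (fun a b => sgn (dg x * degSum dg a) • f a (x :: b))

variable (dg : X → ℤ)

@[simp] theorem split_nil (f : List X → List X → M) : split dg [] f = f [] [] := rfl

theorem split_cons (x : X) (l : List X) (f : List X → List X → M) :
    split dg (x :: l) f = split dg l (fun a b => f (x :: a) b) +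
      split dg l (fun a b => sgn (dg x * degSum dg a) • f a (x :: b)) := rfl

theorem split_congr {l : List X} {f g : List X → List X → M}
    (h : ∀ a b, (a ++ b).Perm l → f a b = g a b) : split dg l f = split dg l g := by
  induction l generalizing f g with
  | nil => exact h _ _ (List.Perm.refl _)
  | cons x l ih =>
    rw [split_cons, split_cons]
    congr 1
    · exact ih fun a b hab => h _ _ (hab.cons x)
    · exact ih fun a b hab => by
        rw [h a (x :: b) (List.perm_middle.trans (hab.cons x))]

theorem split_add (l : List X) (f g : List X → List X → M) :
    split dg l (fun a b => f a b + g a b) = split dg l f + split dg l g := by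
  induction l generalizing f g with
  | nil => rfl
  | cons x l ih => simp only [split_cons, smul_add, ih]; abel

@[simp] theorem split_zero (l : List X) : split dg l (fun _ _ => (0 : M)) = 0 := by
  induction l with
  | nil => rfl
  | cons x l ih => simp [split_cons, ih]

theorem map_split {F : Type*} [FunLike F M N] [AddMonoidHomClass F M N] (φ : F) (l : List X)
    (f : List X → List X → M) : φ (split dg l f) = split dg l (fun a b => φ (f a b)) := by
  induction l generalizing f with
  | nil => rfl
  | cons x l ih => simp only [split_cons, map_add, ih, map_zsmul]

theorem zsmul_split (c : ℤ) (l : List X) (f : List X → List X → M) :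
    c • split dg l f = split dg l (fun a b => c • f a b) :=
  map_split dg (DistribSMul.toAddMonoidHom M c) l f

theorem split_neg (l : List X) (f : List X → List X → M) :
    split dg l (fun a b => - f a b) = - split dg l f :=
  (map_split dg (negAddMonoidHom (α := M)) l f).symm

theorem split_sum {ι : Type*} (s : Finset ι) (l : List X) (f : ι → List X → List X → M) :
    split dg l (fun a b => ∑ i ∈ s, f i a b) = ∑ i ∈ s, split dg l (f i) := by
  classical
  induction s using Finset.induction_on with
  | empty => simp
  | insert i s hi ih => simp only [Finset.sum_insert hi, split_add, ih]

/-- Coassociativity: both sides send each letter to one of three lists, with the Koszul sign of the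
resulting rearrangement. -/
theorem split_assoc (l : List X) (f : List X → List X → List X → M) :
    split dg l (fun a b => split dg a fun c d => f c d b) =
      split dg l (fun c e => split dg e fun d b => f c d b) := by
  induction l generalizing f with
  | nil => rfl
  | cons x l ih =>
    simp only [split_cons, split_add, zsmul_split]
    rw [ih fun c d b => f (x :: c) d b, ih fun c d b => sgn (dg x * degSum dg c) • f c (x :: d) b,
      add_assoc]
    congr 2
    simp only [smul_add, zsmul_split, split_add]
    congr 1
    rw [← ih fun c d b => sgn (dg x * degSum dg c) • sgn (dg x * degSum dg d) • f c d (x :: b)]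
    refine split_congr dg fun a b _ => split_congr dg fun c d hcd => ?_
    rw [smul_smul, ← sgn_add, ← mul_add, ← degSum_append, degSum_perm dg hcd]

/-- Graded cocommutativity: the extra sign is that of moving one block past the other. -/
theorem split_comm (l : List X) (f : List X → List X → M) :
    split dg l f = split dg l (fun a b => sgn (degSum dg a * degSum dg b) • f b a) := by
  induction l generalizing f with
  | nil => simp
  | cons x l ih =>
    simp only [split_cons]
    rw [add_comm]
    congr 1
    · rw [ih]
      refine split_congr dg fun a b _ => ?_
      rw [smul_smul, ← sgn_add, degSum_cons]
      congr 2; ring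
    · rw [ih]
      refine split_congr dg fun a b _ => ?_
      rw [smul_smul, ← sgn_add, degSum_cons]
      congr 1
      refine sgn_congr ⟨- (dg x * degSum dg a), by ring⟩

/-- The two middle blocks of a fourfold splitting change places: coassociativity isolates them, and
cocommutativity exchanges them. -/
theorem split_interchange (l : List X) (f : List X → List X → List X → List X → M) :
    split dg l (fun a b => split dg a fun c c' => split dg b fun e e' => f c c' e e') =
      split dg l (fun a b => split dg a fun c e => split dg b fun c' e' =>
        sgn (degSum dg c' * degSum dg e) • f c c' e e') := by
  rw [split_assoc dg l fun c c' b => split dg b fun e e' => f c c' e e',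
    split_assoc dg l fun c e b => split dg b fun c' e' =>
      sgn (degSum dg c' * degSum dg e) • f c c' e e']
  refine split_congr dg fun c r _ => ?_
  rw [← split_assoc dg r fun c' e e' => f c c' e e', ← split_assoc dg r fun e c' e' =>
      sgn (degSum dg c' * degSum dg e) • f c c' e e']
  refine split_congr dg fun u e' _ => ?_
  rw [split_comm]
  exact split_congr dg fun a b _ => by rw [mul_comm]

/-- The part of a splitting in which the first list is empty. -/
theorem split_left_nil (l : List X) (f : List X → List X → M) (h : ∀ x a b, f (x :: a) b = 0) :
    split dg l f = f [] l := by
  induction l generalizing f with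
  | nil => rfl
  | cons x l ih =>
    rw [split_cons, ih (fun a b => sgn (dg x * degSum dg a) • f a (x :: b)) (by simp [h])]
    simp [h]

theorem split_right_nil (l : List X) (f : List X → List X → M) (h : ∀ x a b, f a (x :: b) = 0) :
    split dg l f = f l [] := by
  induction l generalizing f with
  | nil => rfl
  | cons x l ih =>
    rw [split_cons, ih (fun a b => f (x :: a) b) (by simp [h])]
    simp [h]

/-- Splittings with `x` and `y` on the same side are covered by `hl` and `hr`; the two kinds that
separate `x` from `y` are exchanged with each other. -/
theorem split_swap (p q : List X) (x y : X) (f : List X → List X → M)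
    (hl : ∀ r s b, f (r ++ x :: y :: s) b = sgn (dg x * dg y) • f (r ++ y :: x :: s) b)
    (hr : ∀ r s a, f a (r ++ x :: y :: s) = sgn (dg x * dg y) • f a (r ++ y :: x :: s)) :
    split dg (p ++ x :: y :: q) f = sgn (dg x * dg y) • split dg (p ++ y :: x :: q) f := by
  induction p generalizing f with
  | nil =>
    simp only [List.nil_append, split_cons, smul_add, zsmul_split]
    have h1 := split_congr dg (l := q) (f := fun a b => f (x :: y :: a) b)
      (g := fun a b => sgn (dg x * dg y) • f (y :: x :: a) b) (fun a b _ => hl [] a b)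
    rw [h1, add_assoc, add_assoc]
    congr 1
    have h2 : ∀ a b, sgn (dg y * degSum dg a) • sgn (dg x * degSum dg a) • f a (x :: y :: b) =
        sgn (dg x * dg y) • sgn (dg x * degSum dg a) • sgn (dg y * degSum dg a) •
          f a (y :: x :: b) := fun a b => by
      rw [show f a (x :: y :: b) = _ from hr [] b a]
      simp only [List.nil_append, smul_smul]
      congr 1; ring
    have h3 : ∀ a b, sgn (dg x * degSum dg (y :: a)) • f (y :: a) (x :: b) =
        sgn (dg x * dg y) • sgn (dg x * degSum dg a) • f (y :: a) (x :: b) := fun a b => by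
      rw [smul_smul, ← sgn_add, degSum_cons]
      congr 2; ring
    have h4 : ∀ a b, sgn (dg y * degSum dg a) • f (x :: a) (y :: b) =
        sgn (dg x * dg y) • sgn (dg y * degSum dg (x :: a)) • f (x :: a) (y :: b) := fun a b => by
      rw [smul_smul, ← sgn_add, degSum_cons]
      congr 1
      exact sgn_congr ⟨- (dg x * dg y), by ring⟩
    simp only [h2, h3, h4]
    abel
  | cons z p ih =>
    have hs : degSum dg (p ++ x :: y :: q) = degSum dg (p ++ y :: x :: q) := by simp; ring
    simp only [List.cons_append, split_cons, smul_add]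
    congr 1
    · exact ih _ (fun r s b => hl (z :: r) s b) (fun r s a => hr r s _)
    · refine ih _ (fun r s b => ?_) (fun r s a => ?_)
      · have hd : degSum dg (r ++ x :: y :: s) = degSum dg (r ++ y :: x :: s) := by simp; ring
        rw [hl, hd, smul_comm]
      · rw [smul_comm, ← List.cons_append, hr, List.cons_append]

/-- Elements of even degree at the front are distributed without signs. -/
theorem split_replicate_append (x : X) (hx : dg x = 0) (n : ℕ) (l : List X)
    (f : List X → List X → M) :
    split dg (List.replicate n x ++ l) f = ∑ ij ∈ Finset.HasAntidiagonal.antidiagonal n, n.choose ij.1 •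
      split dg l (fun a b => f (List.replicate ij.1 x ++ a) (List.replicate ij.2 x ++ b)) := by
  induction n generalizing f with
  | zero => simp
  | succ n ih =>
    rw [List.replicate_succ, List.cons_append, split_cons]
    simp only [hx, zero_mul, sgn_zero, one_smul, ih]
    rw [Finset.sum_antidiagonal_choose_succ_nsmul (fun i j => split dg l fun a b =>
      f (List.replicate i x ++ a) (List.replicate j x ++ b)), add_comm]
    refine congrArg _ (Finset.sum_congr rfl fun ij hij => ?_)
    rw [Nat.choose_symm_of_eq_add (Finset.HasAntidiagonal.mem_antidiagonal.1 hij).symm]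
    rfl

end Split

/-! ### Shuffles and splittings -/

section Shuffle

variable {X M : Type*} [AddCommGroup M]

/-- The sublist of `x₁, …, xₙ` at the positions where `g` is true. -/
def maskList {n : ℕ} (g : Fin n → Bool) (x : Fin n → X) : List X :=
  ((List.finRange n).filter g).map x

theorem maskList_cons {n : ℕ} (c : Bool) (g : Fin n → Bool) (x : Fin (n + 1) → X) :
    maskList (Fin.cons (α := fun _ => Bool) c g) x =
      if c then x 0 :: maskList g (fun i => x i.succ) else maskList g (fun i => x i.succ) := by
  have h : (Fin.cons (α := fun _ => Bool) c g) ∘ Fin.succ = g := by ext; simp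
  rw [maskList, List.finRange_succ, List.filter_cons, List.filter_map, h]
  simp only [Fin.cons_zero]
  split_ifs <;> simp [maskList, Function.comp_def]

/-- The Koszul sign of moving the elements selected by `g` to the front. -/
def maskSign {n : ℕ} (g : Fin n → Bool) (d : Fin n → ℤ) : ℤˣ :=
  ∏ i, ∏ j, if j < i ∧ g i = true ∧ g j = false then Int.negOnePow (d i * d j) else 1

theorem prod_mask_negOnePow (dg : X → ℤ) (m : ℤ) {n : ℕ} (g : Fin n → Bool) (x : Fin n → X) :
    ∏ i, (if g i = true then Int.negOnePow (dg (x i) * m) else 1) =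
      Int.negOnePow (m * degSum dg (maskList g x)) := by
  induction n with
  | zero => simp [maskList]
  | succ n ih =>
    obtain ⟨⟨c, g⟩, rfl⟩ := (Fin.consEquiv (fun _ => Bool)).surjective g
    have hc : ∀ i, Fin.consEquiv (fun _ : Fin (n + 1) => Bool) (c, g) i =
      (Fin.cons (α := fun _ => Bool) c g) i := fun i => rfl
    rw [Fin.prod_univ_succ, show (Fin.consEquiv (fun _ : Fin (n + 1) => Bool) (c, g)) =
      (Fin.cons (α := fun _ => Bool) c g) from rfl, maskList_cons]
    simp only [Fin.cons_zero, Fin.cons_succ, ih g (fun i => x i.succ)]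
    cases c
    · simp
    · simp only [if_true, degSum_cons, mul_add, Int.negOnePow_add, mul_comm (dg (x 0))]

theorem maskSign_cons (dg : X → ℤ) {n : ℕ} (c : Bool) (g : Fin n → Bool)
    (x : Fin (n + 1) → X) :
    maskSign (Fin.cons (α := fun _ => Bool) c g) (fun i => dg (x i)) =
      (if c then 1 else
        Int.negOnePow (dg (x 0) * degSum dg (maskList g fun i => x i.succ))) *
      maskSign g (fun i => dg (x i.succ)) := by
  rw [maskSign, Fin.prod_univ_succ]
  simp only [Fin.prod_univ_succ, Fin.cons_zero, Fin.cons_succ, not_lt_zero, false_and, if_false,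
    Finset.prod_const_one, one_mul, Fin.succ_pos, true_and, Finset.prod_mul_distrib,
    Fin.succ_lt_succ_iff]
  congr 1
  rw [← prod_mask_negOnePow dg (dg (x 0)) g]
  cases c <;> simp

/-- The recursion of `split` unrolled: a splitting is the choice of the subset of positions that go
to the first list. -/
theorem split_ofFn (dg : X → ℤ) {n : ℕ} (x : Fin n → X) (f : List X → List X → M) :
    split dg (List.ofFn x) f = ∑ g : Fin n → Bool,
      ((maskSign g fun i => dg (x i) : ℤˣ) : ℤ) •
        f (maskList g x) (maskList (fun i => !g i) x) := by
  induction n generalizing f with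
  | zero => simp [maskSign, maskList]
  | succ n ih =>
    rw [List.ofFn_succ, split_cons, ih, ih, ← (Fin.consEquiv fun _ => Bool).sum_comp,
      Fintype.sum_prod_type, Fintype.sum_bool]
    have hn : ∀ (c : Bool) (g : Fin n → Bool), (fun i =>
        !((Fin.cons (α := fun _ => Bool) c g : Fin (n + 1) → Bool) i)) =
        Fin.cons (α := fun _ => Bool) (!c) (fun i => !g i) := fun c g => by
      ext i; refine Fin.cases ?_ (fun i => ?_) i <;> simp
    have hc : ∀ (c : Bool) (g : Fin n → Bool), Fin.consEquiv (fun _ : Fin (n + 1) => Bool) (c, g) =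
      (Fin.cons (α := fun _ => Bool) c g) := fun _ _ => rfl
    simp only [hc, hn, maskList_cons, maskSign_cons dg]
    congr 1
    · simp
    · refine Finset.sum_congr rfl fun g _ => ?_
      simp only [Bool.false_eq_true, if_false, Bool.not_false, if_true, smul_smul, Units.val_mul,
        sgn]
      rw [mul_comm]

theorem maskList_length {n : ℕ} (g : Fin n → Bool) (x : Fin n → X) :
    (maskList g x).length = ((List.finRange n).filter g).length := by simp [maskList]

/-- A shuffle has no inversions inside either block, so each inversion pairs an element of the first
block with a smaller one of the second. -/
theorem koszulSign_shuffle {i n : ℕ} {σ : Perm (Fin n)} (hσ : σ ∈ shuffles i n) (d : Fin n → ℤ) :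
    koszulSign σ d = maskSign (fun k => decide ((σ.symm k : ℕ) < i)) d := by
  simp only [shuffles, Finset.mem_filter, Finset.mem_univ, true_and] at hσ
  rw [koszulSign, maskSign]
  conv_rhs => rw [← Equiv.prod_comp σ]
  refine Finset.prod_congr rfl fun j _ => ?_
  conv_rhs => rw [← Equiv.prod_comp σ]
  refine Finset.prod_congr rfl fun k _ => ?_
  refine if_congr ?_ rfl rfl
  simp only [Equiv.symm_apply_apply, decide_eq_true_eq, decide_eq_false_iff_not, not_lt]
  constructor
  · rintro ⟨h1, h2⟩
    refine ⟨h2, ?_, ?_⟩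
    · by_contra h
      exact absurd (hσ.2 j k h1 (by omega)) h2.not_gt
    · by_contra h
      exact absurd (hσ.1 j k h1 (by omega)) h2.not_gt
  · rintro ⟨h1, h2, h3⟩
    exact ⟨Fin.lt_def.2 (by omega), h1⟩

theorem maskList_shuffle {i m n : ℕ} (h : i + m = n) {σ : Perm (Fin n)} (hσ : σ ∈ shuffles i n)
    (x : Fin n → X) :
    maskList (fun k => decide ((σ.symm k : ℕ) < i)) x =
        List.ofFn (fun j : Fin i => x (σ ⟨j, by omega⟩)) ∧
      maskList (fun k => !decide ((σ.symm k : ℕ) < i)) x =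
        List.ofFn (fun j : Fin m => x (σ ⟨i + j, by omega⟩)) := by
  simp only [shuffles, Finset.mem_filter, Finset.mem_univ, true_and] at hσ
  have key : ∀ (g : Fin n → Bool) (r : ℕ) (e : Fin r → Fin n), StrictMono (σ ∘ e) →
      (∀ k, g (σ k) = true ↔ ∃ j, e j = k) →
      maskList g x = List.ofFn (fun j => x (σ (e j))) := fun g r e he hg => by
    have : (List.finRange n).filter g = List.ofFn (σ ∘ e) := by
      refine List.Perm.eq_of_pairwise (le := (· < ·)) (fun a b _ _ h h' => absurd h h'.not_gt)
        ((List.pairwise_lt_finRange n).filter _) (List.pairwise_ofFn.2 fun _ _ h => he h) ?_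
      rw [List.perm_ext_iff_of_nodup ((List.nodup_finRange n).filter _)
        (List.nodup_ofFn.2 he.injective)]
      intro a
      obtain ⟨k, rfl⟩ := σ.surjective a
      simp [hg, List.mem_ofFn]
    rw [maskList, this, List.map_ofFn]
    rfl
  refine ⟨key _ i (fun j => ⟨j, by omega⟩) (fun a b hab => hσ.1 _ _ hab b.2) fun k => ?_,
    key _ m (fun j => ⟨i + j, by omega⟩) (fun a b hab => hσ.2 _ _ ?_ ?_) fun k => ?_⟩
  · simp only [Equiv.symm_apply_apply, decide_eq_true_eq]
    exact ⟨fun h => ⟨⟨k, h⟩, rfl⟩, by rintro ⟨j, rfl⟩; exact j.2⟩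
  · simpa using hab
  · simp
  · simp only [Equiv.symm_apply_apply, Bool.not_eq_true', decide_eq_false_iff_not, not_lt]
    exact ⟨fun h => ⟨⟨k - i, by omega⟩, Fin.ext (by simp; omega)⟩, by rintro ⟨j, rfl⟩; simp⟩

/-- As `false < true`, sorting by the negation of `g` places the positions selected by `g` first. -/
theorem sort_not_apply_lt {n : ℕ} (g : Fin n → Bool) (a : Fin n) :
    (a : ℕ) < ((List.finRange n).filter g).length ↔ g (Tuple.sort (fun k => !g k) a) = true := by
  have h := Tuple.lt_card_lt_iff_apply_lt_of_monotone (j := a) (a := true)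
    (Tuple.monotone_sort fun k => !g k)
  have hc : (Finset.univ.filter fun k => ((fun k => !g k) ∘ Tuple.sort fun k => !g k) k < true).card =
      ((List.finRange n).filter g).length := by
    rw [← Finset.card_map (Tuple.sort fun k => !g k).toEmbedding]
    rw [← List.toFinset_card_of_nodup ((List.nodup_finRange n).filter _)]
    congr 1
    ext k
    simp [Bool.lt_iff, Finset.mem_map_equiv]
  rw [← hc, h]
  simp [Bool.lt_iff]

/-- The bridge between shuffles and `split`: an `(i, m)`-shuffle is determined by the `i`-element
set of its first values. -/
theorem sum_shuffles_eq_split (dg : X → ℤ) {i m n : ℕ} (h : i + m = n) (x : Fin n → X)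
    (f : List X → List X → M) :
    ∑ σ ∈ shuffles i n, (koszulSign σ (fun k => dg (x k)) : ℤ) •
        f (List.ofFn fun j : Fin i => x (σ ⟨j, by omega⟩))
          (List.ofFn fun j : Fin m => x (σ ⟨i + j, by omega⟩)) =
      split dg (List.ofFn x) (fun a b => if a.length = i then f a b else 0) := by
  classical
  simp only [split_ofFn, maskList_length, smul_ite, smul_zero]
  rw [← Finset.sum_filter]
  -- The inverse recovers the shuffle as a stable sort: ties keep their order, so the permutation is
  -- increasing on each block.
  refine Finset.sum_nbij' (fun σ k => decide ((σ.symm k : ℕ) < i))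
    (fun g => Tuple.sort fun k => !g k) ?_ ?_ ?_ ?_ ?_
  · intro σ hσ
    have := (maskList_shuffle h hσ (fun k => k)).1
    simp only [Finset.mem_filter, Finset.mem_univ, true_and]
    rw [← maskList_length _ (fun k => k), this, List.length_ofFn]
  · intro g hg
    simp only [Finset.mem_filter, Finset.mem_univ, true_and] at hg
    obtain ⟨h1, h2⟩ := Tuple.eq_sort_iff.1 (Eq.refl (Tuple.sort fun k => !g k))
    have h3 := sort_not_apply_lt g
    rw [hg] at h3
    simp only [shuffles, Finset.mem_filter, Finset.mem_univ, true_and]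
    refine ⟨fun j k hjk hk => h2 _ _ hjk ?_, fun j k hjk hj => h2 _ _ hjk ?_⟩
    · rw [(h3 k).1 hk, (h3 j).1 (lt_trans hjk hk)]
    · have hj' := mt (h3 j).2 (by omega)
      have hk' := mt (h3 k).2 (by have : (j : ℕ) < k := hjk; omega)
      simp only [Bool.not_eq_true] at hj' hk'
      rw [hj', hk']
  · intro σ hσ
    simp only [shuffles, Finset.mem_filter, Finset.mem_univ, true_and] at hσ
    symm
    rw [Tuple.eq_sort_iff]
    refine ⟨fun a b hab => ?_, fun a b hab h => ?_⟩
    · have : (a : ℕ) ≤ b := hab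
      simp only [Function.comp, Equiv.symm_apply_apply]
      by_cases h1 : (a : ℕ) < i
      · simp [h1]
      · simp [h1, show ¬ (b : ℕ) < i by omega]
    · simp only [Equiv.symm_apply_apply] at h
      by_cases h1 : (b : ℕ) < i
      · exact hσ.1 a b hab h1
      · exact hσ.2 a b hab (by simpa [h1] using h)
  · intro g hg
    simp only [Finset.mem_filter, Finset.mem_univ, true_and] at hg
    have h3 := sort_not_apply_lt g
    rw [hg] at h3
    funext k
    rw [Bool.eq_iff_iff, decide_eq_true_eq, h3, Equiv.apply_symm_apply]
  · intro σ hσ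
    obtain ⟨h1, h2⟩ := maskList_shuffle h hσ x
    rw [koszulSign_shuffle hσ, h1, h2]

end Shuffle

/-! ### Graded symmetric functions of lists -/

section Symmetric

variable {X M : Type*} [AddCommGroup M]

/-- `F` changes by the Koszul sign when two neighbours in its argument are exchanged. -/
def GradedSymm (dg : X → ℤ) (F : List X → M) : Prop :=
  ∀ p q x y, F (p ++ x :: y :: q) = sgn (dg x * dg y) • F (p ++ y :: x :: q)

theorem GradedSymm.cons {dg : X → ℤ} {F : List X → M} (hF : GradedSymm dg F) (z : X) :
    GradedSymm dg (fun l => F (z :: l)) := fun p q x y => hF (z :: p) q x y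

theorem GradedSymm.move {dg : X → ℤ} {F : List X → M} (hF : GradedSymm dg F) (x : X)
    (p l q : List X) : F (p ++ x :: (l ++ q)) = sgn (dg x * degSum dg l) • F (p ++ (l ++ x :: q)) := by
  induction l generalizing p with
  | nil => simp
  | cons y l ih =>
    have h := ih (p ++ [y])
    simp only [List.append_assoc, List.singleton_append] at h
    rw [List.cons_append, hF, h, smul_smul, ← sgn_add, degSum_cons, mul_add]
    rfl

/-- Moving the `k`-th entry to the front costs one sign for each entry that it passes. -/
theorem GradedSymm.apply_cons_succAbove {dg : X → ℤ} {n : ℕ} {F : List X → M}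
    (hF : GradedSymm dg F) (x : Fin (n + 1) → X) (k : Fin (n + 1)) :
    F (x k :: List.ofFn fun j => x (k.succAbove j)) =
      ((∏ j, if j < k then Int.negOnePow (dg (x k) * dg (x j)) else 1 : ℤˣ) : ℤ) •
        F (List.ofFn x) := by
  induction n generalizing F with
  | zero =>
    obtain rfl : k = 0 := Fin.fin_one_eq_zero k
    simp
  | succ n ih =>
    refine Fin.cases ?_ (fun k => ?_) k
    · simp [List.ofFn_succ]
    · rw [List.ofFn_succ]
      simp only [Fin.succ_succAbove_zero, Fin.succ_succAbove_succ]
      have h1 := hF [] (List.ofFn fun j => x (k.succAbove j).succ) (x k.succ) (x 0)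
      have h2 := ih (hF.cons (x 0)) (fun j => x j.succ) k
      simp only [List.nil_append] at h1
      rw [h1, h2, smul_smul, List.ofFn_succ (f := x)]
      congr 1
      conv_rhs => rw [Fin.prod_univ_succ]
      simp only [Fin.succ_pos, if_true, Fin.succ_lt_succ_iff, Units.val_mul, sgn]

/-- The permutation of the remaining indices after `0` and its image are deleted. -/
def deleteZero {n : ℕ} (σ : Perm (Fin (n + 1))) : Perm (Fin n) :=
  ((finSuccAboveEquiv 0).trans
    (σ.subtypeEquiv (p := fun a => a ≠ 0) (q := fun a => a ≠ σ 0) (by simp))).trans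
    (finSuccAboveEquiv (σ 0)).symm

theorem succAbove_deleteZero {n : ℕ} (σ : Perm (Fin (n + 1))) (j : Fin n) :
    (σ 0).succAbove (deleteZero σ j) = σ j.succ := by
  have h := (finSuccAboveEquiv (σ 0)).apply_symm_apply
    ((σ.subtypeEquiv (p := fun a => a ≠ 0) (q := fun a => a ≠ σ 0) (by simp))
      (finSuccAboveEquiv 0 j))
  have h' := congrArg Subtype.val h
  refine h'.trans (congrArg σ ?_)
  exact congrFun Fin.succAbove_zero j

/-- The inversions of `σ` that involve position `0` are separated from the others, as needed for the
induction in `GradedSymm.apply_perm`. -/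
theorem koszulSign_deleteZero {n : ℕ} (σ : Perm (Fin (n + 1))) (d : Fin (n + 1) → ℤ) :
    koszulSign σ d = (∏ j, if j < σ 0 then Int.negOnePow (d (σ 0) * d j) else 1) *
      koszulSign (deleteZero σ) (fun j => d ((σ 0).succAbove j)) := by
  have h : (∏ j, if j < σ 0 then Int.negOnePow (d (σ 0) * d j) else 1) =
      ∏ j, if σ (Fin.succ j) < σ 0 then Int.negOnePow (d (σ 0) * d (σ j.succ)) else 1 := by
    rw [Fin.prod_univ_succAbove _ (σ 0), ← Equiv.prod_comp (deleteZero σ)]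
    simp [succAbove_deleteZero]
  rw [h, koszulSign, Fin.prod_univ_succ]
  simp only [Fin.prod_univ_succ, lt_self_iff_false, false_and, if_false, one_mul, Fin.succ_pos,
    true_and, not_lt_zero, Fin.succ_lt_succ_iff, ← succAbove_deleteZero,
    (Fin.strictMono_succAbove (σ 0)).lt_iff_lt, koszulSign]

/-- Exchanges of neighbours suffice: bring `x (σ 0)` to the front, then permute the rest by
induction. -/
theorem GradedSymm.apply_perm {dg : X → ℤ} {n : ℕ} {F : List X → M}
    (hF : GradedSymm dg F) (x : Fin n → X) (σ : Perm (Fin n)) :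
    F (List.ofFn fun i => x (σ i)) =
      (koszulSign σ (fun i => dg (x i)) : ℤ) • F (List.ofFn x) := by
  induction n generalizing F with
  | zero => simp [koszulSign]
  | succ n ih =>
    rw [List.ofFn_succ]
    simp only [← succAbove_deleteZero]
    rw [ih (hF.cons (x (σ 0))) (fun j => x ((σ 0).succAbove j)) (deleteZero σ),
      hF.apply_cons_succAbove, smul_smul, koszulSign_deleteZero, mul_comm, Units.val_mul]

/-- In odd degree each inversion contributes `-1`. This is why `split` in constant degree one
describes alternating maps. -/
theorem koszulSign_one {n : ℕ} (σ : Perm (Fin n)) : koszulSign σ (fun _ => 1) = Perm.sign σ := by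
  rw [Perm.sign_eq_prod_prod_Iio, koszulSign, Finset.prod_comm]
  refine Finset.prod_congr rfl fun j _ => ?_
  rw [← Finset.prod_filter_mul_prod_filter_not Finset.univ (· < j)]
  rw [Finset.prod_eq_one (s := Finset.univ.filter fun i => ¬ i < j), mul_one]
  · refine Finset.prod_congr (by ext; simp) fun i hi => ?_
    have hi : i < j := by simpa using hi
    rcases lt_trichotomy (σ i) (σ j) with h | h | h
    · simp [h, h.not_gt]
    · exact absurd (σ.injective h) hi.ne
    · simp [hi, h, h.not_gt]
  · intro i hi
    simp only [Finset.mem_filter, Finset.mem_univ, true_and] at hi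
    simp [hi]

end Symmetric

/-! ### `L_∞`-algebras in terms of lists -/

section ListLInfinity

variable {K E : Type*} [Field K] [AddCommGroup E] [Module K E]

/-- Homogeneous elements. -/
abbrev Homog (𝒜 : ℤ → Submodule K E) := Σ m, 𝒜 m

/-- The underlying element of a homogeneous element. -/
def Homog.val {𝒜 : ℤ → Submodule K E} (x : Homog 𝒜) : E := x.2

/-- The underlying list of elements of a list of homogeneous elements. -/
def vals {𝒜 : ℤ → Submodule K E} (a : List (Homog 𝒜)) : List E := a.map Homog.val

@[simp] theorem vals_nil {𝒜 : ℤ → Submodule K E} : vals ([] : List (Homog 𝒜)) = [] := rfl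

@[simp] theorem vals_cons {𝒜 : ℤ → Submodule K E} (x : Homog 𝒜) (a : List (Homog 𝒜)) :
    vals (x :: a) = x.val :: vals a := rfl

@[simp] theorem vals_append {𝒜 : ℤ → Submodule K E} (a b : List (Homog 𝒜)) :
    vals (a ++ b) = vals a ++ vals b := List.map_append ..

@[simp] theorem vals_replicate {𝒜 : ℤ → Submodule K E} (n : ℕ) (x : Homog 𝒜) :
    vals (List.replicate n x) = List.replicate n x.val := List.map_replicate ..

/-- An `L_∞`-algebra, with all brackets combined into one function of lists. -/
structure ListLInfinity (𝒜 : ℤ → Submodule K E) (L : List E → E) : Prop where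
  graded : DirectSum.IsInternal 𝒜
  nil : L [] = 0
  map_add : ∀ p q x y, L (p ++ (x + y) :: q) = L (p ++ x :: q) + L (p ++ y :: q)
  map_smul : ∀ p q (c : K) x, L (p ++ (c • x) :: q) = c • L (p ++ x :: q)
  degree_one : ∀ a : List (Homog 𝒜), L (vals a) ∈ 𝒜 (degSum Sigma.fst a + 1)
  symm : GradedSymm (X := Homog 𝒜) Sigma.fst fun a => L (vals a)
  jacobi : ∀ a : List (Homog 𝒜),
    split Sigma.fst a (fun b c => L (L (vals b) :: vals c)) = 0

theorem vals_ofFn {𝒜 : ℤ → Submodule K E} {n : ℕ} (x : Fin n → Homog 𝒜) :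
    vals (List.ofFn x) = List.ofFn fun i => (x i).val := List.map_ofFn ..

theorem ofFn_update {X : Type*} {n : ℕ} (x : Fin n → X) (i : Fin n) (a : X) :
    List.ofFn (Function.update x i a) =
      (List.ofFn x).take i ++ a :: (List.ofFn x).drop (i + 1) := by
  have h := List.set_eq_take_append_cons_drop (l := List.ofFn x) (i := i) (a := a)
  rw [List.length_ofFn, if_pos i.2] at h
  rw [← h]
  refine List.ext_getElem (by simp) fun j h1 h2 => ?_
  simp only [List.getElem_ofFn, List.getElem_set, Function.update_apply, Fin.ext_iff]
  exact if_congr eq_comm rfl rfl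

theorem degSum_ofFn {X : Type*} (dg : X → ℤ) {n : ℕ} (x : Fin n → X) :
    degSum dg (List.ofFn x) = ∑ i, dg (x i) := by
  rw [degSum, List.map_ofFn, List.sum_ofFn]; rfl

/-- Sorting the single list identity by the length of the first block gives the sum over `i` in the
generalized Jacobi identity. -/
theorem ListLInfinity.isLInfinity {𝒜 : ℤ → Submodule K E} {L : List E → E}
    (h : ListLInfinity 𝒜 L) {l : (k : ℕ) → (Fin k → E) → E}
    (hl : ∀ k, 1 ≤ k → ∀ x, l k x = L (List.ofFn x)) : IsLInfinity 𝒜 l where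
  graded := h.graded
  multilinear k hk := ⟨MultilinearMap.mk' (l k)
    (fun x i a b => by simp only [hl k hk, ofFn_update, h.map_add])
    (fun x i c a => by simp only [hl k hk, ofFn_update, h.map_smul]), fun _ => rfl⟩
  degree_one k hk d x hx := by
    have := h.degree_one (List.ofFn fun i => (⟨d i, x i, hx i⟩ : Homog 𝒜))
    rw [vals_ofFn, degSum_ofFn] at this
    rw [hl k hk]
    exact this
  symm n hn d x hx σ := by
    have := h.symm.apply_perm (fun i => (⟨d i, x i, hx i⟩ : Homog 𝒜)) σ
    simp only [vals_ofFn] at this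
    rw [hl n hn, hl n hn]
    exact this
  jacobi n hn d x hx := by
    let y : Fin n → Homog 𝒜 := fun i => ⟨d i, x i, hx i⟩
    have key : ∀ i : Fin n, ∑ σ ∈ shuffles (i + 1) n, (koszulSign σ d : ℤ) •
        l (n - (i + 1) + 1) (Fin.cons (α := fun _ => E)
          (l (i + 1) fun j : Fin (i + 1) => x (σ ⟨j, by omega⟩))
          (fun j : Fin (n - (i + 1)) => x (σ ⟨i + 1 + j, by omega⟩))) =
        split Sigma.fst (List.ofFn y) (fun a b => if a.length = i + 1 then
          L (L (vals a) :: vals b) else 0) := fun i => by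
      rw [← sum_shuffles_eq_split Sigma.fst (i := i + 1) (m := n - (i + 1)) (by omega) y
        (fun a b => L (L (vals a) :: vals b))]
      refine Finset.sum_congr rfl fun σ _ => ?_
      rw [hl _ (by omega), hl _ (by omega), List.ofFn_succ, vals_ofFn, vals_ofFn]
      rfl
    rw [Finset.sum_congr rfl fun i _ => key i, ← split_sum]
    refine (split_congr _ fun a b hab => ?_).trans (h.jacobi (List.ofFn y))
    have hlen := hab.length_eq
    rw [List.length_append, List.length_ofFn] at hlen
    cases a with
    -- An empty inner block is absent from the shuffle form; here it contributes zero because `L []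
    -- = 0`.
    | nil => 
      simp only [List.length_nil, vals_nil, h.nil]
      have := h.map_smul [] (vals b) 0 0
      simp only [zero_smul, List.nil_append] at this
      simp [this]
    | cons z a =>
      rw [List.length_cons] at hlen
      rw [Finset.sum_eq_single ⟨a.length, by omega⟩]
      · simp
      · rintro i - hi
        rw [if_neg]
        rw [List.length_cons]
        exact fun h => hi (Fin.ext (by simpa using h.symm))
      · simp

end ListLInfinity

end RelRB

namespace RelRB

open Equiv Filter

/-! ### Twisting by a Maurer–Cartan element, for brackets whose series are finite -/

section Twisting

variable {K E : Type*} [Field K] [AddCommGroup E] [Module K E]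

/-- All sufficiently long lists made of finitely many given elements have zero bracket. -/
def LocallyNilpotent (L : List E → E) : Prop :=
  ∀ A : List E, ∃ B, ∀ xs : List E, (∀ x ∈ xs, x ∈ A) → B ≤ xs.length → L xs = 0

/-- The `n`-th term of the series for the twisted bracket. -/
def twistListTerm (K : Type*) [Field K] {E : Type*} [AddCommGroup E] [Module K E]
    (L : List E → E) (α : E) (a : List E) (n : ℕ) : E :=
  (n.factorial : K)⁻¹ • L (List.replicate n α ++ a)

theorem LocallyNilpotent.exists_bound {L : List E → E} (h : LocallyNilpotent L) (A : List E) :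
    ∃ B, ∀ a : List E, (∀ x ∈ a, x ∈ A) → ∀ α ∈ A, ∀ n, B ≤ n + a.length →
      L (List.replicate n α ++ a) = 0 := by
  obtain ⟨B, hB⟩ := h A
  refine ⟨B, fun a ha α hα n hn => hB _ (fun x hx => ?_) (by simpa using hn)⟩
  rcases List.mem_append.1 hx with hx | hx
  · rwa [List.eq_of_mem_replicate hx]
  · exact ha x hx

/-- The twisted bracket as a function of lists. -/
noncomputable def twistList (K : Type*) [Field K] {E : Type*} [AddCommGroup E] [Module K E]
    (L : List E → E) (α : E) (a : List E) : E :=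
  ∑ᶠ n, twistListTerm K L α a n

theorem LocallyNilpotent.term_eventually {L : List E → E} (h : LocallyNilpotent L) (α : E)
    (a : List E) : ∃ B, ∀ n, B ≤ n → L (List.replicate n α ++ a) = 0 := by
  obtain ⟨B, hB⟩ := h.exists_bound (α :: a)
  exact ⟨B, fun n hn => hB a (fun x hx => List.mem_cons_of_mem _ hx) α (by simp) n (by omega)⟩

/-- The `finsum` takes the value `0` on infinite support, so the bound `B` is what makes the twisted
bracket meaningful without any filtration. -/
theorem twistList_eq_sum {L : List E → E} {α : E} {a : List E} {B : ℕ}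
    (hB : ∀ n, B ≤ n → L (List.replicate n α ++ a) = 0) :
    twistList K L α a = ∑ n ∈ Finset.range B, twistListTerm K L α a n := by
  refine finsum_eq_sum_of_support_subset _ fun n hn => ?_
  by_contra hn'
  simp only [Finset.coe_range, Set.mem_Iio, not_lt] at hn'
  exact hn (by simp [twistListTerm, hB n hn'])

/-- Stated with a filter so that finitely many series can be truncated at a common length. -/
theorem LocallyNilpotent.twistList_eventually {L : List E → E} (h : LocallyNilpotent L) (α : E)
    (a : List E) : ∀ᶠ M in atTop,
      twistList K L α a = ∑ n ∈ Finset.range M, twistListTerm K L α a n := by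
  obtain ⟨B, hB⟩ := h.term_eventually α a
  filter_upwards [eventually_ge_atTop B] with M hM
  exact twistList_eq_sum fun n hn => hB n (hM.trans hn)

theorem split_eventually {X M : Type*} [AddCommGroup M] (dg : X → ℤ) (l : List X)
    {f : ℕ → List X → List X → M} {g : List X → List X → M}
    (h : ∀ a b, ∀ᶠ n in atTop, f n a b = g a b) :
    ∀ᶠ n in atTop, split dg l (f n) = split dg l g := by
  induction l generalizing f g with
  | nil => exact h [] []
  | cons x l ih =>
    filter_upwards [ih (fun a b => h (x :: a) b),
      ih (f := fun n a b => sgn (dg x * degSum dg a) • f n a (x :: b))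
        (g := fun a b => sgn (dg x * degSum dg a) • g a (x :: b))
        (fun a b => (h a (x :: b)).mono fun n hn => by rw [hn])] with n h1 h2
    rw [split_cons, h1, h2]; rfl

/-- All antidiagonals meeting the square of side `B` have index below `2 * B`, and `g` vanishes on
their parts outside the square. -/
theorem sum_range_antidiagonal {M : Type*} [AddCommMonoid M] (g : ℕ → ℕ → M) (B : ℕ)
    (hg : ∀ i j, B ≤ i ∨ B ≤ j → g i j = 0) :
    ∑ i ∈ Finset.range B, ∑ j ∈ Finset.range B, g i j =
      ∑ N ∈ Finset.range (2 * B), ∑ ij ∈ Finset.HasAntidiagonal.antidiagonal N, g ij.1 ij.2 := by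
  rw [← Finset.sum_product', ← Finset.sum_fiberwise_of_maps_to (s := Finset.range B ×ˢ Finset.range B)
    (t := Finset.range (2 * B)) (g := fun ij => ij.1 + ij.2)]
  · refine Finset.sum_congr rfl fun N _ => ?_
    refine Finset.sum_subset (fun ij h => ?_) fun ij h h' => ?_
    · simp only [Finset.mem_filter] at h
      exact Finset.HasAntidiagonal.mem_antidiagonal.2 h.2
    · have := Finset.HasAntidiagonal.mem_antidiagonal.1 h
      refine hg _ _ ?_
      by_contra hc
      push Not at hc
      exact h' (by simp [hc.1, hc.2, this])
  · intro ij h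
    simp only [Finset.mem_product, Finset.mem_range] at h ⊢
    omega

theorem inv_factorial_mul_choose {K : Type*} [Field K] [CharZero K] (i j : ℕ) :
    (i.factorial : K)⁻¹ * (j.factorial : K)⁻¹ =
      ((i + j).factorial : K)⁻¹ * ((i + j).choose i : K) := by
  rw [Nat.choose_symm_add, Nat.add_choose, Nat.cast_div (Nat.factorial_mul_factorial_dvd_factorial_add _ _)]
  · push_cast
    have := (Nat.cast_ne_zero (R := K)).2 (Nat.factorial_ne_zero (i + j))
    field_simp
  · exact_mod_cast (mul_ne_zero (Nat.factorial_ne_zero _) (Nat.factorial_ne_zero _))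

variable {𝒜 : ℤ → Submodule K E} {L : List E → E}

theorem ListLInfinity.cons_zero (h : ListLInfinity 𝒜 L) (p q : List E) : L (p ++ 0 :: q) = 0 := by
  have := h.map_smul p q 0 0
  simpa using this

theorem ListLInfinity.cons_sum (h : ListLInfinity 𝒜 L) {ι : Type*} (s : Finset ι) (f : ι → E)
    (p q : List E) : L (p ++ (∑ i ∈ s, f i) :: q) = ∑ i ∈ s, L (p ++ f i :: q) := by
  classical
  induction s using Finset.induction_on with
  | empty => simpa using h.cons_zero p q
  | insert i s hi ih => rw [Finset.sum_insert hi, Finset.sum_insert hi, h.map_add, ih]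

theorem ListLInfinity.replicate_cons (h : ListLInfinity 𝒜 L) {α : E} (hα : α ∈ 𝒜 0) (n : ℕ)
    (x : Homog 𝒜) (a : List (Homog 𝒜)) :
    L (List.replicate n α ++ x.val :: vals a) = L (x.val :: (List.replicate n α ++ vals a)) := by
  have := h.symm.move x [] (List.replicate n ⟨0, α, hα⟩) a
  have hd : degSum Sigma.fst (List.replicate n (⟨0, α, hα⟩ : Homog 𝒜)) = 0 := by
    simp [degSum]
  rw [hd] at this
  simpa [Homog.val] using this.symm

/-- The twist of an `L_∞`-algebra by a Maurer–Cartan element. -/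
theorem ListLInfinity.twistList [CharZero K] (h : ListLInfinity 𝒜 L) (hn : LocallyNilpotent L) {α : E}
    (hα : α ∈ 𝒜 0) (hmc : twistList K L α [] = 0) : ListLInfinity 𝒜 (twistList K L α) where
  graded := h.graded
  -- The twisted bracket of the empty list is the Maurer–Cartan series of `α`; its vanishing is what
  -- excludes a curvature term.
  nil := hmc
  map_add p q x y := by
    obtain ⟨M, h1, h2, h3⟩ := ((hn.twistList_eventually (K := K) α (p ++ (x + y) :: q)).and
      ((hn.twistList_eventually (K := K) α (p ++ x :: q)).and
      (hn.twistList_eventually (K := K) α (p ++ y :: q)))).exists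
    rw [h1, h2, h3, ← Finset.sum_add_distrib]
    refine Finset.sum_congr rfl fun n _ => ?_
    simp only [twistListTerm, ← List.append_assoc, h.map_add, smul_add]
  map_smul p q c x := by
    obtain ⟨M, h1, h2⟩ := ((hn.twistList_eventually (K := K) α (p ++ (c • x) :: q)).and
      (hn.twistList_eventually (K := K) α (p ++ x :: q))).exists
    rw [h1, h2, Finset.smul_sum]
    refine Finset.sum_congr rfl fun n _ => ?_
    simp only [twistListTerm, ← List.append_assoc, h.map_smul, smul_comm c]
  degree_one a := by
    obtain ⟨M, h1⟩ := (hn.twistList_eventually (K := K) α (vals a)).exists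
    rw [h1]
    refine Submodule.sum_mem _ fun n _ => Submodule.smul_mem _ _ ?_
    have := h.degree_one (List.replicate n ⟨0, α, hα⟩ ++ a)
    simpa [degSum, Homog.val] using this
  symm p q x y := by
    obtain ⟨M, h1, h2⟩ := ((hn.twistList_eventually (K := K) α (vals (p ++ x :: y :: q))).and
      (hn.twistList_eventually (K := K) α (vals (p ++ y :: x :: q)))).exists
    refine h1.trans (Eq.trans ?_ (congrArg (fun e => sgn (x.1 * y.1) • e) h2.symm))
    simp only [Finset.smul_sum]
    refine Finset.sum_congr rfl fun n _ => ?_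
    have := h.symm (List.replicate n ⟨0, α, hα⟩ ++ p) q x y
    simp only [List.append_assoc, vals_append, vals_replicate] at this
    simp only [twistListTerm, vals_append]
    rw [smul_comm]
    congr 1
  jacobi a := by
    let α' : Homog 𝒜 := ⟨0, α, hα⟩
    let g : List (Homog 𝒜) → List (Homog 𝒜) → ℕ → ℕ → E := fun b c i j =>
      ((i.factorial : K)⁻¹ * (j.factorial : K)⁻¹) •
        L (L (List.replicate i α ++ vals b) :: (List.replicate j α ++ vals c))
    -- The outer list contains the inner bracket, which varies with `i`, so its bound `C i` depends
    -- on `i`. Only the finitely many `i < B` matter, and adding their bounds to `B` dominates all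
    -- of them.
    have hbound : ∀ b c, ∃ B, ∀ i j, B ≤ i ∨ B ≤ j → g b c i j = 0 := fun b c => by
      obtain ⟨B, hB⟩ := hn.term_eventually α (vals b)
      have h2 : ∀ i, ∃ C, ∀ j, C ≤ j →
          L (L (List.replicate i α ++ vals b) :: (List.replicate j α ++ vals c)) = 0 := fun i => by
        let y : Homog 𝒜 := ⟨_, _, h.degree_one (List.replicate i α' ++ b)⟩
        obtain ⟨C, hC⟩ := hn.term_eventually α (y.val :: vals c)
        refine ⟨C, fun j hj => ?_⟩
        have := h.replicate_cons hα j y c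
        rw [hC j hj] at this
        simpa [y, Homog.val, α'] using this.symm
      choose C hC using h2
      refine ⟨B + ∑ i ∈ Finset.range B, C i, fun i j hij => ?_⟩
      by_cases hi : B ≤ i
      · have := h.cons_zero [] (List.replicate j α ++ vals c)
        simp only [List.nil_append] at this
        simp only [g, hB i hi, this, smul_zero]
      · have hj : C i ≤ j := by
          have := Finset.single_le_sum (f := C) (fun _ _ => Nat.zero_le _)
            (Finset.mem_range.2 (not_le.1 hi))
          omega
        simp only [g, hC i j hj, smul_zero]
    have hterm : ∀ b c, ∀ᶠ M in atTop,
        ∑ N ∈ Finset.range (2 * M), ∑ ij ∈ Finset.HasAntidiagonal.antidiagonal N,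
          g b c ij.1 ij.2 =
        RelRB.twistList K L α (RelRB.twistList K L α (vals b) :: vals c) := fun b c => by
      obtain ⟨B, hB⟩ := hbound b c
      filter_upwards [eventually_ge_atTop B, hn.twistList_eventually (K := K) α (vals b),
        hn.twistList_eventually (K := K) α (RelRB.twistList K L α (vals b) :: vals c)] with M h1 h2 h3
      rw [← sum_range_antidiagonal (g b c) M fun i j hij => hB i j (by omega), h3,
        Finset.sum_comm]
      refine Finset.sum_congr rfl fun j _ => ?_
      rw [twistListTerm, h2, h.cons_sum, Finset.smul_sum]
      refine Finset.sum_congr rfl fun i _ => ?_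
      let y : Homog 𝒜 := ⟨_, _, h.degree_one (List.replicate i α' ++ b)⟩
      have h4 := h.replicate_cons hα j y c
      have h5 : y.val = L (List.replicate i α ++ vals b) := by simp [y, Homog.val, α']
      rw [h5] at h4
      rw [twistListTerm, h.map_smul, h4, smul_smul, mul_comm]
    obtain ⟨M, hM⟩ := (split_eventually Sigma.fst a hterm).exists
    rw [← hM, split_sum]
    refine Finset.sum_eq_zero fun N _ => ?_
    -- The Jacobi identity of `L` on `N` copies of `α` followed by `a`. The copies have degree `0`
    -- and distribute with binomial coefficients, which `1/N!` turns into `1/(i! j!)`.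
    have h6 := h.jacobi (List.replicate N α' ++ a)
    rw [split_replicate_append _ α' rfl] at h6
    rw [split_sum]
    have h7 := congrArg (fun e => (N.factorial : K)⁻¹ • e) h6
    simp only [smul_zero, Finset.smul_sum] at h7
    rw [← h7]
    refine Finset.sum_congr rfl fun ij hij => ?_
    have hN := Finset.HasAntidiagonal.mem_antidiagonal.1 hij
    rw [← Nat.cast_smul_eq_nsmul K, smul_smul, ← LinearMap.lsmul_apply (R := K) (M := E), map_split]
    refine split_congr _ fun b c _ => ?_
    rw [LinearMap.lsmul_apply]
    simp only [g, vals_append, vals_replicate]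
    congr 1
    rw [← hN]
    exact inv_factorial_mul_choose ij.1 ij.2

/-- The binomial formula for entries of degree `0`, which commute without sign. The counters `i` and
`j` collect the entries already expanded. -/
theorem ListLInfinity.replicate_add (h : ListLInfinity 𝒜 L) {α β : E} (hα : α ∈ 𝒜 0)
    (hβ : β ∈ 𝒜 0) (N i j : ℕ) :
    L (List.replicate i α ++ (List.replicate j β ++ List.replicate N (α + β))) =
      ∑ ij ∈ Finset.HasAntidiagonal.antidiagonal N, N.choose ij.1 •
        L (List.replicate (i + ij.1) α ++ List.replicate (j + ij.2) β) := by
  induction N generalizing i j with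
  | zero => simp
  | succ N ih =>
    rw [List.replicate_succ, ← List.append_assoc, h.map_add,
      Finset.sum_antidiagonal_choose_succ_nsmul (fun a b =>
        L (List.replicate (i + a) α ++ List.replicate (j + b) β)), add_comm]
    have e1 : L ((List.replicate i α ++ List.replicate j β) ++ β :: List.replicate N (α + β)) =
        L (List.replicate i α ++ (List.replicate (j + 1) β ++ List.replicate N (α + β))) := by
      rw [List.replicate_succ', List.append_assoc, List.append_assoc]; rfl
    have e2 : L ((List.replicate i α ++ List.replicate j β) ++ α :: List.replicate N (α + β)) =
        L (List.replicate (i + 1) α ++ (List.replicate j β ++ List.replicate N (α + β))) := by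
      have := h.symm.move ⟨0, α, hα⟩ (List.replicate i ⟨0, α, hα⟩) (List.replicate j ⟨0, β, hβ⟩)
        (List.replicate N ⟨0, α + β, add_mem hα hβ⟩)
      simp only [zero_mul, sgn_zero, one_smul, vals_append, vals_cons, vals_replicate,
        Homog.val] at this
      rw [List.append_assoc, ← this, List.replicate_succ', List.append_assoc]; rfl
    rw [e1, e2, ih, ih]
    congr 1
    · exact Finset.sum_congr rfl fun ij _ => by rw [show j + 1 + ij.2 = j + (ij.2 + 1) by omega]
    · refine Finset.sum_congr rfl fun ij hij => ?_
      rw [Nat.choose_symm_of_eq_add (Finset.HasAntidiagonal.mem_antidiagonal.1 hij).symm,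
        show i + 1 + ij.1 = i + (ij.1 + 1) by omega]

theorem LocallyNilpotent.twistList {L : List E → E} (hn : LocallyNilpotent L) (α : E) :
    LocallyNilpotent (twistList K L α) := fun A => by
  obtain ⟨B, hB⟩ := hn.exists_bound (α :: A)
  refine ⟨B, fun xs hxs hlen => ?_⟩
  rw [twistList_eq_sum (B := 0)]
  · simp
  · exact fun n _ => hB xs (fun x hx => List.mem_cons_of_mem _ (hxs x hx)) α (by simp) n (by omega)

/-- Twisting by `α` and then by `β` is, on curvatures, twisting by `α + β`. -/
theorem ListLInfinity.twistList_twistList_nil [CharZero K] (h : ListLInfinity 𝒜 L) (hn : LocallyNilpotent L)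
    {α β : E} (hα : α ∈ 𝒜 0) (hβ : β ∈ 𝒜 0) :
    RelRB.twistList K (RelRB.twistList K L α) β [] = RelRB.twistList K L (α + β) [] := by
  obtain ⟨B, hB⟩ := hn [α, β, α + β]
  have h0 : ∀ i j, B ≤ i + j → L (List.replicate i α ++ List.replicate j β) = 0 := fun i j hij => by
    refine hB _ (fun x hx => ?_) (by simpa using hij)
    rcases List.mem_append.1 hx with hx | hx <;> simp [List.eq_of_mem_replicate hx]
  rw [twistList_eq_sum (B := B) (L := RelRB.twistList K L α), twistList_eq_sum (B := 2 * B)]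
  · let g : ℕ → ℕ → E := fun i j => ((i.factorial : K)⁻¹ * (j.factorial : K)⁻¹) •
      L (List.replicate i α ++ List.replicate j β)
    have h1 : ∀ j, twistListTerm K (RelRB.twistList K L α) β [] j =
        ∑ i ∈ Finset.range B, g i j := fun j => by
      rw [twistListTerm, List.append_nil, twistList_eq_sum (B := B), Finset.smul_sum]
      · exact Finset.sum_congr rfl fun i _ => by rw [twistListTerm, smul_smul, mul_comm]
      · exact fun n hn' => h0 n j (by omega)
    simp only [h1]
    rw [Finset.sum_comm, sum_range_antidiagonal g B fun i j hij => by
      simp only [g, h0 i j (by omega), smul_zero]]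
    refine Finset.sum_congr rfl fun N _ => ?_
    have h2 := h.replicate_add hα hβ N 0 0
    simp only [List.replicate_zero, List.nil_append, zero_add] at h2
    rw [twistListTerm, List.append_nil, h2, Finset.smul_sum]
    refine Finset.sum_congr rfl fun ij hij => ?_
    have hN := Finset.HasAntidiagonal.mem_antidiagonal.1 hij
    rw [← Nat.cast_smul_eq_nsmul K, smul_smul]
    simp only [g]
    congr 1
    rw [← hN]
    exact inv_factorial_mul_choose ij.1 ij.2
  · intro n hn'
    refine hB _ (fun x hx => ?_) (by simp; omega)
    simp only [List.append_nil] at hx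
    simp [List.eq_of_mem_replicate hx]
  · intro n hn'
    rw [List.append_nil, twistList_eq_sum (B := 0)]
    · simp
    · exact fun m _ => h0 m n (by omega)

end Twisting

end RelRB

namespace RelRB

open Equiv Filter

/-! ### Weak filtrations: limits of finite series do not depend on the filtration -/

section Filtration

variable {K E : Type*} [Field K] [AddCommGroup E] [Module K E]
  {𝒜 : ℤ → Submodule K E} {l : (k : ℕ) → (Fin k → E) → E} {F : ℕ → Submodule K E}

/-- Separatedness is the uniqueness half of completeness. Completeness is given degree by degree, so
gradedness of `F n` is needed to pass to components. -/
theorem IsWeaklyFiltered.eq_zero (hF : IsWeaklyFiltered 𝒜 l F) {y : E} (hy : ∀ n, y ∈ F n) :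
    y = 0 := by
  classical
  let _ := hF.isLInfinity.graded.chooseDecomposition
  have key : ∀ n, ∀ z ∈ F n, ∀ m, (DirectSum.decompose 𝒜 z m : E) ∈ F n := fun n z hz m => by
    rw [hF.graded n] at hz
    induction hz using Submodule.iSup_induction' with
    | mem m' x hx =>
      by_cases hm : m' = m
      · subst hm
        rw [DirectSum.decompose_of_mem_same _ hx.2]
        exact hx.1
      · rw [DirectSum.decompose_of_mem_ne _ hx.2 hm]
        exact zero_mem _
    | zero => simp
    | add x y _ _ hx hy =>
      rw [DirectSum.decompose_add]
      exact add_mem hx hy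
  have hz : DirectSum.decompose 𝒜 y = 0 := by
    refine DFinsupp.ext fun m => Subtype.ext ?_
    -- Both `0` and the degree `m` component of `y` are limits of the zero sequence.
    obtain ⟨z, -, hu⟩ := hF.complete m (fun _ => 0) (fun _ => zero_mem _) (fun n => by simp)
    rw [hu _ ⟨SetLike.coe_mem _, fun n => by simpa using key n y (hy n) m⟩]
    exact (hu 0 ⟨zero_mem _, fun n => by simp⟩).symm
  exact (DirectSum.decompose 𝒜).injective (hz.trans (DirectSum.decompose_zero 𝒜).symm)

theorem IsWeaklyFiltered.seriesConverges_iff (hF : IsWeaklyFiltered 𝒜 l F) {a : ℕ → E} {B : ℕ}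
    (ha : ∀ n, B ≤ n → a n = 0) (s : E) :
    SeriesConverges F a s ↔ s = ∑ n ∈ Finset.range B, a n := by
  have hs : ∀ M, B ≤ M → ∑ n ∈ Finset.range M, a n = ∑ n ∈ Finset.range B, a n := fun M hM => by
    symm
    refine Finset.sum_subset (Finset.range_mono hM) fun n _ hn => ha n ?_
    simpa using hn
  constructor
  · intro h
    rw [← sub_eq_zero]
    refine hF.eq_zero fun n => ?_
    obtain ⟨N, hN⟩ := h n
    have := hN (max N B) (le_max_left _ _)
    rwa [hs _ (le_max_right _ _)] at this
  · rintro rfl n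
    refine ⟨B, fun M hM => ?_⟩
    rw [hs M hM, sub_self]
    exact zero_mem _

variable {L : List E → E}

theorem twistTerm_eq (hl : ∀ k (x : Fin k → E), l k x = L (List.ofFn x)) (α : E) (k : ℕ)
    (x : Fin k → E) :
    twistTerm (K := K) l α k x = twistListTerm K L α (List.ofFn x) := by
  funext n
  rw [twistTerm, twistListTerm, hl, List.ofFn_fin_append, List.ofFn_const]

theorem IsWeaklyFiltered.seriesConverges_twistList (hF : IsWeaklyFiltered 𝒜 l F)
    (hl : ∀ k (x : Fin k → E), l k x = L (List.ofFn x)) (hn : LocallyNilpotent L) (α : E) (k : ℕ)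
    (x : Fin k → E) (s : E) :
    SeriesConverges F (twistTerm (K := K) l α k x) s ↔ s = twistList K L α (List.ofFn x) := by
  obtain ⟨B, hB⟩ := hn.term_eventually α (List.ofFn x)
  rw [twistTerm_eq hl, hF.seriesConverges_iff (B := B), twistList_eq_sum hB]
  intro n h
  rw [twistListTerm, hB n h, smul_zero]

/-- The finite sum is a limit, and limits are unique, so the chosen limit in `twist` is that sum. -/
theorem IsWeaklyFiltered.twist_eq (hF : IsWeaklyFiltered 𝒜 l F)
    (hl : ∀ k (x : Fin k → E), l k x = L (List.ofFn x)) (hn : LocallyNilpotent L) (α : E) (k : ℕ)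
    (x : Fin k → E) : twist l F α k x = twistList K L α (List.ofFn x) := by
  have h : ∃ s, SeriesConverges F (twistTerm (K := K) l α k x) s :=
    ⟨_, (hF.seriesConverges_twistList hl hn α k x _).2 rfl⟩
  rw [twist, dif_pos h]
  exact (hF.seriesConverges_twistList hl hn α k x _).1 h.choose_spec

/-- The Maurer–Cartan series starts at `l_1` and the twisted bracket of the empty list at `L []`;
the hypothesis `h0` removes the difference. -/
theorem IsWeaklyFiltered.isMaurerCartan_iff (hF : IsWeaklyFiltered 𝒜 l F)
    {l' : (k : ℕ) → (Fin k → E) → E} (hl : ∀ k, 1 ≤ k → ∀ x : Fin k → E, l' k x = L (List.ofFn x))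
    (hn : LocallyNilpotent L) (h0 : L [] = 0) (α : E) :
    IsMaurerCartan 𝒜 l' F α ↔ α ∈ 𝒜 0 ∧ twistList K L α [] = 0 := by
  obtain ⟨B, hB⟩ := hn.term_eventually α []
  refine and_congr Iff.rfl ?_
  have hB' : ∀ n, B + 1 ≤ n → L (List.replicate n α ++ []) = 0 := fun n h => hB n (by omega)
  rw [hF.seriesConverges_iff (B := B), twistList_eq_sum hB', Finset.sum_range_succ', eq_comm]
  · simp [twistListTerm, h0, hl, List.ofFn_const, List.replicate_succ]
  · intro n h
    have := hB (n + 1) (by omega)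
    rw [hl _ (by omega), List.ofFn_const]
    rw [List.append_nil] at this
    rw [this, smul_zero]

theorem IsWeaklyFiltered.twist [CharZero K] (hF : IsWeaklyFiltered 𝒜 l F)
    (h : ListLInfinity 𝒜 L) (hl : ∀ k (x : Fin k → E), l k x = L (List.ofFn x))
    (hn : LocallyNilpotent L) {α : E} (hα : IsMaurerCartan 𝒜 l F α) :
    IsWeaklyFiltered 𝒜 (twist l F α) F where
  isLInfinity := by
    obtain ⟨h1, h2⟩ := (hF.isMaurerCartan_iff (fun k _ => hl k) hn h.nil α).1 hα
    exact (h.twistList hn h1 h2).isLInfinity fun k _ x => hF.twist_eq hl hn α k x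
  one := hF.one
  antitone := hF.antitone
  graded := hF.graded
  bracket_mem := by
    obtain ⟨n₀, h1, h2⟩ := hF.bracket_mem
    refine ⟨n₀, h1, fun k hk x => ?_⟩
    rw [hF.twist_eq hl hn]
    obtain ⟨M, hM⟩ := (hn.twistList_eventually (K := K) α (List.ofFn x)).exists
    rw [hM]
    refine Submodule.sum_mem _ fun n _ => ?_
    rw [← twistTerm_eq hl, twistTerm]
    -- A term with `n` copies of `α` is a value of `l_{n+k}`, so it lies in `F (n + k) ≤ F k`.
    exact Submodule.smul_mem _ _ (hF.antitone (Nat.le_add_left k n) (h2 (n + k) (by omega) _))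
  complete := hF.complete

theorem IsWeaklyFiltered.isMaurerCartan_twist_iff [CharZero K] (hF : IsWeaklyFiltered 𝒜 l F)
    (h : ListLInfinity 𝒜 L) (hl : ∀ k (x : Fin k → E), l k x = L (List.ofFn x))
    (hn : LocallyNilpotent L) {α β : E} (hα : IsMaurerCartan 𝒜 l F α) (hβ : β ∈ 𝒜 0) :
    IsMaurerCartan 𝒜 (RelRB.twist l F α) F β ↔ IsMaurerCartan 𝒜 l F (α + β) := by
  obtain ⟨h1, h2⟩ := (hF.isMaurerCartan_iff (fun k _ => hl k) hn h.nil α).1 hα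
  rw [hF.isMaurerCartan_iff (fun k _ => hF.twist_eq hl hn α k) (hn.twistList α) h2,
    hF.isMaurerCartan_iff (fun k _ => hl k) hn h.nil, h.twistList_twistList_nil hn h1 hβ]
  exact and_congr_left fun _ => ⟨fun hβ => add_mem h1 hβ, fun _ => hβ⟩

end Filtration

/-! ### The Nijenhuis–Richardson bracket in terms of lists -/

section ListCirc

variable {W : Type*} [AddCommGroup W]

/-- `P ∘̄ Q` for functions of lists of vectors. -/
def listCirc (P Q : List W → W) (l : List W) : W :=
  split (fun _ => 1) l fun a b => P (Q a :: b)

@[simp] theorem degSum_one {X : Type*} (l : List X) : degSum (fun _ => 1) l = l.length := by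
  simp [degSum]

theorem listCirc_add_left (P P' Q : List W → W) :
    listCirc (P + P') Q = listCirc P Q + listCirc P' Q := by
  funext l
  exact split_add _ _ _ _

theorem listCirc_smul_left (c : ℤ) (P Q : List W → W) :
    listCirc (c • P) Q = c • listCirc P Q := by
  funext l
  exact (zsmul_split _ _ _ _).symm

variable {P Q R : List W → W} (hP : ∀ a b l, P ((a + b) :: l) = P (a :: l) + P (b :: l))

include hP in
theorem listCirc_add_right (Q Q' : List W → W) :
    listCirc P (Q + Q') = listCirc P Q + listCirc P Q' := by
  funext l
  simp only [listCirc, Pi.add_apply, hP, split_add]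

include hP in
theorem listCirc_smul_right (c : ℤ) (Q : List W → W) :
    listCirc P (c • Q) = c • listCirc P Q := by
  funext l
  have h : ∀ (x : W) b, P ((c • x) :: b) = c • P (x :: b) := fun x b =>
    map_zsmul (AddMonoidHom.mk' (fun x => P (x :: b)) fun x y => hP x y b) c x
  simp only [listCirc, Pi.smul_apply, h, zsmul_split]

include hP in
-- The value of `R` is either an argument of `Q` or a further argument of `P`. The second case is
-- the associator of `∘̄`.
theorem listCirc_listCirc_left (l : List W) :
    listCirc (listCirc P Q) R l = listCirc P (listCirc Q R) l +
      split (fun _ => 1) l fun e d => split (fun _ => 1) e fun a c =>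
        sgn c.length • P (Q c :: R a :: d) := by
  have h : ∀ (l' b : List W) (f : List W → List W → W), P (split (fun _ => 1) l' f :: b) =
      split (fun _ => 1) l' fun c d => P (f c d :: b) := fun l' b f =>
    map_split _ (AddMonoidHom.mk' (fun x => P (x :: b)) fun x y => hP x y b) l' f
  simp only [listCirc, split_cons, split_add, h, one_mul, degSum_one]
  rw [split_assoc _ l fun a c d => P (Q (R a :: c) :: d),
    split_assoc _ l fun a c d => sgn c.length • P (Q c :: R a :: d)]

/-- The pre-Lie property: since `P` is alternating, the associator is graded symmetric in `Q` and
`R`. The length conditions fix the parity of the blocks in the nonzero terms. -/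
theorem split_pair_swap (halt : ∀ a b l, P (a :: b :: l) = - P (b :: a :: l)) {q r : ℤ}
    (hQ : ∀ l : List W, (l.length : ℤ) ≠ q + 1 → Q l = 0)
    (hR : ∀ l : List W, (l.length : ℤ) ≠ r + 1 → R l = 0)
    (h0 : ∀ l, P (0 :: l) = 0) (l : List W) :
    (split (fun _ => 1) l fun e d => split (fun _ => 1) e fun a c =>
        sgn c.length • P (Q c :: R a :: d)) =
      sgn (q * r) • split (fun _ => 1) l fun e d => split (fun _ => 1) e fun a c =>
        sgn c.length • P (R c :: Q a :: d) := by
  rw [zsmul_split]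
  refine split_congr _ fun e d _ => ?_
  rw [split_comm, zsmul_split]
  refine split_congr _ fun a c _ => ?_
  simp only [degSum_one, smul_smul]
  by_cases ha : (a.length : ℤ) = q + 1
  · by_cases hc : (c.length : ℤ) = r + 1
    · rw [halt, ha, hc, smul_neg, ← neg_smul, ← sgn_add, ← sgn_add, neg_sgn]
      congr 1
      exact sgn_congr ⟨q + 1, by ring⟩
    · rw [hR c hc, halt]
      simp only [h0, neg_zero, smul_zero]
  · rw [hQ a ha, h0, halt (R c)]
    simp only [h0, neg_zero, smul_zero]

end ListCirc

/-! ### Cochains as functions of lists, and the graded Lie algebra `L` -/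

section ListEval

variable {K W : Type*} [Field K] [AddCommGroup W] [Module K W]

/-- An element of `L` as a function of lists of vectors. -/
def listEval (x : CochainAlg K W) : List W → W
  | [] => 0
  | w :: t => x t.length fun i => (w :: t).get i

@[simp] theorem listEval_nil (x : CochainAlg K W) : listEval x [] = 0 := rfl

theorem listEval_eq (x : CochainAlg K W) {n : ℕ} (l : List W) (h : l.length = n + 1) :
    listEval x l = x n fun i => l.get (i.cast h.symm) := by
  cases l with
  | nil => simp at h
  | cons w t =>
    obtain rfl : t.length = n := by simpa using h
    rfl

theorem listEval_ofFn (x : CochainAlg K W) {n : ℕ} (y : Fin (n + 1) → W) :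
    listEval x (List.ofFn y) = x n y := by
  rw [listEval_eq x (n := n) _ (List.length_ofFn ..)]
  congr 1
  funext i
  rw [List.get_eq_getElem, List.getElem_ofFn]
  rfl

theorem listEval_add (x y : CochainAlg K W) : listEval (x + y) = listEval x + listEval y := by
  funext l
  cases l with
  | nil => simp
  | cons w t => simp [listEval]

theorem listEval_smul (c : K) (x : CochainAlg K W) : listEval (c • x) = c • listEval x := by
  funext l
  cases l with
  | nil => simp
  | cons w t =>
    simp only [listEval, Pi.smul_apply]
    rw [DirectSum.smul_apply]
    rfl

/-- `listEval` as a linear map. -/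
def listEvalHom (K W : Type*) [Field K] [AddCommGroup W] [Module K W] :
    CochainAlg K W →ₗ[K] List W → W where
  toFun := listEval
  map_add' := listEval_add
  map_smul' := listEval_smul

theorem listEval_zsmul (c : ℤ) (x : CochainAlg K W) : listEval (c • x) = c • listEval x :=
  map_zsmul (listEvalHom K W) c x

theorem listEval_sub (x y : CochainAlg K W) : listEval (x - y) = listEval x - listEval y :=
  map_sub (listEvalHom K W) x y

theorem listEval_zero : listEval (0 : CochainAlg K W) = 0 := map_zero (listEvalHom K W)

theorem listEval_injective : Function.Injective (listEval (K := K) (W := W)) := fun x y h => by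
  refine DFinsupp.ext fun n => AlternatingMap.ext fun v => ?_
  rw [← listEval_ofFn, h, listEval_ofFn]

theorem append_cons_eq_ofFn {X : Type*} (p q : List X) (a : X) :
    ∃ (n : ℕ) (y : Fin (n + 1) → X) (i : Fin (n + 1)),
      ∀ b, p ++ b :: q = List.ofFn (Function.update y i b) := by
  have hlen : (p ++ a :: q).length = (p.length + q.length) + 1 := by simp; omega
  refine ⟨p.length + q.length, fun i => (p ++ a :: q).get (i.cast hlen.symm),
    ⟨p.length, by omega⟩, fun b => ?_⟩
  have h : List.ofFn (fun i => (p ++ a :: q).get (i.cast hlen.symm)) = p ++ a :: q :=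
    List.ext_getElem (by rw [List.length_ofFn, hlen]) fun j h1 h2 => by
      rw [List.getElem_ofFn]; rfl
  rw [ofFn_update, h]
  simp [List.drop_append]

theorem listEval_map_add (x : CochainAlg K W) (p q : List W) (a b : W) :
    listEval x (p ++ (a + b) :: q) = listEval x (p ++ a :: q) + listEval x (p ++ b :: q) := by
  obtain ⟨n, y, i, h⟩ := append_cons_eq_ofFn p q a
  simp only [h, listEval_ofFn, AlternatingMap.map_update_add]

theorem listEval_map_smul (x : CochainAlg K W) (p q : List W) (c : K) (a : W) :
    listEval x (p ++ (c • a) :: q) = c • listEval x (p ++ a :: q) := by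
  obtain ⟨n, y, i, h⟩ := append_cons_eq_ofFn p q a
  simp only [h, listEval_ofFn, AlternatingMap.map_update_smul]

theorem listEval_map_zero (x : CochainAlg K W) (p q : List W) :
    listEval x (p ++ 0 :: q) = 0 := by
  simpa using listEval_map_smul x p q 0 0

theorem listEval_cons_add (x : CochainAlg K W) (a b : W) (q : List W) :
    listEval x ((a + b) :: q) = listEval x (a :: q) + listEval x (b :: q) :=
  listEval_map_add x [] q a b

theorem listEval_cons_zero (x : CochainAlg K W) (q : List W) :
    listEval x (0 :: q) = 0 := listEval_map_zero x [] q

theorem listEval_swap (x : CochainAlg K W) (a b : W) (q : List W) :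
    listEval x (a :: b :: q) = - listEval x (b :: a :: q) := by
  have e : ∀ a b, a :: b :: q =
      List.ofFn (Fin.cons a (Fin.cons b q.get) : Fin (q.length + 1 + 1) → W) := fun a b => by
    simp [List.ofFn_succ]
  rw [e a b, e b a, listEval_ofFn, listEval_ofFn, ← AlternatingMap.map_swap _ _ Fin.zero_ne_one]
  congr 1
  funext i
  refine Fin.cases (by simp) (fun i => Fin.cases (by simp) (fun i => ?_) i) i
  rw [Function.comp, Equiv.swap_apply_of_ne_of_ne (by simp [Fin.ext_iff]) (by simp [Fin.ext_iff])]
  simp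

/-- The elements of `L` of degree `m`. -/
def degPart (K W : Type*) [Field K] [AddCommGroup W] [Module K W] (m : ℤ) :
    Submodule K (CochainAlg K W) where
  carrier := {x | ∀ n : ℕ, (n : ℤ) ≠ m → x n = 0}
  zero_mem' := fun _ _ => rfl
  add_mem' {x y} hx hy n hn := by simp [DirectSum.add_apply, hx n hn, hy n hn]
  smul_mem' c x hx n hn := by simp [DirectSum.smul_apply, hx n hn]

theorem listEval_eq_zero {m : ℤ} {x : CochainAlg K W} (hx : x ∈ degPart K W m) {l : List W}
    (hl : (l.length : ℤ) ≠ m + 1) : listEval x l = 0 := by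
  cases l with
  | nil => rfl
  | cons w t =>
    rw [listEval, hx _ fun h => hl (by rw [List.length_cons]; push_cast; rw [h])]
    rfl

theorem lof_mem_degPart (n : ℕ) (f : Cochain K W n) :
    DirectSum.lof K ℕ (fun n => Cochain K W n) n f ∈ degPart K W n := fun m hm => by
  rw [DirectSum.lof_eq_of, DirectSum.of_eq_of_ne]
  exact fun h => hm (by rw [h])

theorem exists_lof_of_mem_degPart {m : ℤ} {x : CochainAlg K W} (hx : x ∈ degPart K W m) :
    x = 0 ∨ ∃ (n : ℕ) (f : Cochain K W n), (n : ℤ) = m ∧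
      x = DirectSum.lof K ℕ (fun n => Cochain K W n) n f := by
  classical
  by_cases h : ∃ n : ℕ, (n : ℤ) = m
  · obtain ⟨n, rfl⟩ := h
    refine Or.inr ⟨n, x n, rfl, DFinsupp.ext fun k => ?_⟩
    by_cases hk : n = k
    · subst hk
      exact (DirectSum.lof_apply ..).symm
    · exact (hx k (fun h => hk (by exact_mod_cast h.symm))).trans
        (lof_mem_degPart n (x n) k (fun h => hk (by exact_mod_cast h.symm))).symm
  · exact Or.inl (DFinsupp.ext fun k => hx k fun hk => h ⟨k, hk⟩)

variable [CharZero K]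

/-- `listCirc` does not prescribe block lengths, but a homogeneous cochain vanishes on lists of the
wrong length, so only `(q+1, p)`-splittings survive. -/
theorem listEval_circ {p q : ℕ} (P : Cochain K W p) (Q : Cochain K W q) :
    listEval (DirectSum.lof K ℕ (fun n => Cochain K W n) (p + q) (circ P Q)) =
      listCirc (listEval (DirectSum.lof K ℕ (fun n => Cochain K W n) p P))
        (listEval (DirectSum.lof K ℕ (fun n => Cochain K W n) q Q)) := by
  have hP := lof_mem_degPart p P
  have hQ := lof_mem_degPart q Q
  have key : ∀ a b : List W, a.length ≠ q + 1 →
      listEval (DirectSum.lof K ℕ (fun n => Cochain K W n) p P)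
        (listEval (DirectSum.lof K ℕ (fun n => Cochain K W n) q Q) a :: b) = 0 := fun a b h => by
    rw [listEval_eq_zero hQ (by exact_mod_cast h), listEval_cons_zero]
  funext l
  by_cases hl : l.length = p + q + 1
  · obtain ⟨x, rfl⟩ : ∃ x : Fin (p + q + 1) → W, l = List.ofFn x :=
      ⟨fun i => l.get (i.cast hl.symm), List.ext_getElem (by rw [List.length_ofFn, hl])
        fun j h1 h2 => by rw [List.getElem_ofFn]; rfl⟩
    rw [listEval_ofFn, DirectSum.lof_apply, circ_apply]
    have h := sum_shuffles_eq_split (fun _ => 1) (i := q + 1) (m := p) (by omega) x fun a b =>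
      listEval (DirectSum.lof K ℕ (fun n => Cochain K W n) p P)
        (listEval (DirectSum.lof K ℕ (fun n => Cochain K W n) q Q) a :: b)
    rw [listCirc, split_congr (g := fun a b => if a.length = q + 1 then
      listEval (DirectSum.lof K ℕ (fun n => Cochain K W n) p P)
        (listEval (DirectSum.lof K ℕ (fun n => Cochain K W n) q Q) a :: b) else 0), ← h]
    · refine Finset.sum_congr rfl fun σ _ => ?_
      rw [koszulSign_one, listEval_ofFn, DirectSum.lof_apply]
      congr 1
      have h2 : ∀ (w : W) (z : Fin p → W), w :: List.ofFn z =
        List.ofFn (Fin.cons (α := fun _ => W) w z) := fun w z => by simp [List.ofFn_succ]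
      rw [h2, listEval_ofFn, DirectSum.lof_apply]
    · intro a b _
      split_ifs with h
      · rfl
      · exact key a b h
  · rw [listEval_eq_zero (lof_mem_degPart _ _) (by push_cast; exact_mod_cast hl), listCirc,
      ← split_zero (fun _ => 1) l]
    refine split_congr _ fun a b hab => ?_
    by_cases h : a.length = q + 1
    · refine (listEval_eq_zero hP ?_).symm
      have := hab.length_eq
      rw [List.length_append] at this
      rw [List.length_cons]
      push_cast
      omega
    · exact (key a b h).symm

theorem listEval_nrBracket {p q : ℤ} {P Q : CochainAlg K W} (hP : P ∈ degPart K W p)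
    (hQ : Q ∈ degPart K W q) :
    listEval (nrBracket K W P Q) = listCirc (listEval P) (listEval Q) -
      sgn (p * q) • listCirc (listEval Q) (listEval P) := by
  have h0 : listEval (0 : CochainAlg K W) = 0 := listEval_zero
  have h1 : ∀ x : CochainAlg K W, listCirc (listEval x) 0 = 0 := fun x => by
    funext l
    simp [listCirc, listEval_cons_zero]
  have h2 : ∀ x : CochainAlg K W, listCirc 0 (listEval x) = 0 := fun x => by
    funext l
    simp [listCirc]
  obtain rfl | ⟨m, f, rfl, rfl⟩ := exists_lof_of_mem_degPart hP
  · simp [h0, h1, h2]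
  obtain rfl | ⟨n, g, rfl, rfl⟩ := exists_lof_of_mem_degPart hQ
  · simp [h0, h1, h2]
  rw [nrBracket_lof, listEval_sub, listEval_smul, listEval_circ, listEval_circ]
  congr 1
  rw [← Int.cast_smul_eq_zsmul K, ← Nat.cast_mul, sgn_natCast]

theorem nrBracket_mem_degPart {p q : ℤ} {P Q : CochainAlg K W} (hP : P ∈ degPart K W p)
    (hQ : Q ∈ degPart K W q) : nrBracket K W P Q ∈ degPart K W (p + q) := by
  obtain rfl | ⟨m, f, rfl, rfl⟩ := exists_lof_of_mem_degPart hP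
  · simp
  obtain rfl | ⟨n, g, rfl, rfl⟩ := exists_lof_of_mem_degPart hQ
  · simp
  rw [nrBracket_lof]
  have h := lof_mem_degPart (n + m) (circ g f)
  rw [show ((n + m : ℕ) : ℤ) = (m : ℤ) + n by push_cast; ring] at h
  refine sub_mem ?_ (Submodule.smul_mem _ _ ?_)
  · simpa using lof_mem_degPart (m + n) (circ f g)
  · exact h

theorem nrBracket_antisymm {p q : ℤ} {P Q : CochainAlg K W} (hP : P ∈ degPart K W p)
    (hQ : Q ∈ degPart K W q) :
    nrBracket K W P Q = - (sgn (p * q) • nrBracket K W Q P) := by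
  refine listEval_injective ?_
  rw [← neg_one_smul ℤ, listEval_zsmul, listEval_zsmul, listEval_nrBracket hP hQ,
    listEval_nrBracket hQ hP, mul_comm q p]
  have := sgn_mul_self (p * q)
  rw [smul_sub, smul_smul _ _ (listCirc (listEval P) (listEval Q)), this]
  module

theorem sgn_eq_one_or (n : ℤ) : sgn n = 1 ∨ sgn n = -1 := by
  rcases Int.even_or_odd n with h | h
  · exact Or.inl (by simp [sgn, Int.negOnePow_even n h])
  · exact Or.inr (by simp [sgn, Int.negOnePow_odd n h])

/-- The graded Jacobi identity. -/
theorem nrBracket_jacobi {p q r : ℤ} {P Q R : CochainAlg K W} (hP : P ∈ degPart K W p)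
    (hQ : Q ∈ degPart K W q) (hR : R ∈ degPart K W r) :
    nrBracket K W (nrBracket K W P Q) R = nrBracket K W P (nrBracket K W Q R) +
      sgn (q * r) • nrBracket K W (nrBracket K W P R) Q := by
  -- The graded pre-Lie identity. Its three instances with `P`, `Q` and `R` in first place combine
  -- to the Jacobi identity.
  have assoc : ∀ {p q r : ℤ} {P Q R : CochainAlg K W} (hP : P ∈ degPart K W p)
      (hQ : Q ∈ degPart K W q) (hR : R ∈ degPart K W r),
      listCirc (listCirc (listEval P) (listEval Q)) (listEval R) -
        listCirc (listEval P) (listCirc (listEval Q) (listEval R)) =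
      sgn (q * r) • (listCirc (listCirc (listEval P) (listEval R)) (listEval Q) -
        listCirc (listEval P) (listCirc (listEval R) (listEval Q))) := by
    intro p q r P Q R hP hQ hR
    funext l
    simp only [Pi.sub_apply, Pi.smul_apply]
    rw [listCirc_listCirc_left (listEval_cons_add P), listCirc_listCirc_left (listEval_cons_add P),
      add_sub_cancel_left, add_sub_cancel_left]
    exact split_pair_swap (listEval_swap P) (fun l => listEval_eq_zero hQ)
      (fun l => listEval_eq_zero hR) (listEval_cons_zero P) l
  have a1 := assoc hP hQ hR
  have a2 := assoc hQ hP hR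
  have a3 := assoc hR hP hQ
  refine listEval_injective ?_
  have e : ∀ x : CochainAlg K W, ∀ y y', listCirc (listEval x) (y - y') =
      listCirc (listEval x) y - listCirc (listEval x) y' := fun x y y' => by
    rw [sub_eq_add_neg, ← neg_one_smul ℤ, listCirc_add_right (listEval_cons_add x),
      listCirc_smul_right (listEval_cons_add x)]
    module
  have e' : ∀ x y y' : List W → W, listCirc (y - y') x = listCirc y x - listCirc y' x :=
    fun x y y' => by
    rw [sub_eq_add_neg, ← neg_one_smul ℤ, listCirc_add_left, listCirc_smul_left]
    module
  have f : ∀ x : CochainAlg K W, ∀ (c : ℤ) y, listCirc (listEval x) (c • y) =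
      c • listCirc (listEval x) y := fun x c y => listCirc_smul_right (listEval_cons_add x) c y
  rw [listEval_add, listEval_zsmul, listEval_nrBracket (nrBracket_mem_degPart hP hQ) hR,
    listEval_nrBracket hP (nrBracket_mem_degPart hQ hR),
    listEval_nrBracket (nrBracket_mem_degPart hP hR) hQ,
    listEval_nrBracket hP hQ, listEval_nrBracket hP hR, listEval_nrBracket hQ hR]
  simp only [e, e', f, listCirc_smul_left, add_mul, mul_add, sgn_add, mul_comm r q]
  linear_combination (norm := skip)
    a1 - sgn (p * q) • a2 + (sgn (p * r) * sgn (q * r)) • a3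
  -- Only three independent signs remain; fixing their values leaves an identity linear over `ℤ`.
  rcases sgn_eq_one_or (p * q) with h1 | h1 <;> rcases sgn_eq_one_or (p * r) with h2 | h2 <;>
  rcases sgn_eq_one_or (q * r) with h3 | h3 <;> simp only [h1, h2, h3] <;> module

end ListEval

/-! ### The projection onto `𝔥` -/

section Projection

variable {K 𝔤 V : Type*} [Field K] [AddCommGroup 𝔤] [Module K 𝔤] [AddCommGroup V] [Module K V]

/-- Alternating maps on `𝔤 ⊕ V` are determined by their values on families of vectors of `𝔤` and
of `V`. -/
theorem alternatingMap_ext_pure {U : Type*} [AddCommGroup U] [Module K U] {n : ℕ}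
    {f f' : (𝔤 × V) [⋀^Fin n]→ₗ[K] U}
    (h : ∀ (S : Finset (Fin n)) (x : Fin n → 𝔤 × V), IsPure S x → f x = f' x) : f = f' := by
  refine AlternatingMap.ext fun x => ?_
  have hx : x = (fun i => ((x i).1, (0 : V))) + fun i => ((0 : 𝔤), (x i).2) := by
    funext i; simp
  rw [hx]
  have h1 := f.toMultilinearMap.map_add_univ (fun i => ((x i).1, (0 : V)))
    (fun i => ((0 : 𝔤), (x i).2))
  have h2 := f'.toMultilinearMap.map_add_univ (fun i => ((x i).1, (0 : V)))
    (fun i => ((0 : 𝔤), (x i).2))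
  refine h1.trans (Eq.trans (Finset.sum_congr rfl fun S _ => h S _ fun i => ⟨fun hi => ?_,
    fun hi => ?_⟩) h2.symm)
  · simp [hi]
  · simp [hi]

theorem projHom_eq_self {n : ℕ} {f : Cochain K (𝔤 × V) n}
    (hf : f ∈ bidegree K 𝔤 V n (-1) (n + 1)) : projHom K 𝔤 V n f = f := by
  refine alternatingMap_ext_pure fun S x hx => ?_
  have hp : projHom K 𝔤 V n f x = ((f fun j => ((0 : 𝔤), (x j).2)).1, 0) := rfl
  obtain ⟨h1, -, h3⟩ := hf S x hx
  rw [hp]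
  have hc := card_compl_add_card S
  by_cases hS : S = ∅
  · subst hS
    have : (fun j => ((0 : 𝔤), (x j).2)) = x := by
      funext j
      exact Prod.ext ((hx j).2 (by simp)).symm rfl
    rw [this]
    exact Prod.ext rfl (h1 ⟨by simp, by simp⟩).symm
  · have h0 : S.card ≠ 0 := by simpa using hS
    rw [h3 (fun h => by omega) (fun h => by omega)]
    obtain ⟨i, hi⟩ := Finset.card_ne_zero.1 h0
    rw [f.map_coord_zero i (by simp [(hx i).1 hi])]
    rfl

theorem proj_eq_self {θ : CochainAlg K (𝔤 × V)} (hθ : θ ∈ HPart K 𝔤 V) :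
    proj K 𝔤 V θ = θ :=
  DFinsupp.ext fun n => (proj_apply θ n).trans (projHom_eq_self (hθ n))

theorem listEval_proj (x : CochainAlg K (𝔤 × V)) (l : List (𝔤 × V)) :
    listEval (proj K 𝔤 V x) l =
      ((listEval x (l.map fun w => ((0 : 𝔤), w.2))).1, 0) := by
  cases l with
  | nil => rfl
  | cons w t =>
    have h := listEval_eq x (n := t.length) ((w :: t).map fun w => ((0 : 𝔤), w.2)) (by simp)
    rw [h, listEval, proj_apply]
    change ((x t.length fun j => ((0 : 𝔤), ((w :: t).get j).2)).1, (0 : V)) = _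
    congr 3
    funext j
    exact (List.getElem_map (fun w : 𝔤 × V => ((0 : 𝔤), w.2))).symm

theorem proj_mem_degPart {m : ℤ} {x : CochainAlg K (𝔤 × V)} (hx : x ∈ degPart K (𝔤 × V) m) :
    proj K 𝔤 V x ∈ degPart K (𝔤 × V) m := fun n hn => by
  rw [proj_apply, hx n hn, map_zero]

variable [CharZero K]

/-- Values of `θ'` lie in `𝔤`, and `θ` vanishes as soon as one argument lies in `𝔤`; hence both
compositions are zero. -/
theorem nrBracket_HPart {p q : ℤ} {θ θ' : CochainAlg K (𝔤 × V)} (hθ : θ ∈ HPart K 𝔤 V)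
    (hθ' : θ' ∈ HPart K 𝔤 V) (hp : θ ∈ degPart K (𝔤 × V) p) (hq : θ' ∈ degPart K (𝔤 × V) q) :
    nrBracket K (𝔤 × V) θ θ' = 0 := by
  have key : ∀ {θ θ' : CochainAlg K (𝔤 × V)}, θ ∈ HPart K 𝔤 V → θ' ∈ HPart K 𝔤 V →
      listCirc (listEval θ) (listEval θ') = 0 := fun {θ θ'} h h' => by
    funext l
    rw [listCirc, Pi.zero_apply, ← split_zero (fun _ => 1) l]
    refine split_congr _ fun a b _ => ?_
    rw [← proj_eq_self h, ← proj_eq_self h', listEval_proj, listEval_proj, List.map_cons]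
    have := listEval_cons_zero θ (b.map fun w => ((0 : 𝔤), w.2))
    rw [← Prod.mk_zero_zero] at this
    rw [this]
    rfl
  refine listEval_injective ?_
  rw [listEval_nrBracket hp hq, key hθ hθ', key hθ' hθ, listEval_zero]
  simp

/-- A map is killed by the projection iff it sends families of `V`-vectors into `V`, a property
stable under composition. So the kernel is a subalgebra. -/
theorem proj_nrBracket_eq_zero {p q : ℤ} {A B : CochainAlg K (𝔤 × V)}
    (hA : A ∈ degPart K (𝔤 × V) p) (hB : B ∈ degPart K (𝔤 × V) q)
    (hA' : proj K 𝔤 V A = 0) (hB' : proj K 𝔤 V B = 0) :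
    proj K 𝔤 V (nrBracket K (𝔤 × V) A B) = 0 := by
  have h0 : ∀ {A : CochainAlg K (𝔤 × V)}, proj K 𝔤 V A = 0 → ∀ l : List (𝔤 × V),
      (∀ w ∈ l, w.1 = 0) → (listEval A l).1 = 0 := fun {A} h l hl => by
    have h1 := listEval_proj A l
    have h2 : (l.map fun w => ((0 : 𝔤), w.2)) = l := by
      conv_rhs => rw [← List.map_id l]
      exact List.map_congr_left fun w hw => Prod.ext (hl w hw).symm rfl
    rw [h, listEval_zero, h2] at h1
    exact (congrArg Prod.fst h1).symm
  have key : ∀ {A B : CochainAlg K (𝔤 × V)}, proj K 𝔤 V A = 0 → proj K 𝔤 V B = 0 →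
      ∀ l : List (𝔤 × V), (∀ w ∈ l, w.1 = 0) → (listCirc (listEval A) (listEval B) l).1 = 0 := by
    intro A B hA hB l hl
    have := map_split (fun _ => 1) (LinearMap.fst K 𝔤 V) l fun a b =>
      listEval A (listEval B a :: b)
    rw [LinearMap.fst_apply] at this
    rw [listCirc, this, ← split_zero (fun _ => 1) l]
    refine split_congr _ fun a b hab => ?_
    have ha : ∀ w ∈ a, w.1 = 0 := fun w hw => hl w (hab.subset (List.mem_append_left _ hw))
    have hb : ∀ w ∈ b, w.1 = 0 := fun w hw => hl w (hab.subset (List.mem_append_right _ hw))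
    exact h0 hA _ (List.forall_mem_cons.2 ⟨h0 hB a ha, hb⟩)
  refine listEval_injective (funext fun l => ?_)
  have hl : ∀ w ∈ l.map fun w => ((0 : 𝔤), w.2), w.1 = 0 := fun w hw => by
    obtain ⟨v, -, rfl⟩ := List.mem_map.1 hw
    rfl
  rw [listEval_proj, listEval_nrBracket hA hB, listEval_zero]
  refine Prod.ext ?_ rfl
  simp [key hA' hB' _ hl, key hB' hA' _ hl]

/-- Expand the bracket of `A - PA` and `B - PB`, which lies in the kernel of `P`, and use `[PA, PB]
= 0`. -/
theorem proj_nrBracket {p q : ℤ} {A B : CochainAlg K (𝔤 × V)}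
    (hA : A ∈ degPart K (𝔤 × V) p) (hB : B ∈ degPart K (𝔤 × V) q) :
    proj K 𝔤 V (nrBracket K (𝔤 × V) A B) =
      proj K 𝔤 V (nrBracket K (𝔤 × V) (proj K 𝔤 V A) B) +
      proj K 𝔤 V (nrBracket K (𝔤 × V) A (proj K 𝔤 V B)) := by
  have hz : ∀ A : CochainAlg K (𝔤 × V), proj K 𝔤 V (A - proj K 𝔤 V A) = 0 := fun A => by
    rw [map_sub, proj_eq_self (proj_mem A), sub_self]
  have h := proj_nrBracket_eq_zero (sub_mem hA (proj_mem_degPart hA))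
    (sub_mem hB (proj_mem_degPart hB)) (hz A) (hz B)
  have h' := nrBracket_HPart (proj_mem A) (proj_mem B) (proj_mem_degPart hA) (proj_mem_degPart hB)
  simp only [map_sub, LinearMap.sub_apply, h', sub_zero] at h
  rw [sub_sub, sub_eq_zero] at h
  exact h

end Projection

/-! ### Higher derived brackets -/

section Single

variable {X M N : Type*} [AddCommGroup M] [AddCommGroup N]

/-- `g y e` if `c = [y]`, and zero if `c` does not have length one. -/
def single (g : X → List X → M) : List X → List X → M
  | [y], e => g y e
  | _, _ => 0

@[simp] theorem single_nil (g : X → List X → M) (e : List X) : single g [] e = 0 := rfl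

@[simp] theorem single_singleton (g : X → List X → M) (y : X) (e : List X) :
    single g [y] e = g y e := rfl

@[simp] theorem single_cons_cons (g : X → List X → M) (y z : X) (c e : List X) :
    single g (y :: z :: c) e = 0 := rfl

theorem split_single_cons (dg : X → ℤ) (x : X) (l : List X) (g : X → List X → M) :
    split dg (x :: l) (single g) = g x l +
      split dg l (fun c e => single (fun y e => sgn (dg x * dg y) • g y (x :: e)) c e) := by
  rw [split_cons, split_left_nil dg l (fun a b => single g (x :: a) b) fun y a b => rfl]
  congr 1
  refine split_congr dg fun c e _ => ?_
  match c with
  | [] => simp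
  | [y] => simp
  | y :: z :: c => simp

/-- The form that matches `bracketHTerm`: one distinguished entry is moved to the front with its
Koszul sign. -/
theorem split_single_ofFn (dg : X → ℤ) {n : ℕ} (x : Fin n → X) (g : X → List X → M) :
    split dg (List.ofFn x) (single g) = ∑ i,
      (((List.finRange n).filter fun j => j ≠ i).map fun j =>
        if j < i then sgn (dg (x i) * dg (x j)) else 1).prod •
      g (x i) (((List.finRange n).filter fun j => j ≠ i).map x) := by
  induction n generalizing g with
  | zero => simp
  | succ n ih =>
    have h0 : (List.finRange (n + 1)).filter (fun j => j ≠ 0) =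
        (List.finRange n).map Fin.succ := by
      rw [List.finRange_succ, List.filter_cons, if_neg (by simp), List.filter_map,
        List.filter_eq_self.2]
      simp [Fin.succ_ne_zero]
    have hs : ∀ i : Fin n, (List.finRange (n + 1)).filter (fun j => j ≠ i.succ) =
        0 :: ((List.finRange n).filter fun j => j ≠ i).map Fin.succ := fun i => by
      rw [List.finRange_succ, List.filter_cons, if_pos (by simp [(Fin.succ_ne_zero i).symm]),
        List.filter_map]
      congr 3
      funext j
      simp
    rw [List.ofFn_succ, split_single_cons, ih, Fin.sum_univ_succ, h0]
    congr 1
    · simp [Function.comp_def, List.ofFn_eq_map]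
    · refine Finset.sum_congr rfl fun i _ => ?_
      rw [hs, List.map_cons, List.prod_cons, if_pos (Fin.succ_pos i), List.map_cons, List.map_map,
        List.map_map, smul_smul, mul_comm, mul_comm (dg (x 0))]
      simp [Function.comp_def, Fin.succ_lt_succ_iff]

end Single

/-- A graded Lie algebra with a projection onto an abelian subalgebra along a subalgebra. -/
structure VoronovData (K L : Type*) [Field K] [AddCommGroup L] [Module K L] where
  /-- The bracket. -/
  br : L →ₗ[K] L →ₗ[K] L
  /-- The homogeneous parts. -/
  deg : ℤ → Submodule K L
  /-- The projection. -/
  P : L →ₗ[K] L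
  /-- The abelian subalgebra. -/
  H : Submodule K L
  br_mem : ∀ {p q A B}, A ∈ deg p → B ∈ deg q → br A B ∈ deg (p + q)
  antisymm : ∀ {p q A B}, A ∈ deg p → B ∈ deg q → br A B = - (sgn (p * q) • br B A)
  jacobi : ∀ {p q r A B C}, A ∈ deg p → B ∈ deg q → C ∈ deg r →
    br (br A B) C = br A (br B C) + sgn (q * r) • br (br A C) B
  abelian : ∀ {p q A B}, A ∈ H → B ∈ H → A ∈ deg p → B ∈ deg q → br A B = 0
  P_mem : ∀ {p A}, A ∈ deg p → P A ∈ deg p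
  P_mem_H : ∀ A, P A ∈ H
  P_br : ∀ {p q A B}, A ∈ deg p → B ∈ deg q → P (br A B) = P (br (P A) B) + P (br A (P B))

namespace VoronovData

variable {K L X : Type*} [Field K] [AddCommGroup L] [Module K L] (D : VoronovData K L)

/-- The nested bracket `[⋯[[x, θ₁], θ₂], ⋯, θ_k]`. -/
def nest : List L → (L →ₗ[K] L)
  | [] => LinearMap.id
  | θ :: θs => nest θs ∘ₗ D.br.flip θ

/-- The sum of `± [⋯[q_i, θ₁], ⋯, θ_n]` (with `θ_i` omitted), over the entries `i` of a list. -/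
def nestSum (dg : X → ℤ) (q θ : X → L) (a : List X) : L :=
  split dg a (single fun y e => D.nest (e.map θ) (q y))

/-- `(-1)^{deg q₁} [q₁, q₂]` for lists of length two, otherwise zero. -/
def nrPair (dg : X → ℤ) (q : X → L) : List X → L
  | [y, z] => sgn (dg y + 1) • D.br (q y) (q z)
  | _ => 0

@[simp] theorem nrPair_nil (dg : X → ℤ) (q : X → L) : D.nrPair dg q [] = 0 := rfl

@[simp] theorem nrPair_singleton (dg : X → ℤ) (q : X → L) (y : X) :
    D.nrPair dg q [y] = 0 := rfl

@[simp] theorem nrPair_pair (dg : X → ℤ) (q : X → L) (y z : X) :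
    D.nrPair dg q [y, z] = sgn (dg y + 1) • D.br (q y) (q z) := rfl

@[simp] theorem nrPair_cons_cons_cons (dg : X → ℤ) (q : X → L) (x y z : X)
    (a : List X) : D.nrPair dg q (x :: y :: z :: a) = 0 := rfl

@[simp] theorem nest_nil (x : L) : D.nest [] x = x := rfl

@[simp] theorem nest_cons (θ : L) (l : List (L))
    (x : L) : D.nest (θ :: l) x =
      D.nest l (D.br x θ) := rfl

theorem nest_append (l l' : List (L)) (x : L) :
    D.nest (l ++ l') x = D.nest l' (D.nest l x) := by
  induction l generalizing x with
  | nil => rfl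
  | cons θ l ih => exact ih _

theorem nest_map_zsmul {ι : Type*} (c : ι → ℤ)
    (θ : ι → L) (l : List ι) (x : L) :
    D.nest (l.map fun i => c i • θ i) x =
      (l.map c).prod • D.nest (l.map θ) x := by
  induction l generalizing x with
  | nil => simp
  | cons i l ih =>
    simp only [List.map_cons, nest_cons, List.prod_cons, map_zsmul, ih, smul_smul]
    rw [mul_comm]

variable {D} {dg : X → ℤ} {q θ : X → L}
  (hq : ∀ x, q x ∈ D.deg (dg x + 1)) (hθ : ∀ x, θ x ∈ D.deg (dg x))
  (hH : ∀ x, θ x ∈ D.H)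

include hθ in
theorem nest_mem {m : ℤ} {A : L} (hA : A ∈ D.deg m)
    (b : List X) : D.nest (b.map θ) A ∈ D.deg (m + degSum dg b) := by
  induction b generalizing m A with
  | nil => simpa using hA
  | cons x b ih =>
    have := ih (D.br_mem hA (hθ x))
    rwa [degSum_cons, ← add_assoc]

include hθ in
/-- The Leibniz rule. -/
theorem nest_br {p r : ℤ} {A B : L} (hA : A ∈ D.deg p)
    (hB : B ∈ D.deg r) (b : List X) :
    D.nest (b.map θ) (D.br A B) = split dg b fun e e' =>
      sgn (r * degSum dg e) • D.br (D.nest (e.map θ) A)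
        (D.nest (e'.map θ) B) := by
  induction b generalizing p r A B with
  | nil => simp
  | cons x b ih =>
    rw [List.map_cons, nest_cons, D.jacobi hA hB (hθ x), map_add, map_zsmul,
      ih hA (D.br_mem hB (hθ x)), ih (D.br_mem hA (hθ x)) hB,
      split_cons, add_comm]
    congr 1
    · rw [zsmul_split]
      refine split_congr _ fun e e' _ => ?_
      rw [smul_smul, ← sgn_add, degSum_cons, mul_add]
      rfl
    · refine split_congr _ fun e e' _ => ?_
      rw [smul_smul, ← sgn_add, List.map_cons, nest_cons]
      congr 2; ring

/-- In the quotient by `S` every summand is zero. -/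
theorem split_mem {M : Type*} [AddCommGroup M] [Module K M] {l : List X}
    {f : List X → List X → M} {S : Submodule K M}
    (h : ∀ c e, (c ++ e).Perm l → f c e ∈ S) : split dg l f ∈ S := by
  rw [← Submodule.Quotient.mk_eq_zero, ← Submodule.mkQ_apply, map_split, ← split_zero dg l]
  exact split_congr _ fun c e hce => (Submodule.Quotient.mk_eq_zero S).2 (h c e hce)

include hq hθ in
theorem nestSum_mem (a : List X) : D.nestSum dg q θ a ∈ D.deg (degSum dg a + 1) := by
  refine split_mem fun c e hce => ?_
  match c with
  | [] => exact zero_mem _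
  | [y] =>
    have h := nest_mem hθ (hq y) e
    rw [← degSum_perm dg hce]
    simpa [add_right_comm] using h
  | _ :: _ :: _ => exact zero_mem _

include hq in
theorem nrPair_mem (a : List X) :
    D.nrPair dg q a ∈ D.deg (degSum dg a + 1 + 1) := by
  match a with
  | [] => exact zero_mem _
  | [_] => exact zero_mem _
  | [y, z] =>
    have h := D.br_mem (hq y) (hq z)
    have e : degSum dg [y, z] + 1 + 1 = dg y + 1 + (dg z + 1) := by simp; ring
    rw [e]
    exact zsmul_mem h _
  | _ :: _ :: _ :: _ => exact zero_mem _

include hq hθ hH in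
-- As `[θ_x, θ_y] = 0`, the Jacobi identity gives `[[A, θ_x], θ_y] = ± [[A, θ_y], θ_x]`.
theorem gradedSymm_nestSum : GradedSymm dg (D.nestSum dg q θ) := fun p r x y => by
  refine split_swap dg p r x y _ (fun r s b => ?_) (fun r s a => ?_)
  · match r with
    | [] => simp
    | [_] => simp
    | _ :: _ :: _ => simp
  · match a with
    | [] => simp
    | [z] =>
      simp only [single_singleton, List.map_append, List.map_cons, nest_append,
        nest_cons]
      have hA := nest_mem hθ (hq z) r
      rw [D.jacobi hA (hθ x) (hθ y), D.abelian (hH x) (hH y) (hθ x) (hθ y), map_zero,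
        zero_add, map_zsmul]
    | _ :: _ :: _ => simp

include hq in
-- The degree shift and the sign `(-1)^{deg q}` turn graded antisymmetry of the bracket into graded
-- symmetry.
theorem gradedSymm_nrPair : GradedSymm dg (D.nrPair dg q) := fun p r x y => by
  match p, r with
  | [], [] =>
    simp only [List.nil_append, nrPair]
    rw [D.antisymm (hq x) (hq y), smul_neg, ← neg_smul, smul_smul, smul_smul,
      neg_mul_comm, neg_sgn, ← sgn_add, ← sgn_add]
    congr 1
    exact sgn_congr ⟨dg x + 1, by ring⟩
  | [], _ :: _ => simp
  | [_], [] => simp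
  | [_], _ :: _ => simp
  | [_, _], _ => simp
  | _ :: _ :: _ :: _, _ => simp

include hθ hH in
-- In the Leibniz rule every term in which some `θ` meets `H` vanishes, since both lie in the
-- abelian subalgebra.
theorem nest_br_of_mem_H {p m : ℤ} {A H : L}
    (hA : A ∈ D.deg p) (hm : H ∈ D.deg m) (hH' : H ∈ D.H)
    (b : List X) :
    D.nest (b.map θ) (D.br A H) =
      sgn (m * degSum dg b) • D.br (D.nest (b.map θ) A) H := by
  rw [nest_br hθ hA hm, split_right_nil]
  · simp
  · intro x a b
    rw [List.map_cons, nest_cons, D.abelian hH' (hH x) hm (hθ x)]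
    simp

/-- Counting a pair in both orders writes it as a sum over splittings, to which the calculus of
`split` applies. The resulting factor `2` is cancelled in characteristic zero. -/
theorem two_nsmul_nrPair (hq : ∀ x, q x ∈ D.deg (dg x + 1)) (a : List X) :
    (2 : ℤ) • D.nrPair dg q a = split dg a fun c c' => single (fun y _ => single (fun z _ =>
      sgn (dg y + 1) • D.br (q y) (q z)) c' []) c [] := by
  match a with
  | [] => simp
  | [_] => simp [split_cons]
  | [y, z] =>
    have := gradedSymm_nrPair hq [] [] y z
    simp only [List.nil_append, nrPair_pair] at this
    simp only [split_cons, split_nil, single_singleton, single_nil, single_cons_cons, smul_zero,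
      zero_add, add_zero, nrPair_pair, degSum_cons, degSum_nil, mul_zero, sgn_zero, one_smul]
    rw [← this, two_smul, add_comm]
  | x :: y :: z :: a =>
    rw [nrPair_cons_cons_cons, smul_zero, ← split_zero dg]
    refine split_congr _ fun c c' h => ?_
    have hl := h.length_eq
    simp only [List.length_append, List.length_cons] at hl
    match c, c' with
    | [], _ => simp
    | [_], [] => simp
    | [_], [_] => simp at hl
    | [_], _ :: _ :: _ => simp
    | _ :: _ :: _, _ => simp

theorem br_split_left (l : List X)
    (f : List X → List X → L) (z : L) :
    D.br (split dg l f) z = split dg l fun a b => D.br (f a b) z :=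
  map_split dg ((D.br).flip z) l f

theorem br_split_right (l : List X)
    (f : List X → List X → L) (z : L) :
    D.br z (split dg l f) = split dg l fun a b => D.br z (f a b) :=
  map_split dg (D.br z) l f

include hθ in
-- The Leibniz rule distributes the `θ`s over the two factors of `[q_y, q_z]`; regrouping each
-- factor with its own `θ`s gives brackets of nested sums.
theorem two_nsmul_split_nrPair (hq : ∀ x, q x ∈ D.deg (dg x + 1)) (a : List X) :
    (2 : ℤ) • split dg a (fun b c => D.nest (c.map θ) (D.nrPair dg q b)) =
      - split dg a fun b c => sgn (degSum dg b) •
        D.br (D.nestSum dg q θ b) (D.nestSum dg q θ c) := by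
  -- The lists `c = [y]` and `c' = [z]` select the two factors, and `e`, `e'` are the `θ`s applied
  -- to them. `split_interchange` passes from `(c, c', e, e')` to `(c, e, c', e')`.
  let G : List X → List X → List X → List X → L := fun c c' e e' =>
    single (fun y e => single (fun z e' => (sgn (dg y + 1) * sgn ((dg z + 1) * degSum dg e)) •
      D.br (D.nest (e.map θ) (q y))
        (D.nest (e'.map θ) (q z))) c' e') c e
  have h1 : (2 : ℤ) • split dg a (fun b c => D.nest (c.map θ) (D.nrPair dg q b)) =
      split dg a fun a b => split dg a fun c c' => split dg b fun e e' => G c c' e e' := by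
    rw [zsmul_split]
    refine split_congr _ fun a b _ => ?_
    rw [← map_zsmul, two_nsmul_nrPair hq, map_split]
    refine split_congr _ fun c c' _ => ?_
    match c, c' with
    | [], _ => simp [G]
    | [_], [] => simp [G]
    | [y], [z] =>
      simp only [G, single_singleton, map_zsmul]
      rw [nest_br hθ (hq y) (hq z), zsmul_split]
      simp only [smul_smul]
    | [_], _ :: _ :: _ => simp [G]
    | _ :: _ :: _, _ => simp [G]
  rw [h1, split_interchange, ← split_neg]
  refine split_congr _ fun b b' _ => ?_
  have hN : ∀ b, D.nestSum dg q θ b =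
    split dg b (single fun y e => D.nest (e.map θ) (q y)) := fun _ => rfl
  rw [hN b, br_split_left, zsmul_split, ← split_neg]
  refine split_congr _ fun c e hce => ?_
  rw [hN b', br_split_right, zsmul_split, ← split_neg]
  refine split_congr _ fun c' e' _ => ?_
  match c, c' with
  | [], _ => simp [G]
  | [_], [] => simp [G]
  | [y], [z] =>
    simp only [G, single_singleton, smul_smul]
    rw [← neg_smul, neg_sgn, ← sgn_add, ← sgn_add, ← degSum_perm dg hce]
    congr 1
    refine sgn_congr ⟨dg z * degSum dg e, ?_⟩
    simp
    ring
  | [_], _ :: _ :: _ => simp [G]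
  | _ :: _ :: _, _ => simp [G]

include hq hθ hH in
-- The inner bracket, which lies in `𝔥`, is moved behind the other `θ`s; summing over the
-- distinguished entry then builds the second nested sum.
theorem split_nest_P (a : List X) :
    (split dg a fun b c => split dg c (single fun y e => sgn ((degSum dg b + 1) * dg y) •
        D.nest (D.P (D.nestSum dg q θ b) :: e.map θ) (q y))) =
      split dg a fun b c => sgn (degSum dg b) •
        D.br (D.nestSum dg q θ b) (D.P (D.nestSum dg q θ c)) := by
  rw [split_comm dg a fun b c => sgn (degSum dg b) •
        D.br (D.nestSum dg q θ b) (D.P (D.nestSum dg q θ c))]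
  refine split_congr _ fun b c _ => ?_
  have hN : D.nestSum dg q θ c =
    split dg c (single fun y e => D.nest (e.map θ) (q y)) := rfl
  rw [smul_smul, ← sgn_add, hN, br_split_left, zsmul_split]
  refine split_congr _ fun u e hue => ?_
  match u with
  | [] => simp
  | [y] =>
    simp only [single_singleton, nest_cons]
    have hb := nestSum_mem hq hθ b
    rw [nest_br_of_mem_H hθ hH (hq y) (D.P_mem hb) (D.P_mem_H _), smul_smul,
      ← sgn_add, ← degSum_perm dg hue]
    congr 1
    refine sgn_congr ⟨0, ?_⟩
    simp
    ring
  | _ :: _ :: _ => simp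

include hq hθ hH in
/-- The `𝔥`-component of the generalized Jacobi identities. -/
theorem nestSum_jacobi [CharZero K] (a : List X) :
    (split dg a fun b c => D.P (D.nest (c.map θ) (D.nrPair dg q b) +
      split dg c (single fun y e => sgn ((degSum dg b + 1) * dg y) •
        D.nest (D.P (D.nestSum dg q θ b) :: e.map θ) (q y)))) = 0 := by
  rw [← map_split, split_add, split_nest_P hq hθ hH, map_add]
  have h2 : ∀ x : L, (2 : ℤ) • x = 0 → x = 0 := fun x hx => by
    rw [← Int.cast_smul_eq_zsmul K, smul_eq_zero] at hx
    exact hx.resolve_left (by norm_num)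
  apply h2
  rw [smul_add, ← map_zsmul, two_nsmul_split_nrPair hθ hq, map_neg, map_split, map_split]
  have h3 : (split dg a fun b c => D.P (sgn (degSum dg b) •
        D.br (D.nestSum dg q θ b) (D.nestSum dg q θ c))) =
      (split dg a fun b c => D.P (sgn (degSum dg b) •
        D.br (D.P (D.nestSum dg q θ b)) (D.nestSum dg q θ c))) +
      split dg a fun b c => D.P (sgn (degSum dg b) •
        D.br (D.nestSum dg q θ b) (D.P (D.nestSum dg q θ c))) := by
    rw [← split_add]
    refine split_congr _ fun b c _ => ?_
    rw [map_zsmul, map_zsmul, map_zsmul, ← smul_add,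
      D.P_br (nestSum_mem hq hθ b) (nestSum_mem hq hθ c)]
  -- Antisymmetry together with cocommutativity makes the two halves of `P[N, N']` equal, so that
  -- each cancels one copy of the doubled second term.
  have h4 : (split dg a fun b c => D.P (sgn (degSum dg b) •
        D.br (D.P (D.nestSum dg q θ b)) (D.nestSum dg q θ c))) =
      split dg a fun b c => D.P (sgn (degSum dg b) •
        D.br (D.nestSum dg q θ b) (D.P (D.nestSum dg q θ c))) := by
    rw [split_comm]
    refine split_congr _ fun b c _ => ?_
    rw [D.antisymm (D.P_mem (nestSum_mem hq hθ c)) (nestSum_mem hq hθ b),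
      ← map_zsmul, smul_neg, smul_neg, smul_smul, smul_smul, ← neg_smul, ← sgn_add, ← sgn_add,
      neg_sgn]
    congr 2
    exact sgn_congr ⟨degSum dg b * degSum dg c + degSum dg c + 1, by ring⟩
  rw [h3, h4]
  module

include hq in
/-- The `L'`-component of the generalized Jacobi identities. -/
theorem nrPair_jacobi (a : List X) (β : List X → X)
    (hβ : ∀ b, dg (β b) = degSum dg b + 1) (hβ' : ∀ b, q (β b) = D.nrPair dg q b) :
    (split dg a fun b c => D.nrPair dg q (β b :: c)) = 0 := by
  match a with
  | [] => simp
  | [x] => simp [split_cons, hβ, hβ']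
  | [x, y] => simp [split_cons, hβ, hβ']
  -- The only length with content, since an outer and an inner pair together use three entries. It
  -- is the graded Jacobi identity with shifted signs.
  | [x, y, z] =>
    simp only [split_cons, split_nil, nrPair_singleton, nrPair_pair, nrPair_cons_cons_cons, hβ, hβ',
      smul_zero, zero_add, add_zero, map_zsmul, LinearMap.smul_apply, degSum_cons, degSum_nil,
      smul_smul]
    rw [D.jacobi (hq x) (hq y) (hq z), D.antisymm
      (D.br_mem (hq y) (hq z)) (hq x)]
    simp only [smul_add, smul_neg, smul_smul, ← sgn_add]
    have e1 : sgn (dg x * (dg y + dg z) + (dg y + dg z + 1 + 1 + (dg y + 1)) +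
        (dg y + 1 + (dg z + 1)) * (dg x + 1)) =
        sgn (dg z * 0 + (dg x + dg y + 1 + 1 + (dg x + 1))) :=
      sgn_congr ⟨dg x * dg y + dg x * dg z + dg y + dg z + 1, by ring⟩
    have e2 : sgn (dg y * dg z + (dg x + dg z + 1 + 1 + (dg x + 1))) =
        - sgn (dg z * 0 + (dg x + dg y + 1 + 1 + (dg x + 1)) + (dg y + 1) * (dg z + 1)) := by
      rw [neg_sgn]
      exact sgn_congr ⟨- dg y - 1, by ring⟩
    rw [e1, e2]
    module
  | x :: y :: z :: w :: a =>
    rw [← split_zero dg]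
    refine split_congr _ fun b c h => ?_
    have hl := h.length_eq
    simp only [List.length_append, List.length_cons] at hl
    match b, c with
    | _, [] => simp
    | [], [_] => simp [hβ']
    | [_], [_] => simp [hβ']
    | [_, _], [_] => simp at hl
    | _ :: _ :: _ :: _, [_] => simp [hβ']
    | _, _ :: _ :: _ => simp

end VoronovData

/-! ### The brackets `l_k` as derived brackets of the Nijenhuis–Richardson algebra -/

section Brackets

variable {K 𝔤 V : Type*} [Field K] [AddCommGroup 𝔤] [Module K 𝔤] [AddCommGroup V] [Module K V]

/-- The family `𝒜`, seen as a family of subspaces of an additive commutative group. -/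
def asGrading {K E : Type*} [Field K] [AddCommGroup E] [Module K E] (𝒜 : ℤ → Submodule K E) :
    ℤ → Submodule K E := 𝒜

/-- The grading of `s⁻¹L' ⊕ 𝔥`. -/
def totalGrading (K 𝔤 V : Type*) [Field K] [AddCommGroup 𝔤] [Module K 𝔤] [AddCommGroup V]
    [Module K V] :=
  asGrading (E := TotalSpace K 𝔤 V) (grading K 𝔤 V)

/-- Homogeneous elements of `s⁻¹L' ⊕ 𝔥`. -/
abbrev HomogTotal (K 𝔤 V : Type*) [Field K] [AddCommGroup 𝔤] [Module K 𝔤] [AddCommGroup V]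
    [Module K V] :=
  Homog (K := K) (E := TotalSpace K 𝔤 V) (totalGrading K 𝔤 V)

/-- The `L'`-component of a homogeneous element of `s⁻¹L' ⊕ 𝔥`. -/
def qPart (y : HomogTotal K 𝔤 V) : CochainAlg K (𝔤 × V) := y.val.1

/-- The `𝔥`-component of a homogeneous element of `s⁻¹L' ⊕ 𝔥`. -/
def hPart (y : HomogTotal K 𝔤 V) : CochainAlg K (𝔤 × V) := y.val.2

theorem qPart_mem (y : HomogTotal K 𝔤 V) : qPart y ∈ degPart K (𝔤 × V) (y.1 + 1) :=
  y.2.2.1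

theorem hPart_mem (y : HomogTotal K 𝔤 V) : hPart y ∈ degPart K (𝔤 × V) y.1 :=
  y.2.2.2

theorem hPart_mem_HPart (y : HomogTotal K 𝔤 V) : hPart y ∈ HPart K 𝔤 V := y.val.2.2

theorem signTwist_eq_smul {W : Type*} [AddCommGroup W] [Module K W] {m : ℤ} {θ : CochainAlg K W}
    (hθ : θ ∈ degPart K W m) (r : ℕ) : signTwist K W r θ = sgn (r * m) • θ := by
  obtain rfl | ⟨n, f, rfl, rfl⟩ := exists_lof_of_mem_degPart hθ
  · simp
  · rw [signTwist, DirectSum.toModule_lof, LinearMap.smul_apply, ← Int.cast_smul_eq_zsmul K,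
      ← Nat.cast_mul, sgn_natCast]

variable [CharZero K]

/-- The Nijenhuis–Richardson algebra with its projection onto `𝔥`. -/
def nrVoronov (K 𝔤 V : Type*) [Field K] [CharZero K] [AddCommGroup 𝔤] [Module K 𝔤]
    [AddCommGroup V] [Module K V] : VoronovData K (CochainAlg K (𝔤 × V)) where
  br := nrBracket K (𝔤 × V)
  deg := degPart K (𝔤 × V)
  P := proj K 𝔤 V
  H := HPart K 𝔤 V
  br_mem := nrBracket_mem_degPart
  antisymm := nrBracket_antisymm
  jacobi := nrBracket_jacobi
  abelian := nrBracket_HPart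
  P_mem := proj_mem_degPart
  P_mem_H := proj_mem
  P_br := proj_nrBracket

theorem nrVoronov_nest (l : List (CochainAlg K (𝔤 × V))) :
    (nrVoronov K 𝔤 V).nest l = nestedBracket K (𝔤 × V) l := by
  induction l with
  | nil => rfl
  | cons θ l ih => exact congrArg (fun f => f ∘ₗ (nrBracket K (𝔤 × V)).flip θ) ih

/-- The bracket as a function of lists. -/
def listBracket (a : List (TotalSpace K 𝔤 V)) : TotalSpace K 𝔤 V := bracket a.length a.get

theorem listBracket_ofFn (k : ℕ) (x : Fin k → TotalSpace K 𝔤 V) :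
    bracket k x = listBracket (List.ofFn x) := by
  have h : (⟨k, x⟩ : Σ k, Fin k → TotalSpace K 𝔤 V) =
      ⟨(List.ofFn x).length, (List.ofFn x).get⟩ := by
    rw [← List.ofFn_inj']
    simp
  exact congrArg (fun s : Σ k, Fin k → TotalSpace K 𝔤 V => bracket s.1 s.2) h

/-- On homogeneous entries the sign operators are scalars, which multilinearity collects into the
Koszul sign of moving entry `i` to the front. -/
theorem bracketHTerm_eq {n : ℕ} (x : Fin n → HomogTotal K 𝔤 V) (i : Fin n) :
    bracketHTerm (fun j => (x j).val) i = proj K 𝔤 V (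
      (((List.finRange n).filter fun j => j ≠ i).map fun j =>
        if j < i then sgn ((x i).1 * (x j).1) else 1).prod •
      (nrVoronov K 𝔤 V).nest ((((List.finRange n).filter fun j => j ≠ i).map x).map hPart)
        (qPart (x i))) := by
  rw [bracketHTerm]
  change proj K 𝔤 V (DirectSum.toModule K ℕ _ _ (qPart (x i))) = _
  obtain h | ⟨q, f, hq, h⟩ := exists_lof_of_mem_degPart (qPart_mem (x i))
  · rw [h]; simp
  · rw [h, DirectSum.toModule_lof, List.map_map, ← VoronovData.nest_map_zsmul, LinearMap.comp_apply,
      nrVoronov_nest]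
    congr 2
    refine congrArg _ (List.map_congr_left fun j _ => ?_)
    simp only [Function.comp]
    split_ifs with hj
    · change signTwist K (𝔤 × V) (q + 1) (hPart (x j)) = _
      rw [signTwist_eq_smul (hPart_mem (x j))]
      congr 1
      -- The exponents `(q + 1) d_j` and `d_i d_j` differ by `2 d_j`, because `q = d_i + 1`.
      refine sgn_congr ⟨(x j).1, ?_⟩
      push_cast
      rw [hq]
      ring
    · rw [one_smul]; rfl

theorem listBracket_snd (a : List (HomogTotal K 𝔤 V)) :
    ((listBracket (vals a)).2 : CochainAlg K (𝔤 × V)) = 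
      proj K 𝔤 V ((nrVoronov K 𝔤 V).nestSum Sigma.fst qPart hPart a) := by
  obtain ⟨n, x, rfl⟩ : ∃ (n : ℕ) (x : Fin n → HomogTotal K 𝔤 V), a = List.ofFn x :=
    ⟨a.length, a.get, by simp⟩
  rw [vals_ofFn, ← listBracket_ofFn, VoronovData.nestSum, split_single_ofFn, map_sum, bracket]
  rw [AddSubmonoidClass.coe_finsetSum]
  exact Finset.sum_congr rfl fun i _ => bracketHTerm_eq x i

theorem listBracket_fst (a : List (HomogTotal K 𝔤 V)) :
    ((listBracket (vals a)).1 : CochainAlg K (𝔤 × V)) =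
      (nrVoronov K 𝔤 V).nrPair Sigma.fst qPart a := by
  match a with
  | [] => rfl
  | [_] => rfl
  | [y, z] =>
    change nrBracket K (𝔤 × V) (signTwist K (𝔤 × V) 1 (qPart y)) (qPart z) = _
    rw [signTwist_eq_smul (qPart_mem y), VoronovData.nrPair_pair, map_zsmul,
      LinearMap.smul_apply, Nat.cast_one, one_mul]
    rfl
  | _ :: _ :: _ :: _ => rfl

theorem listBracket_mem (a : List (HomogTotal K 𝔤 V)) :
    listBracket (vals a) ∈ totalGrading K 𝔤 V (degSum Sigma.fst a + 1) := by
  refine ⟨?_, ?_⟩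
  · rw [listBracket_fst]
    exact VoronovData.nrPair_mem (D := nrVoronov K 𝔤 V) qPart_mem a
  · rw [listBracket_snd]
    exact proj_mem_degPart (VoronovData.nestSum_mem (D := nrVoronov K 𝔤 V) qPart_mem hPart_mem a)

end Brackets

section TotalLInfinity

variable {K 𝔤 V : Type*} [Field K] [AddCommGroup 𝔤] [Module K 𝔤] [AddCommGroup V] [Module K V]

/-! ### The grading -/

theorem sum_components (Q : CochainAlg K (𝔤 × V)) : ∃ s : Finset ℕ,
    Q = ∑ n ∈ s, DirectSum.lof K ℕ (fun n => Cochain K (𝔤 × V) n) n (Q n) := by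
  classical
  exact ⟨DFinsupp.support Q, (DirectSum.sum_support_of Q).symm⟩

theorem inl_lof_mem_totalGrading {n : ℕ} {f : Cochain K (𝔤 × V) n}
    (hf : f ∈ bidegree K 𝔤 V n n 0) :
    ((⟨_, lof_mem_LPrime hf⟩, 0) : TotalSpace K 𝔤 V) ∈ totalGrading K 𝔤 V ((n : ℤ) - 1) := by
  refine ⟨fun j hj => ?_, fun _ _ => rfl⟩
  exact lof_mem_degPart n f j fun h => hj (by rw [h]; ring)

theorem inr_lof_mem_totalGrading {n : ℕ} {f : Cochain K (𝔤 × V) n}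
    (hf : f ∈ bidegree K 𝔤 V n (-1) (n + 1)) :
    ((0, ⟨_, lof_mem_HPart hf⟩) : TotalSpace K 𝔤 V) ∈ totalGrading K 𝔤 V (n : ℤ) :=
  ⟨fun _ _ => rfl, fun j hj => lof_mem_degPart n f j hj⟩

/-- Every element is a finite sum of its homogeneous components. Used with `S = ⊤` for the grading
and with `S = F_n` for the filtration. -/
theorem le_iSup_inf_totalGrading {S : Submodule K (TotalSpace K 𝔤 V)}
    (h1 : ∀ x ∈ S, ∀ n, ((⟨_, lof_mem_LPrime (x.1.2 n)⟩, 0) : TotalSpace K 𝔤 V) ∈ S)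
    (h2 : ∀ x ∈ S, ∀ n, ((0, ⟨_, lof_mem_HPart (x.2.2 n)⟩) : TotalSpace K 𝔤 V) ∈ S) :
    S ≤ ⨆ m, S ⊓ totalGrading K 𝔤 V m := by
  intro x hx
  obtain ⟨s, hs⟩ := sum_components (x.1 : CochainAlg K (𝔤 × V))
  obtain ⟨t, ht⟩ := sum_components (x.2 : CochainAlg K (𝔤 × V))
  have hx' : x = (∑ n ∈ s, ((⟨_, lof_mem_LPrime (x.1.2 n)⟩, 0) : TotalSpace K 𝔤 V)) +
      ∑ n ∈ t, ((0, ⟨_, lof_mem_HPart (x.2.2 n)⟩) : TotalSpace K 𝔤 V) := by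
    refine Prod.ext (Subtype.ext ?_) (Subtype.ext ?_)
    · rw [Prod.fst_add, Prod.fst_sum, Prod.fst_sum]
      simpa using hs
    · rw [Prod.snd_add, Prod.snd_sum, Prod.snd_sum]
      simpa using ht
  rw [hx']
  exact add_mem
    (sum_mem fun n _ => Submodule.mem_iSup_of_mem _ ⟨h1 x hx n, inl_lof_mem_totalGrading (x.1.2 n)⟩)
    (sum_mem fun n _ => Submodule.mem_iSup_of_mem _ ⟨h2 x hx n, inr_lof_mem_totalGrading (x.2.2 n)⟩)

theorem isInternal_totalGrading : DirectSum.IsInternal (totalGrading K 𝔤 V) := by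
  refine (DirectSum.isInternal_submodule_iff_iSupIndep_and_iSup_eq_top (R := K)
    (M := TotalSpace K 𝔤 V) _).2 ⟨fun m => ?_, ?_⟩
  · let S : Submodule K (TotalSpace K 𝔤 V) :=
      { carrier := {x | (∀ n : ℕ, (n : ℤ) = m + 1 → (x.1 : CochainAlg K (𝔤 × V)) n = 0) ∧
          (∀ n : ℕ, (n : ℤ) = m → (x.2 : CochainAlg K (𝔤 × V)) n = 0)}
        zero_mem' := ⟨fun n _ => rfl, fun n _ => rfl⟩
        add_mem' := fun {x y} hx hy => ⟨fun n hn => by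
            simp [DirectSum.add_apply, hx.1 n hn, hy.1 n hn], fun n hn => by
            simp [DirectSum.add_apply, hx.2 n hn, hy.2 n hn]⟩
        smul_mem' := fun c x hx => ⟨fun n hn => by
            simp [DirectSum.smul_apply, hx.1 n hn], fun n hn => by
            simp [DirectSum.smul_apply, hx.2 n hn]⟩ }
    have hS : (⨆ j, ⨆ (_ : j ≠ m), totalGrading K 𝔤 V j) ≤ S :=
      iSup_le fun j => iSup_le fun hj x hx =>
        ⟨fun n hn => hx.1 n fun h => hj (by linarith), fun n hn => hx.2 n fun h => hj (by linarith)⟩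
    refine Disjoint.mono_right hS ?_
    rw [Submodule.disjoint_def]
    intro x hx hx'
    refine Prod.ext (Subtype.ext (DFinsupp.ext fun n => ?_)) (Subtype.ext (DFinsupp.ext fun n => ?_))
    · by_cases h : (n : ℤ) = m + 1
      exacts [hx'.1 n h, hx.1 n h]
    · by_cases h : (n : ℤ) = m
      exacts [hx'.2 n h, hx.2 n h]
  · have := le_iSup_inf_totalGrading (K := K) (𝔤 := 𝔤) (V := V) (S := ⊤)
      (fun _ _ _ => trivial) fun _ _ _ => trivial
    simpa using this

variable [CharZero K]

/-! ### Multilinearity -/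

theorem exists_linearMap_bracketHTerm {k : ℕ} (x : Fin k → TotalSpace K 𝔤 V) (m i : Fin k) :
    ∃ φ : TotalSpace K 𝔤 V →ₗ[K] CochainAlg K (𝔤 × V),
      ∀ b, bracketHTerm (Function.update x m b) i = φ b := by
  by_cases hmi : m = i
  · subst hmi
    refine ⟨proj K 𝔤 V ∘ₗ (DirectSum.toModule K ℕ (CochainAlg K (𝔤 × V))
      (fun q => nestedBracket K (𝔤 × V)
        (((List.finRange k).filter fun j => j ≠ m).map fun j =>
          if j < m then signTwist K (𝔤 × V) (q + 1) (x j).2 else (x j).2) ∘ₗ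
      DirectSum.lof K ℕ (fun n => Cochain K (𝔤 × V) n) q)) ∘ₗ (LPrime K 𝔤 V).subtype ∘ₗ
        LinearMap.fst K _ _, fun b => ?_⟩
    rw [bracketHTerm, Function.update_self]
    simp only [LinearMap.comp_apply]
    congr 3
    funext q
    congr 2
    refine List.map_congr_left fun j hj => ?_
    rw [Function.update_of_ne (by simpa using hj)]
  · obtain ⟨l₁, l₂, hl⟩ := List.append_of_mem
      (show m ∈ (List.finRange k).filter fun j => j ≠ i by simp [hmi])
    have hnd : (l₁ ++ m :: l₂).Nodup := hl ▸ (List.nodup_finRange k).filter _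
    rw [List.nodup_middle, List.nodup_cons, List.mem_append, not_or] at hnd
    obtain ⟨⟨h₁, h₂⟩, -⟩ := hnd
    let f (x : Fin k → TotalSpace K 𝔤 V) (q : ℕ) (j : Fin k) : CochainAlg K (𝔤 × V) :=
      if j < i then signTwist K (𝔤 × V) (q + 1) (x j).2 else (x j).2
    let S (q : ℕ) : TotalSpace K 𝔤 V →ₗ[K] CochainAlg K (𝔤 × V) :=
      (if m < i then signTwist K (𝔤 × V) (q + 1) else LinearMap.id) ∘ₗ (HPart K 𝔤 V).subtype ∘ₗ
        LinearMap.snd K _ _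
    -- The signs on the `θ`s depend on the degree `q` of the distinguished entry, so linearity in
    -- slot `m` is shown for each `q` and the maps are then assembled over the direct sum.
    let Φ (q : ℕ) : TotalSpace K 𝔤 V →ₗ[K]
        (Cochain K (𝔤 × V) q →ₗ[K] CochainAlg K (𝔤 × V)) :=
      { toFun := fun b => nestedBracket K (𝔤 × V) (l₂.map (f x q)) ∘ₗ
          (nrBracket K (𝔤 × V)).flip (S q b) ∘ₗ nestedBracket K (𝔤 × V) (l₁.map (f x q)) ∘ₗ
          DirectSum.lof K ℕ (fun n => Cochain K (𝔤 × V) n) q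
        map_add' := fun a b => by
          refine LinearMap.ext fun y => ?_
          simp only [LinearMap.comp_apply, LinearMap.add_apply, map_add]
        map_smul' := fun c b => by
          refine LinearMap.ext fun y => ?_
          simp only [LinearMap.comp_apply, LinearMap.smul_apply, map_smul, RingHom.id_apply] }
    have hΦ : ∀ q b, nestedBracket K (𝔤 × V) ((l₁ ++ m :: l₂).map (f (Function.update x m b) q)) ∘ₗ
        DirectSum.lof K ℕ (fun n => Cochain K (𝔤 × V) n) q = Φ q b := fun q b => by
      have e : ∀ l : List (Fin k), m ∉ l →
          l.map (f (Function.update x m b) q) = l.map (f x q) := fun l hml =>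
        List.map_congr_left fun j hj => by
          have hjm : j ≠ m := fun h => hml (h ▸ hj)
          simp only [f, Function.update_of_ne hjm]
      have e' : f (Function.update x m b) q m = S q b := by
        simp only [f, S, Function.update_self]
        split_ifs <;> rfl
      refine LinearMap.ext fun y => ?_
      rw [List.map_append, List.map_cons, e _ h₁, e _ h₂, e', ← nrVoronov_nest,
        LinearMap.comp_apply, VoronovData.nest_append, VoronovData.nest_cons, nrVoronov_nest,
        nrVoronov_nest]
      rfl
    refine ⟨proj K 𝔤 V ∘ₗ DirectSum.toModule K ℕ (TotalSpace K 𝔤 V →ₗ[K] CochainAlg K (𝔤 × V))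
      (fun q => (Φ q).flip) (x i).1, fun b => ?_⟩
    rw [bracketHTerm, Function.update_of_ne (Ne.symm hmi), hl, LinearMap.comp_apply]
    refine congrArg _ ?_
    refine (LinearMap.congr_fun (congrArg (DirectSum.toModule K ℕ (CochainAlg K (𝔤 × V)))
      (funext fun q => hΦ q b)) _).trans ?_
    generalize ((x i).1 : CochainAlg K (𝔤 × V)) = Q
    have h : DirectSum.toModule K ℕ (CochainAlg K (𝔤 × V)) (fun q => Φ q b) =
        LinearMap.applyₗ b ∘ₗ DirectSum.toModule K ℕ
          (TotalSpace K 𝔤 V →ₗ[K] CochainAlg K (𝔤 × V)) (fun q => (Φ q).flip) := by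
      refine DirectSum.linearMap_ext K fun q => LinearMap.ext fun y => ?_
      simp only [LinearMap.comp_apply, DirectSum.toModule_lof]
      rfl
    exact LinearMap.congr_fun h Q

theorem exists_linearMap_bracketL {k : ℕ} (x : Fin k → TotalSpace K 𝔤 V) (m : Fin k) :
    ∃ φ : TotalSpace K 𝔤 V →ₗ[K] LPrime K 𝔤 V,
      ∀ b, bracketL k (Function.update x m b) = φ b := by
  match k, x, m with
  | 0, _, _ => exact ⟨0, fun _ => rfl⟩
  | 1, _, _ => exact ⟨0, fun _ => rfl⟩
  | 2, x, 0 =>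
    refine ⟨LinearMap.codRestrict _ ((nrBracket K (𝔤 × V)).flip (x 1).1 ∘ₗ signTwist K (𝔤 × V) 1 ∘ₗ
      (LPrime K 𝔤 V).subtype ∘ₗ LinearMap.fst K _ _) fun b =>
      nrBracket_mem_LPrime (signTwist_mem_LPrime 1 b.1.2) (x 1).1.2, fun b => Subtype.ext ?_⟩
    simp [bracketL]
    rfl
  | 2, x, 1 =>
    refine ⟨LinearMap.codRestrict _ (nrBracket K (𝔤 × V) (signTwist K (𝔤 × V) 1 (x 0).1) ∘ₗ
      (LPrime K 𝔤 V).subtype ∘ₗ LinearMap.fst K _ _) fun b =>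
      nrBracket_mem_LPrime (signTwist_mem_LPrime 1 (x 0).1.2) b.1.2, fun b => Subtype.ext ?_⟩
    simp [bracketL]
  | _ + 3, _, _ => exact ⟨0, fun _ => rfl⟩

theorem exists_linearMap_bracket {k : ℕ} (x : Fin k → TotalSpace K 𝔤 V) (m : Fin k) :
    ∃ φ : TotalSpace K 𝔤 V →ₗ[K] TotalSpace K 𝔤 V,
      ∀ b, bracket k (Function.update x m b) = φ b := by
  choose φ hφ using fun i => exists_linearMap_bracketHTerm x m i
  obtain ⟨ψ, hψ⟩ := exists_linearMap_bracketL x m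
  let φ' (i : Fin k) : TotalSpace K 𝔤 V →ₗ[K] HPart K 𝔤 V :=
    LinearMap.codRestrict _ (φ i) fun b => hφ i b ▸ proj_mem _
  refine ⟨ψ.prod (∑ i, φ' i), fun b => Prod.ext (hψ b) ?_⟩
  have h : ∀ i, (⟨bracketHTerm (Function.update x m b) i, proj_mem _⟩ : HPart K 𝔤 V) = φ' i b :=
    fun i => Subtype.ext (hφ i b)
  exact (Finset.sum_congr rfl fun i _ => h i).trans (LinearMap.sum_apply Finset.univ φ' b).symm

theorem exists_linearMap_listBracket (p q : List (TotalSpace K 𝔤 V)) :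
    ∃ φ : TotalSpace K 𝔤 V →ₗ[K] TotalSpace K 𝔤 V, ∀ b, listBracket (p ++ b :: q) = φ b := by
  obtain ⟨n, y, i, h⟩ := append_cons_eq_ofFn p q 0
  obtain ⟨φ, hφ⟩ := exists_linearMap_bracket y i
  exact ⟨φ, fun b => by rw [h, ← listBracket_ofFn, hφ]⟩

/-! ### The Jacobi identities -/

/-- The bracket of homogeneous elements. -/
def homogBracket (a : List (HomogTotal K 𝔤 V)) : HomogTotal K 𝔤 V :=
  ⟨degSum Sigma.fst a + 1, ⟨listBracket (vals a), listBracket_mem a⟩⟩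

theorem qPart_homogBracket (a : List (HomogTotal K 𝔤 V)) :
    qPart (homogBracket a) = (nrVoronov K 𝔤 V).nrPair Sigma.fst qPart a := listBracket_fst a

theorem hPart_homogBracket (a : List (HomogTotal K 𝔤 V)) :
    hPart (homogBracket a) =
      (nrVoronov K 𝔤 V).P ((nrVoronov K 𝔤 V).nestSum Sigma.fst qPart hPart a) := listBracket_snd a

theorem listBracket_gradedSymm :
    GradedSymm (X := HomogTotal K 𝔤 V) Sigma.fst fun a => listBracket (vals a) := fun p q x y => by
  have h1 := VoronovData.gradedSymm_nrPair (D := nrVoronov K 𝔤 V) (dg := Sigma.fst)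
    (qPart_mem (𝔤 := 𝔤)) p q x y
  have h2 := VoronovData.gradedSymm_nestSum (D := nrVoronov K 𝔤 V) (dg := Sigma.fst)
    (qPart_mem (𝔤 := 𝔤)) hPart_mem hPart_mem_HPart p q x y
  refine Prod.ext (Subtype.ext ?_) (Subtype.ext ?_)
  · rw [listBracket_fst, h1, ← listBracket_fst]
    rfl
  · rw [listBracket_snd, h2, map_zsmul, ← listBracket_snd]
    rfl

theorem listBracket_jacobi (a : List (HomogTotal K 𝔤 V)) :
    split Sigma.fst a (fun b c => listBracket (listBracket (vals b) :: vals c)) = 0 := by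
  refine Prod.ext (Subtype.ext ?_) (Subtype.ext ?_)
  · refine (map_split Sigma.fst ((LPrime K 𝔤 V).subtype ∘ₗ LinearMap.fst K _ _) a _).trans ?_
    refine Eq.trans (split_congr _ fun b c _ => ?_)
      (VoronovData.nrPair_jacobi (D := nrVoronov K 𝔤 V) (dg := Sigma.fst) (qPart_mem (𝔤 := 𝔤)) a
        homogBracket (fun _ => rfl) qPart_homogBracket)
    exact listBracket_fst (homogBracket b :: c)
  · refine (map_split Sigma.fst ((HPart K 𝔤 V).subtype ∘ₗ LinearMap.snd K _ _) a _).trans ?_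
    refine Eq.trans (split_congr _ fun b c _ => ?_)
      (VoronovData.nestSum_jacobi (D := nrVoronov K 𝔤 V) (dg := Sigma.fst) (qPart_mem (𝔤 := 𝔤))
        hPart_mem hPart_mem_HPart a)
    refine (listBracket_snd (homogBracket b :: c)).trans ?_
    -- The inner bracket is either the distinguished entry of the outer one, through its `L'`-part,
    -- or one of the `θ`s, through its `𝔥`-part. These are the two summands of `nestSum_jacobi`.
    rw [VoronovData.nestSum, split_single_cons, qPart_homogBracket]
    simp only [List.map_cons, hPart_homogBracket]
    rfl

theorem listLInfinity_listBracket :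
    ListLInfinity (totalGrading K 𝔤 V) (listBracket (K := K) (𝔤 := 𝔤) (V := V)) where
  graded := isInternal_totalGrading
  nil := rfl
  map_add p q x y := by
    obtain ⟨φ, h⟩ := exists_linearMap_listBracket p q
    simp only [h, map_add]
  map_smul p q c x := by
    obtain ⟨φ, h⟩ := exists_linearMap_listBracket p q
    simp only [h, map_smul]
  degree_one := listBracket_mem
  symm := listBracket_gradedSymm
  jacobi := listBracket_jacobi

end TotalLInfinity

/-! ### Weights -/

theorem split_map {X Y M : Type*} [AddCommGroup M] (c : ℤ) (s : X → Y) (l : List X)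
    (f : List Y → List Y → M) :
    split (fun _ => c) (l.map s) f = split (fun _ => c) l fun a b => f (a.map s) (b.map s) := by
  induction l generalizing f with
  | nil => rfl
  | cons x l ih => simp [split_cons, ih, degSum]

section Weight

variable (K 𝔤 V : Type*) [Field K] [AddCommGroup 𝔤] [Module K 𝔤] [AddCommGroup V] [Module K V]

/-- The map `(x, v) ↦ (2 x, v)`. -/
def dilation : (𝔤 × V) →ₗ[K] 𝔤 × V := ((2 : K) • LinearMap.id).prodMap LinearMap.id

/-- The maps of weight `j`: the sum of the spaces `C^{j|l}`. -/
def weightPart (j : ℤ) : Submodule K (CochainAlg K (𝔤 × V)) where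
  carrier := {A | ∀ l : List (𝔤 × V), listEval A (l.map (dilation K 𝔤 V)) =
    (2 : K) ^ j • dilation K 𝔤 V (listEval A l)}
  zero_mem' l := by simp [listEval_zero]
  add_mem' {A B} hA hB l := by simp [listEval_add, hA l, hB l]
  smul_mem' c A hA l := by simp [listEval_smul, hA l, smul_comm c]

variable {K 𝔤 V}

theorem listEval_component (A : CochainAlg K (𝔤 × V)) (n : ℕ) {l : List (𝔤 × V)}
    (hl : l.length = n + 1) :
    listEval (DirectSum.lof K ℕ (fun n => Cochain K (𝔤 × V) n) n (A n)) l = listEval A l := by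
  rw [listEval_eq _ l hl, listEval_eq _ l hl, DirectSum.lof_apply]

theorem component_mem_weightPart {j : ℤ} {A : CochainAlg K (𝔤 × V)} (hA : A ∈ weightPart K 𝔤 V j)
    (n : ℕ) :
    DirectSum.lof K ℕ (fun n => Cochain K (𝔤 × V) n) n (A n) ∈ weightPart K 𝔤 V j := fun l => by
  by_cases hl : l.length = n + 1
  · rw [listEval_component _ _ hl, listEval_component _ _ (by simpa using hl), hA]
  · rw [listEval_eq_zero (lof_mem_degPart n _) (by rw [List.length_map]; exact_mod_cast hl),
      listEval_eq_zero (lof_mem_degPart n _) (by exact_mod_cast hl), map_zero, smul_zero]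

/-- On a pure family, dilating the arguments multiplies the value by `2` to the number of
`𝔤`-arguments. That number is `n + 1` when the value lies in `𝔤`, where dilation supplies one factor
`2`, and `n` when it lies in `V`. -/
theorem weightPart_of_bidegree {n : ℕ} {f : Cochain K (𝔤 × V) n}
    (hf : f ∈ bidegree K 𝔤 V n n 0) :
    DirectSum.lof K ℕ (fun n => Cochain K (𝔤 × V) n) n f ∈ weightPart K 𝔤 V n := by
  rw [mem_bidegree_zero_iff] at hf
  have key : f.compLinearMap (dilation K 𝔤 V) =
      ((2 : K) ^ n • dilation K 𝔤 V).compAlternatingMap f := by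
    refine alternatingMap_ext_pure fun S x hx => ?_
    obtain ⟨h0, h1, h2⟩ := hf S x hx
    have hd : (fun i => dilation K 𝔤 V (x i)) = fun i => (if i ∈ S then (2 : K) else 1) • x i := by
      funext i
      by_cases hi : i ∈ S
      · simp [dilation, hi, Prod.ext_iff, (hx i).1 hi]
      · simp [dilation, hi, Prod.ext_iff, (hx i).2 hi]
    have hL : f.compLinearMap (dilation K 𝔤 V) x = (2 : K) ^ S.card • f x := by
      change f (fun i => dilation K 𝔤 V (x i)) = _
      rw [hd]
      refine (f.toMultilinearMap.map_smul_univ _ _).trans ?_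
      rw [Finset.prod_ite_mem, Finset.univ_inter, Finset.prod_const]
      rfl
    rw [hL]
    change _ = (2 : K) ^ n • dilation K 𝔤 V (f x)
    have hc := card_compl_add_card S
    obtain h | h | h : Sᶜ.card = 0 ∨ Sᶜ.card = 1 ∨ 2 ≤ Sᶜ.card := by omega
    · have hS : S.card = n + 1 := by omega
      have : dilation K 𝔤 V (f x) = (2 : K) • f x := by
        simp [dilation, Prod.ext_iff, h0 h]
      rw [this, hS, smul_smul, pow_succ]
    · have hS : S.card = n := by omega
      have : dilation K 𝔤 V (f x) = f x := by
        simp [dilation, Prod.ext_iff, h1 h]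
      rw [this, hS]
    · rw [h2 h, map_zero, smul_zero, smul_zero]
  intro l
  by_cases hl : l.length = n + 1
  · rw [listEval_eq _ l hl, listEval_eq _ (l.map _) (n := n) (by simpa using hl),
      DirectSum.lof_apply, zpow_natCast]
    have := congrArg (fun g => g fun i => l.get (i.cast hl.symm)) key
    simp only [AlternatingMap.compLinearMap_apply] at this
    simpa using this
  · rw [listEval_eq_zero (lof_mem_degPart n _) (by rw [List.length_map]; exact_mod_cast hl),
      listEval_eq_zero (lof_mem_degPart n _) (by exact_mod_cast hl), map_zero, smul_zero]

theorem signTwist_mem_HPart (r : ℕ) {θ : CochainAlg K (𝔤 × V)} (hθ : θ ∈ HPart K 𝔤 V) :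
    signTwist K (𝔤 × V) r θ ∈ HPart K 𝔤 V := fun n => by
  rw [signTwist_apply]
  exact Submodule.smul_mem _ _ (hθ n)

theorem exists_forall_apply_eq_zero (Q : CochainAlg K (𝔤 × V)) : ∃ N, ∀ n, N ≤ n → Q n = 0 := by
  obtain ⟨s, hs⟩ := sum_components Q
  refine ⟨s.sup id + 1, fun n hn => ?_⟩
  rw [hs]
  have : (∑ m ∈ s, DirectSum.lof K ℕ (fun n => Cochain K (𝔤 × V) n) m (Q m)) ∈
      ({ carrier := {A | A n = 0}, zero_mem' := rfl, add_mem' := fun {x y} hx hy => by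
          change (x + y) n = 0
          rw [DirectSum.add_apply, hx, hy, add_zero] } :
        AddSubmonoid (CochainAlg K (𝔤 × V))) := by
    refine sum_mem fun m hm => ?_
    have : m ≤ s.sup id := Finset.le_sup (f := id) hm
    exact lof_mem_degPart m _ n (by omega)
  exact this

/-! ### The filtration -/

/-- If some `F N` meets `S` trivially, a Cauchy sequence in `S` is constant from index `N` on. -/
theorem existsUnique_limit {K E : Type*} [Field K] [AddCommGroup E] [Module K E]
    {S : Submodule K E} {F : ℕ → Submodule K E} (hF : Antitone F) {N : ℕ}
    (hN : ∀ y ∈ S, y ∈ F N → y = 0) {x : ℕ → E} (hx : ∀ n, x n ∈ S)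
    (hx' : ∀ n, x (n + 1) - x n ∈ F n) : ∃! y, y ∈ S ∧ ∀ n, y - x n ∈ F n := by
  have hle : ∀ n n', n ≤ n' → x n' - x n ∈ F n := fun n n' h => by
    induction n', h using Nat.le_induction with
    | base => rw [sub_self]; exact zero_mem _
    | succ k hk ih =>
      rw [← sub_add_sub_cancel (x (k + 1)) (x k) (x n)]
      exact add_mem (hF hk (hx' k)) ih
  have hN' : ∀ n, N ≤ n → x n = x N := fun n hn => sub_eq_zero.1
    (hN _ (sub_mem (hx n) (hx N)) (hle N n hn))
  refine ⟨x N, ⟨hx N, fun n => ?_⟩, fun y hy => sub_eq_zero.1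
    (hN _ (sub_mem hy.1 (hx N)) (hy.2 N))⟩
  rcases le_total n N with h | h
  · exact hle n N h
  · rw [hN' n h, sub_self]
    exact zero_mem _

theorem antitone_arityFiltration : Antitone (arityFiltration K 𝔤 V) := fun m n h _ hx =>
  ⟨fun hm => hx.1 (hm.trans h), fun j hj => hx.2 j (by omega)⟩

/-- In degree `m` the `𝔥`-part is a cochain of degree `m`, and `F_n` contains only cochains of
degree at least `n - 2`. So in each degree the filtration is eventually zero. -/
theorem eq_zero_of_mem_arityFiltration {m : ℤ} {n : ℕ} (hn : m + 3 ≤ n) (hn' : 2 ≤ n)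
    {x : TotalSpace K 𝔤 V} (hx : x ∈ totalGrading K 𝔤 V m) (hx' : x ∈ arityFiltration K 𝔤 V n) :
    x = 0 := by
  refine Prod.ext (hx'.1 hn') (Subtype.ext (DFinsupp.ext fun j => ?_))
  by_cases h : (j : ℤ) = m
  · exact hx'.2 j (by omega)
  · exact hx.2 j h

/-! ### Weights in characteristic zero -/

variable [CharZero K]

theorem HPart_le_weightPart : HPart K 𝔤 V ≤ weightPart K 𝔤 V (-1) := fun θ hθ l => by
  have h : (l.map (dilation K 𝔤 V)).map (fun w => ((0 : 𝔤), w.2)) =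
      l.map fun w => ((0 : 𝔤), w.2) := by
    rw [List.map_map]
    exact List.map_congr_left fun w _ => rfl
  rw [← proj_eq_self hθ, listEval_proj, listEval_proj, h]
  simp [dilation, inv_smul_smul₀]

theorem two_zpow_ne_one {j : ℤ} (hj : j ≠ 0) : (2 : K) ^ j ≠ 1 := fun h => by
  have h' : (((2 : ℚ) ^ j : ℚ) : K) = ((1 : ℚ) : K) := by
    push_cast
    exact h
  have h2 : (2 : ℚ) ^ j = 1 := Rat.cast_injective h'
  exact hj ((zpow_eq_one_iff_right₀ (by norm_num) (by norm_num)).1 h2)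

/-- Dilation fixes `V`-vectors and doubles `𝔤`-values, so the `𝔤`-value `y` on `V`-vectors satisfies
`y = 2^(j+1) y`; in characteristic zero this forces `y = 0`. -/
theorem proj_eq_zero_of_weight {j : ℤ} (hj : j ≠ -1) {A : CochainAlg K (𝔤 × V)}
    (hA : A ∈ weightPart K 𝔤 V j) : proj K 𝔤 V A = 0 := by
  refine listEval_injective (funext fun l => ?_)
  have h := congrArg Prod.fst (hA (l.map fun w => ((0 : 𝔤), w.2)))
  rw [List.map_map, List.map_congr_left (g := fun w => ((0 : 𝔤), w.2)) (fun w _ => by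
    simp [dilation])] at h
  rw [listEval_proj, listEval_zero]
  refine Prod.ext ?_ rfl
  generalize (listEval A (l.map fun w => ((0 : 𝔤), w.2))) = y at h ⊢
  have h' : ((2 : K) ^ (j + 1) - 1) • y.1 = 0 := by
    rw [zpow_add_one₀ two_ne_zero, sub_smul, one_smul, mul_smul, sub_eq_zero]
    exact h.symm
  exact (smul_eq_zero.1 h').resolve_left
    (sub_ne_zero.2 (two_zpow_ne_one fun h => hj (by linarith)))

theorem listCirc_weight {i j : ℤ} {A B : CochainAlg K (𝔤 × V)} (hA : A ∈ weightPart K 𝔤 V i)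
    (hB : B ∈ weightPart K 𝔤 V j) (l : List (𝔤 × V)) :
    listCirc (listEval A) (listEval B) (l.map (dilation K 𝔤 V)) =
      (2 : K) ^ (i + j) • dilation K 𝔤 V (listCirc (listEval A) (listEval B) l) := by
  have h := map_split (fun _ => 1) ((2 : K) ^ (i + j) • dilation K 𝔤 V) l
    fun a b => listEval A (listEval B a :: b)
  refine Eq.trans ?_ h.symm
  rw [listCirc, split_map]
  refine split_congr _ fun a b _ => ?_
  rw [hB, zpow_add₀ two_ne_zero, mul_comm, LinearMap.smul_apply, mul_smul, ← hA, List.map_cons]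
  exact listEval_map_smul A [] _ _ _

theorem nrBracket_mem_weightPart {i j : ℤ} {A B : CochainAlg K (𝔤 × V)}
    (hA : A ∈ weightPart K 𝔤 V i) (hB : B ∈ weightPart K 𝔤 V j) :
    nrBracket K (𝔤 × V) A B ∈ weightPart K 𝔤 V (i + j) := by
  obtain ⟨s, hs⟩ := sum_components A
  obtain ⟨t, ht⟩ := sum_components B
  rw [hs, ht]
  simp only [map_sum, LinearMap.sum_apply]
  refine sum_mem fun q _ => sum_mem fun p _ l => ?_
  rw [listEval_nrBracket (lof_mem_degPart _ _) (lof_mem_degPart _ _)]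
  simp only [Pi.sub_apply, Pi.smul_apply, map_sub, smul_sub, map_zsmul]
  rw [listCirc_weight (component_mem_weightPart hA p) (component_mem_weightPart hB q),
    listCirc_weight (component_mem_weightPart hB q) (component_mem_weightPart hA p), add_comm j i,
    smul_comm ((2 : K) ^ (i + j))]

theorem nest_mem_weightPart {i : ℤ} {A : CochainAlg K (𝔤 × V)} (hA : A ∈ weightPart K 𝔤 V i)
    {l : List (CochainAlg K (𝔤 × V))} (hl : ∀ θ ∈ l, θ ∈ HPart K 𝔤 V) :
    nestedBracket K (𝔤 × V) l A ∈ weightPart K 𝔤 V (i - l.length) := by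
  induction l generalizing i A with
  | nil =>
    rw [List.length_nil, Nat.cast_zero, sub_zero]
    exact hA
  | cons θ l ih =>
    rw [List.forall_mem_cons] at hl
    have := ih (nrBracket_mem_weightPart hA (HPart_le_weightPart hl.1)) hl.2
    rw [List.length_cons]
    push_cast
    rwa [show i - ((l.length : ℤ) + 1) = i + -1 - l.length by ring]

/-! ### Vanishing of the brackets -/

/-- The elements of `L` of degree at least `d`. -/
def degGE (K W : Type*) [Field K] [AddCommGroup W] [Module K W] (d : ℕ) :
    Submodule K (CochainAlg K W) where
  carrier := {A | ∀ n, n < d → A n = 0}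
  zero_mem' _ _ := rfl
  add_mem' {x y} hx hy n hn := by simp [DirectSum.add_apply, hx n hn, hy n hn]
  smul_mem' c x hx n hn := by simp [DirectSum.smul_apply, hx n hn]

theorem nrBracket_mem_degGE {d : ℕ} {A : CochainAlg K (𝔤 × V)} (hA : A ∈ degGE K (𝔤 × V) d)
    (B : CochainAlg K (𝔤 × V)) : nrBracket K (𝔤 × V) A B ∈ degGE K (𝔤 × V) d := by
  obtain ⟨s, hs⟩ := sum_components A
  obtain ⟨t, ht⟩ := sum_components B
  rw [hs, ht]
  simp only [map_sum, LinearMap.sum_apply]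
  refine sum_mem fun q _ => sum_mem fun p _ n hn => ?_
  rcases lt_or_ge p d with h | h
  · rw [hA p h, map_zero, map_zero]
    rfl
  · exact nrBracket_mem_degPart (lof_mem_degPart p _) (lof_mem_degPart q _) n (by omega)

theorem nest_mem_degGE {d : ℕ} {A : CochainAlg K (𝔤 × V)} (hA : A ∈ degGE K (𝔤 × V) d)
    (l : List (CochainAlg K (𝔤 × V))) : nestedBracket K (𝔤 × V) l A ∈ degGE K (𝔤 × V) d := by
  induction l generalizing A with
  | nil => exact hA
  | cons θ l ih => exact ih (nrBracket_mem_degGE hA θ)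

/-- Bracketing a component in `C^{n|0}` with `k - 1` elements of `𝔥` gives weight `n - (k - 1)`,
which equals `-1` only for `n = k - 2`. All other components are killed by the projection. -/
theorem bracketHTerm_mem {k : ℕ} (x : Fin k → TotalSpace K 𝔤 V) (i : Fin k)
    {S : Submodule K (CochainAlg K (𝔤 × V))}
    (h : ∀ n l, n + 2 = k → proj K 𝔤 V (nestedBracket K (𝔤 × V) l
      (DirectSum.lof K ℕ (fun n => Cochain K (𝔤 × V) n) n ((x i).1.1 n))) ∈ S) :
    bracketHTerm x i ∈ S := by
  obtain ⟨s, hs⟩ := sum_components (x i).1.1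
  rw [bracketHTerm, hs]
  simp only [map_sum, DirectSum.toModule_lof, LinearMap.comp_apply]
  refine sum_mem fun n _ => ?_
  by_cases hn : n + 2 = k
  · exact h n _ hn
  · have hlen : (((List.finRange k).filter fun j => j ≠ i)).length + 1 = k := by
      have h1 : ((List.finRange k).filter fun j => j ≠ i) = (List.finRange k).erase i := by
        rw [(List.nodup_finRange k).erase_eq_filter]
        exact List.filter_congr fun j _ => by simp [bne, beq_eq_decide]
      have h2 := i.pos
      rw [h1, List.length_erase_of_mem (List.mem_finRange i), List.length_finRange]
      omega
    rw [proj_eq_zero_of_weight _ (nest_mem_weightPart (weightPart_of_bidegree ((x i).1.2 n)) _)]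
    · exact zero_mem S
    · rw [List.length_map]
      omega
    · intro θ hθ
      obtain ⟨j, -, rfl⟩ := List.mem_map.1 hθ
      split_ifs
      exacts [signTwist_mem_HPart _ (x j).2.2, (x j).2.2]

theorem bracket_eq_zero {k : ℕ} (hk : 3 ≤ k) (x : Fin k → TotalSpace K 𝔤 V)
    (h : ∀ i, ∀ n, n + 2 = k → (x i).1.1 n = 0) : bracket k x = 0 := by
  obtain ⟨k, rfl⟩ := Nat.exists_eq_add_of_le' hk
  refine Prod.ext rfl ?_
  have h0 : ∀ i, (⟨bracketHTerm x i, proj_mem _⟩ : HPart K 𝔤 V) = 0 := fun i => Subtype.ext ?_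
  · have : ∑ i, (⟨bracketHTerm x i, proj_mem _⟩ : HPart K 𝔤 V) = 0 :=
      Finset.sum_eq_zero fun i _ => h0 i
    exact this
  refine (Submodule.mem_bot K).1 (bracketHTerm_mem x i fun n l hn => ?_)
  rw [h i n hn, map_zero, map_zero, map_zero]
  exact zero_mem _

theorem bracket_mem_arityFiltration {k : ℕ} (hk : 3 ≤ k) (x : Fin k → TotalSpace K 𝔤 V) :
    bracket k x ∈ arityFiltration K 𝔤 V k := by
  obtain ⟨k, rfl⟩ := Nat.exists_eq_add_of_le' hk
  refine ⟨fun _ => rfl, fun j hj => ?_⟩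
  have h : ((bracket (k + 3) x).2 : CochainAlg K (𝔤 × V)) = ∑ i, bracketHTerm x i :=
    AddSubmonoidClass.coe_finsetSum ..
  rw [h]
  -- Here `k + 3` is the number of entries, so the surviving component has degree `k + 1`, and
  -- nested brackets never lower the degree.
  refine (sum_mem fun i _ => bracketHTerm_mem x i (S := degGE K (𝔤 × V) (k + 1))
    fun n l hn => ?_ : _ ∈ degGE K (𝔤 × V) (k + 1)) j (by omega)
  intro m hm
  rw [proj_apply, nest_mem_degGE (d := k + 1) _ l m hm, map_zero]
  intro m hm
  exact lof_mem_degPart n _ m (by omega)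

/-- The `L'`-parts of finitely many elements have bounded degree, while a bracket of `k ≥ 3` entries
needs a component of degree `k - 2`. -/
theorem locallyNilpotent_listBracket :
    LocallyNilpotent (listBracket (K := K) (𝔤 := 𝔤) (V := V)) := fun A => by
  have hA : ∃ N, ∀ x ∈ A, ∀ n, N ≤ n → x.1.1 n = 0 := by
    induction A with
    | nil => exact ⟨0, by simp⟩
    | cons x A ih =>
      obtain ⟨N, hN⟩ := ih
      obtain ⟨M, hM⟩ := exists_forall_apply_eq_zero x.1.1
      refine ⟨max M N, List.forall_mem_cons.2 ⟨fun n hn => hM n (le_trans (le_max_left _ _) hn),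
        fun y hy n hn => hN y hy n (le_trans (le_max_right _ _) hn)⟩⟩
  obtain ⟨N, hN⟩ := hA
  refine ⟨N + 3, fun xs hxs hlen => bracket_eq_zero (by omega) _ fun i n hn => ?_⟩
  exact hN _ (hxs _ (List.get_mem xs i)) n (by omega)

theorem isWeaklyFiltered_arityFiltration :
    IsWeaklyFiltered (totalGrading K 𝔤 V) bracket (arityFiltration K 𝔤 V) where
  isLInfinity := listLInfinity_listBracket.isLInfinity fun k _ x => listBracket_ofFn k x
  one := eq_top_iff.2 fun x _ => ⟨fun h => by omega, fun j h => by omega⟩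
  antitone := antitone_arityFiltration
  graded n := by
    refine le_antisymm (le_iSup_inf_totalGrading (fun x hx m => ⟨fun h => ?_, fun _ _ => rfl⟩)
      fun x hx m => ⟨fun _ => rfl, fun j hj => ?_⟩) (iSup_le fun m => inf_le_left)
    · refine Subtype.ext ?_
      change DirectSum.lof K ℕ (fun n => Cochain K (𝔤 × V) n) m (x.1.1 m) = 0
      rw [hx.1 h]
      exact map_zero _
    · by_cases h : m = j
      · subst h
        exact (DirectSum.lof_apply K _ _).trans (hx.2 m hj)
      · exact lof_mem_degPart m _ j (by omega)
  bracket_mem := ⟨3, by norm_num, fun k hk x => bracket_mem_arityFiltration hk x⟩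
  complete m x hx hx' := by
    obtain ⟨N, h1, h2⟩ : ∃ N : ℕ, m + 3 ≤ N ∧ 2 ≤ N := ⟨m.toNat + 3, by omega, by omega⟩
    exact existsUnique_limit (E := TotalSpace K 𝔤 V) antitone_arityFiltration
      (fun y hy hy' => eq_zero_of_mem_arityFiltration h1 h2 hy hy') hx hx'

end Weight

section MaurerCartan

variable {K 𝔤 V : Type*} [Field K] [AddCommGroup 𝔤] [Module K 𝔤] [AddCommGroup V] [Module K V]

/-! ### Maurer–Cartan elements and relative Rota–Baxter Lie algebras -/

theorem listEval_lof_of_length_ne {n : ℕ} (f : Cochain K (𝔤 × V) n) {l : List (𝔤 × V)}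
    (h : l.length ≠ n + 1) :
    listEval (DirectSum.lof K ℕ (fun n => Cochain K (𝔤 × V) n) n f) l = 0 :=
  listEval_eq_zero (lof_mem_degPart n f) (by exact_mod_cast h)

/-- `μ + ρ` as an element of `L`. -/
def pairElement (μ : 𝔤 [⋀^Fin 2]→ₗ[K] 𝔤) (ρ : 𝔤 →ₗ[K] Module.End K V) : CochainAlg K (𝔤 × V) :=
  DirectSum.lof K ℕ (fun n => Cochain K (𝔤 × V) n) 1 (liftPair μ ρ)

/-- `T` as an element of `L`. -/
def operatorElement (T : V →ₗ[K] 𝔤) : CochainAlg K (𝔤 × V) :=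
  DirectSum.lof K ℕ (fun n => Cochain K (𝔤 × V) n) 0 (liftOperator T)

variable (μ : 𝔤 [⋀^Fin 2]→ₗ[K] 𝔤) (ρ : 𝔤 →ₗ[K] Module.End K V) (T : V →ₗ[K] 𝔤)

theorem pairElement_mem : pairElement μ ρ ∈ degPart K (𝔤 × V) 1 := lof_mem_degPart 1 _

theorem operatorElement_mem : operatorElement T ∈ degPart K (𝔤 × V) 0 := lof_mem_degPart 0 _

theorem listEval_pairElement (a b : 𝔤 × V) :
    listEval (pairElement μ ρ) [a, b] = (μ ![a.1, b.1], ρ a.1 b.2 - ρ b.1 a.2) := by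
  have h : [a, b] = List.ofFn ![a, b] := by simp
  rw [h, listEval_ofFn, pairElement, DirectSum.lof_apply, liftPair_apply]
  congr 2
  funext i
  fin_cases i <;> rfl

theorem listEval_operatorElement (a : 𝔤 × V) :
    listEval (operatorElement T) [a] = (T a.2, 0) := by
  have h : [a] = List.ofFn ![a] := by simp
  rw [h, listEval_ofFn, operatorElement, DirectSum.lof_apply]
  rfl

theorem listEval_pairElement_of_length_ne {l : List (𝔤 × V)} (h : l.length ≠ 2) :
    listEval (pairElement μ ρ) l = 0 := listEval_lof_of_length_ne _ h

theorem listEval_operatorElement_of_length_ne {l : List (𝔤 × V)} (h : l.length ≠ 1) :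
    listEval (operatorElement T) l = 0 := listEval_lof_of_length_ne _ h

/-- The `𝔤`-component is the Jacobiator of `μ`, and the `V`-component is the cyclic sum of the
failures of `ρ` to be a representation. -/
theorem listCirc_pairElement (a b c : 𝔤 × V) :
    listCirc (listEval (pairElement μ ρ)) (listEval (pairElement μ ρ)) [a, b, c] =
      (μ ![μ ![a.1, b.1], c.1] + μ ![μ ![b.1, c.1], a.1] + μ ![μ ![c.1, a.1], b.1],
        (ρ (μ ![a.1, b.1]) c.2 - (ρ a.1 (ρ b.1 c.2) - ρ b.1 (ρ a.1 c.2))) +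
        (ρ (μ ![b.1, c.1]) a.2 - (ρ b.1 (ρ c.1 a.2) - ρ c.1 (ρ b.1 a.2))) +
        (ρ (μ ![c.1, a.1]) b.2 - (ρ c.1 (ρ a.1 b.2) - ρ a.1 (ρ c.1 b.2)))) := by
  have hs : μ ![a.1, c.1] = - μ ![c.1, a.1] := by
    have := μ.map_swap ![c.1, a.1] (i := 0) (j := 1) (by decide)
    rw [← this]
    congr 1
    funext i
    fin_cases i <;> rfl
  have hn : ∀ x y : 𝔤, μ ![-x, y] = - μ ![x, y] := fun x y => by
    have e : ∀ z, Function.update ![x, y] 0 z = ![z, y] := fun z => by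
      funext i
      fin_cases i <;> rfl
    rw [← e, AlternatingMap.map_update_neg, e]
  have h2 : sgn 2 = 1 := rfl
  simp only [listCirc, split_cons, split_nil, degSum_cons, degSum_nil]
  simp [listEval_pairElement, listEval_pairElement_of_length_ne, hs, hn, h2]
  refine ⟨by abel, by abel⟩

variable [CharZero K]

theorem nrBracket_pairElement_eq_zero_iff :
    nrBracket K (𝔤 × V) (pairElement μ ρ) (pairElement μ ρ) = 0 ↔
      (∀ x y z, μ ![μ ![x, y], z] + μ ![μ ![y, z], x] + μ ![μ ![z, x], y] = 0) ∧
      ∀ x y v, ρ (μ ![x, y]) v = ρ x (ρ y v) - ρ y (ρ x v) := by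
  have h2 : listEval (nrBracket K (𝔤 × V) (pairElement μ ρ) (pairElement μ ρ)) =
      (2 : K) • listCirc (listEval (pairElement μ ρ)) (listEval (pairElement μ ρ)) := by
    rw [listEval_nrBracket (pairElement_mem μ ρ) (pairElement_mem μ ρ), mul_one, sgn_one, neg_smul,
      one_smul, sub_neg_eq_add, two_smul]
  constructor
  · intro h
    rw [h, listEval_zero] at h2
    have key : ∀ a b c, listCirc (listEval (pairElement μ ρ)) (listEval (pairElement μ ρ))
        [a, b, c] = 0 := fun a b c => by
      have h3 : (2 : K) • listCirc (listEval (pairElement μ ρ)) (listEval (pairElement μ ρ))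
        [a, b, c] = 0 := (congrFun h2 [a, b, c]).symm
      exact (smul_eq_zero.1 h3).resolve_left two_ne_zero
    simp only [listCirc_pairElement] at key
    -- Three `𝔤`-vectors isolate the Jacobi identity; two `𝔤`-vectors and one `V`-vector isolate the
    -- representation condition.
    refine ⟨fun x y z => congrArg Prod.fst (key (x, 0) (y, 0) (z, 0)), fun x y v => ?_⟩
    have := congrArg Prod.snd (key (x, 0) (y, 0) (0, v))
    simpa [sub_eq_zero] using this
  · rintro ⟨hj, hr⟩
    refine listEval_injective (funext fun l => ?_)
    by_cases hl : l.length = 3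
    · obtain ⟨a, b, c, rfl⟩ := List.length_eq_three.1 hl
      rw [h2, Pi.smul_apply, listCirc_pairElement, hj, hr, hr, hr, listEval_zero]
      simp
    · rw [listEval_eq_zero (nrBracket_mem_degPart (pairElement_mem μ ρ) (pairElement_mem μ ρ))
        (fun h => hl (by exact_mod_cast h)), listEval_zero]
      rfl

theorem listEval_nrBracket_operatorElement {A : CochainAlg K (𝔤 × V)}
    (hA : A ∈ degPart K (𝔤 × V) 1) (a b : 𝔤 × V) :
    listEval (nrBracket K (𝔤 × V) A (operatorElement T)) [a, b] =
      listEval A [(T a.2, 0), b] - listEval A [(T b.2, 0), a] - (T (listEval A [a, b]).2, 0) := by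
  have h1 : ∀ c, listEval A [c] = 0 := fun c => listEval_eq_zero hA (by simp)
  have h3 : ∀ c d e, listEval A [c, d, e] = 0 := fun c d e => listEval_eq_zero hA (by simp)
  rw [listEval_nrBracket hA (operatorElement_mem T)]
  simp [listCirc, split_cons, listEval_operatorElement, listEval_operatorElement_of_length_ne, h1,
    h3, sub_eq_add_neg]

/-- On two vectors of `V`, the `𝔤`-value of `[[π, T], T]` is twice the defect of the Rota–Baxter
identity. -/
theorem proj_nrBracket_operatorElement_eq_zero_iff :
    proj K 𝔤 V (nrBracket K (𝔤 × V) (nrBracket K (𝔤 × V) (pairElement μ ρ) (operatorElement T))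
        (operatorElement T)) = 0 ↔
      ∀ u v, μ ![T u, T v] = T (ρ (T u) v - ρ (T v) u) := by
  have hN := nrBracket_mem_degPart (pairElement_mem μ ρ) (operatorElement_mem T)
  have hM := nrBracket_mem_degPart hN (operatorElement_mem T)
  have hs : ∀ x y : 𝔤, μ ![y, x] = - μ ![x, y] := fun x y => by
    have := μ.map_swap ![x, y] (i := 0) (j := 1) (by decide)
    rw [← this]
    congr 1
    funext i
    fin_cases i <;> rfl
  have key : ∀ u v, (listEval (nrBracket K (𝔤 × V) (nrBracket K (𝔤 × V) (pairElement μ ρ)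
      (operatorElement T)) (operatorElement T)) [(0, u), (0, v)]).1 =
        (2 : K) • (μ ![T u, T v] - T (ρ (T u) v - ρ (T v) u)) := fun u v => by
    rw [listEval_nrBracket_operatorElement T hN]
    simp only [listEval_nrBracket_operatorElement T (pairElement_mem μ ρ), listEval_pairElement]
    have h0 : ∀ x : 𝔤, μ ![0, x] = 0 := fun x => μ.map_coord_zero 0 rfl
    have h0' : ∀ x : 𝔤, μ ![x, 0] = 0 := fun x => μ.map_coord_zero 1 rfl
    rw [two_smul]
    simp [h0, h0', hs (T u) (T v)]
    abel
  constructor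
  · intro h u v
    have h1 := listEval_proj (nrBracket K (𝔤 × V) (nrBracket K (𝔤 × V) (pairElement μ ρ)
      (operatorElement T)) (operatorElement T)) [(0, u), (0, v)]
    rw [h, listEval_zero] at h1
    have h2 := (key u v).symm.trans (congrArg Prod.fst h1).symm
    exact sub_eq_zero.1 ((smul_eq_zero.1 h2).resolve_left two_ne_zero)
  · intro h
    refine listEval_injective (funext fun l => ?_)
    rw [listEval_zero]
    by_cases hl : l.length = 2
    · obtain ⟨a, b, rfl⟩ := List.length_eq_two.1 hl
      rw [listEval_proj]
      refine Prod.ext ((key a.2 b.2).trans ?_) rfl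
      rw [h, sub_self, smul_zero]
      rfl
    · exact listEval_eq_zero (proj_mem_degPart hM) fun h => hl (by exact_mod_cast h)

omit [CharZero K] in
theorem toElement_mem : toElement μ ρ T ∈ totalGrading K 𝔤 V 0 :=
  ⟨pairElement_mem μ ρ, operatorElement_mem T⟩

omit [CharZero K] in
theorem toElement_add (μ' : 𝔤 [⋀^Fin 2]→ₗ[K] 𝔤) (ρ' : 𝔤 →ₗ[K] Module.End K V) (T' : V →ₗ[K] 𝔤) :
    toElement (μ + μ') (ρ + ρ') (T + T') = toElement μ ρ T + toElement μ' ρ' T' := by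
  refine Prod.ext (Subtype.ext ?_) (Subtype.ext ?_)
  · refine Eq.trans (congrArg (DirectSum.lof K ℕ (fun n => Cochain K (𝔤 × V) n) 1) ?_)
      (map_add _ _ _)
    refine AlternatingMap.ext fun x => ?_
    rw [AlternatingMap.add_apply, liftPair_apply, liftPair_apply, liftPair_apply]
    refine Prod.ext rfl ?_
    simp
    abel
  · refine Eq.trans (congrArg (DirectSum.lof K ℕ (fun n => Cochain K (𝔤 × V) n) 0) ?_)
      (map_add _ _ _)
    refine AlternatingMap.ext fun x => ?_
    simp [liftOperator]

omit [CharZero K] in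
theorem pairElement_weight : pairElement μ ρ ∈ weightPart K 𝔤 V 1 :=
  weightPart_of_bidegree (liftPair_mem μ ρ)

/-- The Maurer–Cartan series of `(s⁻¹π, T)` is `(-½ s⁻¹[π, π], ½ P[[π, T], T])`, and its two
components encode the three axioms. -/
theorem twistList_toElement :
    twistList K listBracket (toElement μ ρ T) [] = 0 ↔ IsRelRotaBaxter μ ρ T := by
  let a : HomogTotal K 𝔤 V := ⟨0, toElement μ ρ T, toElement_mem μ ρ T⟩
  have hq : qPart a = pairElement μ ρ := rfl
  have hh : hPart a = operatorElement T := rfl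
  -- Since `π` has weight `1`, exactly two elements of `𝔥` are needed to reach weight `-1`.
  have hw : ∀ l : List (CochainAlg K (𝔤 × V)), (∀ θ ∈ l, θ ∈ HPart K 𝔤 V) → l.length ≠ 2 →
      proj K 𝔤 V (nestedBracket K (𝔤 × V) l (pairElement μ ρ)) = 0 := fun l hl hl' =>
    proj_eq_zero_of_weight (by omega) (nest_mem_weightPart (pairElement_weight μ ρ) hl)
  have hT : operatorElement T ∈ HPart K 𝔤 V := lof_mem_HPart (liftOperator_mem T)
  have hB : ∀ n, 4 ≤ n → listBracket (List.replicate n (toElement μ ρ T) ++ []) = 0 := fun n hn => by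
    rw [List.append_nil]
    refine bracket_eq_zero (by rw [List.length_replicate]; omega) _ fun i m hm => ?_
    rw [List.length_replicate] at hm
    rw [List.get_eq_getElem, List.getElem_replicate]
    exact pairElement_mem μ ρ m (by omega)
  have h1 : listBracket [toElement μ ρ T] = 0 := by
    refine Prod.ext (Subtype.ext (listBracket_fst [a])) (Subtype.ext ?_)
    refine (listBracket_snd [a]).trans ?_
    rw [VoronovData.nestSum, split_single_cons, hq, nrVoronov_nest]
    simpa using hw [] (by simp) (by simp)
  obtain ⟨Q, hQ⟩ : ∃ Q : LPrime K 𝔤 V, (Q : CochainAlg K (𝔤 × V)) =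
      nrBracket K (𝔤 × V) (pairElement μ ρ) (pairElement μ ρ) :=
    ⟨⟨_, nrBracket_mem_LPrime (toElement μ ρ T).1.2 (toElement μ ρ T).1.2⟩, rfl⟩
  obtain ⟨Θ, hΘ⟩ : ∃ Θ : HPart K 𝔤 V, (Θ : CochainAlg K (𝔤 × V)) =
      proj K 𝔤 V (nrBracket K (𝔤 × V) (nrBracket K (𝔤 × V) (pairElement μ ρ)
        (operatorElement T)) (operatorElement T)) := ⟨⟨_, proj_mem _⟩, rfl⟩
  -- The minus sign is `(-1)^π`, as `π` has degree `1`.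
  have h2 : listBracket [toElement μ ρ T, toElement μ ρ T] = (-Q, 0) := by
    refine Prod.ext (Subtype.ext ((listBracket_fst [a, a]).trans ?_)) (Subtype.ext ?_)
    · rw [VoronovData.nrPair_pair, hq]
      change _ = -(Q : CochainAlg K (𝔤 × V))
      rw [hQ]
      simp [a]
      rfl
    · refine (listBracket_snd [a, a]).trans ?_
      rw [VoronovData.nestSum]
      simp only [split_cons, split_nil, single_nil, single_singleton, single_cons_cons, nrVoronov_nest,
        hq, hh, List.map_cons, List.map_nil, map_add, map_zsmul, smul_zero]
      have := hw [operatorElement T] (by simpa using hT) (by simp)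
      simp [this]
  -- Each of the three positions for `π` gives the same term, without sign because the entries have
  -- degree `0`. The factor `3` against `1/3!` leaves `½`.
  have h3 : listBracket [toElement μ ρ T, toElement μ ρ T, toElement μ ρ T] =
      (0, (3 : K) • Θ) := by
    refine Prod.ext (Subtype.ext ((listBracket_fst [a, a, a]).trans rfl)) (Subtype.ext ?_)
    refine (listBracket_snd [a, a, a]).trans ?_
    rw [VoronovData.nestSum]
    have ha : a.1 = 0 := rfl
    simp only [split_cons, split_nil, single_nil, single_singleton, single_cons_cons, nrVoronov_nest,
      hq, hh, List.map_cons, List.map_nil, map_add, smul_zero, ha, zero_mul, sgn_zero, one_smul,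
      add_zero, zero_add]
    change _ = (3 : K) • (Θ : CochainAlg K (𝔤 × V))
    rw [hΘ]
    change _ = (3 : K) • proj K 𝔤 V (nestedBracket K (𝔤 × V) [operatorElement T, operatorElement T]
      (pairElement μ ρ))
    module
  have h5 : (2 : K)⁻¹ ≠ 0 := inv_ne_zero two_ne_zero
  have hsum : twistList K listBracket (toElement μ ρ T) [] =
      ((2 : K)⁻¹ • -Q, (2 : K)⁻¹ • Θ) := by
    have h0 : listBracket ([] : List (TotalSpace K 𝔤 V)) = 0 := rfl
    have h6 : ((3 : ℕ).factorial : K)⁻¹ * 3 = 2⁻¹ := by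
      rw [show (3 : ℕ).factorial = 3 * 2 from rfl]
      push_cast
      field_simp
      norm_num
    rw [twistList_eq_sum (E := TotalSpace K 𝔤 V) hB]
    simp only [Finset.sum_range_succ, Finset.sum_range_zero, twistListTerm, List.append_nil,
      List.replicate, h0, h1, h2, h3, Prod.smul_mk, smul_smul, h6, smul_zero, zero_add,
      Nat.factorial_two, Nat.cast_ofNat, Prod.mk_add_mk, add_zero]
  have hneg : -Q = 0 ↔ Q = 0 := neg_eq_zero (a := Q)
  rw [hsum, Prod.mk_eq_zero, smul_eq_zero_iff_right h5, smul_eq_zero_iff_right h5, hneg,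
    ← Submodule.coe_eq_zero, ← Submodule.coe_eq_zero, hQ, hΘ,
    nrBracket_pairElement_eq_zero_iff, proj_nrBracket_operatorElement_eq_zero_iff]
  exact ⟨fun h => ⟨h.1.1, h.1.2, h.2⟩, fun h => ⟨⟨h.jacobi, h.rep⟩, h.rotaBaxter⟩⟩

theorem isMaurerCartan_toElement_iff {F : ℕ → Submodule K (TotalSpace K 𝔤 V)}
    (hF : IsWeaklyFiltered (grading K 𝔤 V) bracket F) :
    IsMaurerCartan (grading K 𝔤 V) bracket F (toElement μ ρ T) ↔ IsRelRotaBaxter μ ρ T := by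
  rw [hF.isMaurerCartan_iff (fun k _ => listBracket_ofFn k) locallyNilpotent_listBracket rfl,
    twistList_toElement]
  exact and_iff_right (toElement_mem μ ρ T)

end MaurerCartan

end RelRB

/-! ### The theorem on the controlling `L_∞`-algebra and its twist -/

theorem mainTheorem2 {K 𝔤 V : Type*} [Field K] [CharZero K] [AddCommGroup 𝔤] [Module K 𝔤]
    [AddCommGroup V] [Module K V]
    (μ : 𝔤 [⋀^Fin 2]→ₗ[K] 𝔤) (ρ : 𝔤 →ₗ[K] Module.End K V) (T : V →ₗ[K] 𝔤)
    (hT : IsRelRotaBaxter μ ρ T) :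
    IsWeaklyFiltered (grading K 𝔤 V) bracket (arityFiltration K 𝔤 V) ∧
    ∀ F : ℕ → Submodule K (TotalSpace K 𝔤 V), IsWeaklyFiltered (grading K 𝔤 V) bracket F →
      IsMaurerCartan (grading K 𝔤 V) bracket F (toElement μ ρ T) ∧
      (∀ k, 1 ≤ k → ∀ x : Fin k → TotalSpace K 𝔤 V,
        SeriesConverges F (twistTerm (K := K) bracket (toElement μ ρ T) k x)
          (twist bracket F (toElement μ ρ T) k x)) ∧
      IsWeaklyFiltered (grading K 𝔤 V) (twist bracket F (toElement μ ρ T)) F ∧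
      ∀ (μ' : 𝔤 [⋀^Fin 2]→ₗ[K] 𝔤) (ρ' : 𝔤 →ₗ[K] Module.End K V) (T' : V →ₗ[K] 𝔤),
        IsRelRotaBaxter (μ + μ') (ρ + ρ') (T + T') ↔
          IsMaurerCartan (grading K 𝔤 V) (twist bracket F (toElement μ ρ T)) F
            (toElement μ' ρ' T') := by
  refine ⟨isWeaklyFiltered_arityFiltration, fun F hF => ?_⟩
  have hMC := (isMaurerCartan_toElement_iff μ ρ T hF).2 hT
  refine ⟨hMC, fun k _ x => ?_, ?_, fun μ' ρ' T' => ?_⟩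
  · exact (hF.seriesConverges_twistList listBracket_ofFn locallyNilpotent_listBracket _ k x _).2
      (hF.twist_eq listBracket_ofFn locallyNilpotent_listBracket _ k x)
  · exact hF.twist listLInfinity_listBracket listBracket_ofFn locallyNilpotent_listBracket hMC
  · rw [hF.isMaurerCartan_twist_iff listLInfinity_listBracket listBracket_ofFn
      locallyNilpotent_listBracket hMC (toElement_mem μ' ρ' T'), ← toElement_add,
      isMaurerCartan_toElement_iff _ _ _ hF]
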